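/- Let $0<\alpha<2$, $J\ge 1$, and for $j=1,\dots,J$ let $\pi_j>0$, $\beta_j\in[-1,1]$ and let $(d_{j,k})_{k\in\mathbb Z}$ be a real sequence that is not identically zero, such that $\sum_k|d_{j,k}|^s<\infty$ for some $s\in(0,\alpha)\cap[0,1]$ if $\alpha\ne1$ or $\beta_j=0$, and $\sum_k|d_{j,k}|\,\big|\ln|d_{j,k}|\big|<\infty$ if $\alpha=1$ and $\beta_j\ne0$. Let $(\varepsilon_{j,t})_{t\in\mathbb Z}$, $j=1,\dots,J$, be mutually independent i.i.d. sequences with stable law $\mathcal S(\alpha,\beta_j,1,0)$, that is $$\mathbb E\, e^{iu\varepsilon_{j,t}}=\exp\{-|u|^\alpha(1-i\beta_j\,\mathrm{sign}(u)\,w(\alpha,u))\},\qquad w(\alpha,u)=\tan(\pi\alpha/2)\ (\alpha\ne1),\quad w(1,u)=-\tfrac2\pi\ln|u| .$$ Let $X_{j,t}=\sum_{k\in\mathbb Z}d_{j,k}\varepsilon_{j,t+k}$ (almost surely unconditionally convergent series; the latent moving averages) and $X_t=\sum_{j=1}^J\pi_jX_{j,t}$ (the stable aggregate). For $m\ge0$,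 $h\ge1$ put $$\boldsymbol X_t=(X_{t-m},\dots,X_t,X_{t+1},\dots,X_{t+h}),\qquad \boldsymbol d_{j,k}=(d_{j,k+m},\dots,d_{j,k},d_{j,k-1},\dots,d_{j,k-h}).$$ *Definitions.* A past semi-norm on $\mathbb R^{m+h+1}$ is a semi-norm with $\|(x_{-m},\dots,x_h)\|=0\iff x_{-m}=\dots=x_0=0$; its unit cylinder is $C^{\|\cdot\|}=\{s:\|s\|=1\}$. A random vector $\boldsymbol X$ is symmetric if $\boldsymbol X\overset d=-\boldsymbol X$ (S1S when it is moreover $1$-stable). A spectral representation of a vector $\boldsymbol X$ on $C^{\|\cdot\|}$ is a pair $(\Gamma',\mu')$ of a Borel measure on $C^{\|\cdot\|}$ and a vector such that: - if $\boldsymbol X$ is not symmetric, for all $u$, $\int|\langle u,s\rangle|^\alpha\,\Gamma'(ds)<\infty$ (if $\alpha\neq1$), resp. $\int|\langle u,s\rangle|\,\big|\ln|\langle u,s\rangle|\big|\,\Gamma'(ds)<\infty$ (if $\alpha=1$), and $$\mathbb E\,e^{i\langle u,\boldsymbol X\rangle}=\exp\Big\{-\int|\langle u,s\rangle|^\alpha\big(1-i\,\mathrm{sign}(\langle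 u,s\rangle)\,w(\alpha,\langle u,s\rangle)\big)\Gamma'(ds)+i\langle u,\mu'\rangle\Big\};$$ - if $\boldsymbol X$ is symmetric, $\Gamma'$ is symmetric, $\mu'=0$, and for all $u$, $\int|\langle u,s\rangle|^\alpha\,\Gamma'(ds)<\infty$ and $\mathbb E\,e^{i\langle u,\boldsymbol X\rangle}=\exp\{-\int|\langle u,s\rangle|^\alpha\,\Gamma'(ds)\}$. A process is $(m,h)$-past-representable if its paths $\boldsymbol X_t$ have a spectral representation on $C^{\|\cdot\|}$ for some past semi-norm on $\mathbb R^{m+h+1}$, and past-representable if it is $(m,h)$-past-representable for some $m\ge0$, $h\ge1$. Let $m_{0,j}\in\mathbb N\cup\{\infty\}$ be the supremum (zero if the set is empty) of the set of $m\ge1$ such that $d_{j,k+m}=\dots=d_{j,k+1}=0$ and $d_{j,k}\ne0$ for some $k\in\mathbb Z$. For a past semi-norm $\|\cdot\|$, the log-summability condition for the sequence $(d_{j,k})_k$ is $$\sum_{k\in\mathbb Z}\|\boldsymbol d_{j,k}\|_e\,\Big|\ln\big(\|\boldsymbol d_{j,k}\|/\|\boldsymbol d_{j,k}\|_e\big)\Big|<\infty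 ,$$ where $\|\cdot\|_e$ is the Euclidean norm, terms with $\boldsymbol d_{j,k}=0$ are zero, and $|\ln 0|=\infty$. *Proposition.* (i)(a) Let $\alpha\ne1$. Then $(X_t)$ is past-representable if and only if every $(X_{j,t})$, $j=1,\dots,J$, is past-representable, and if and only if $\sup_jm_{0,j}<\infty$. Moreover, for $m\ge0$, $h\ge1$, $(X_t)$ is $(m,h)$-past-representable if and only if $\sup_jm_{0,j}<\infty$ and $m\ge\max_jm_{0,j}$. (i)(b) Let $\alpha=1$, and choose any past semi-norm on each $\mathbb R^{m+h+1}$. Then $(X_t)$ is past-representable if and only if $\sup_jm_{0,j}<\infty$ and there is a pair $(m,h)$, $m\ge\max_jm_{0,j}$, $h\ge1$, such that either $\boldsymbol X_t$ is S1S, or $\boldsymbol X_t$ is not symmetric and the log-summability condition holds for all the sequences $(d_{j,k})_k$, $j=1,\dots,J$. For every such pair, $(X_t)$ is $(m,h)$-past-representable. (ii) Let $(X_t)$ be $(m,h)$-past-representable, $m\ge0$, $h\ge1$, and let $\|\cdot\|$ be any past semi-norm on $\mathbb R^{m+h+1}$. Then $\boldsymbol X_t$ has exactly one spectral representation on $C^{\|\cdot\|}$,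 namely $(\Gamma^{\|\cdot\|},\mu^{\|\cdot\|})$ with $$\Gamma^{\|\cdot\|}=\sum_{j=1}^J\sum_{\vartheta\in\{-1,1\}}\sum_{k\in\mathbb Z}\frac{1+\vartheta\beta_j}2\,\pi_j^\alpha\,\|\boldsymbol d_{j,k}\|^\alpha\,\delta_{\vartheta\boldsymbol d_{j,k}/\|\boldsymbol d_{j,k}\|},\qquad \mu^{\|\cdot\|}=-\mathbf 1_{\{\alpha=1\}}\frac2\pi\sum_{j=1}^J\sum_{k\in\mathbb Z}\pi_j\beta_j\,\boldsymbol d_{j,k}\ln\|\pi_j\boldsymbol d_{j,k}\| ,$$ where terms with $\boldsymbol d_{j,k}=0$ vanish. The series in $\mu^{\|\cdot\|}$ converge absolutely, except possibly if $\alpha=1$ and $\boldsymbol X_t$ is S1S; in that case $\mu^{\|\cdot\|}=0$, and this agrees with the formula whenever the series converge absolutely for every $j$. -/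

import Mathlib

open MeasureTheory ProbabilityTheory
open scoped ENNReal

noncomputable section

namespace StableAgg

/-- The function `w(α, s)`: `tan (π α / 2)` for `α ≠ 1`, and `-(2/π) ln |s|` for `α = 1`. -/
def w (α s : ℝ) : ℝ :=
  if α = 1 then -(2 / Real.pi) * Real.log |s| else Real.tan (Real.pi * α / 2)

/-- The integrand of the stable characteristic exponent, as a function of `x = ⟨u, s⟩`:
`|x|^α (1 - i β sign(x) w(α, x))`. -/
def stableExponent (α β x : ℝ) : ℂ :=
  ((|x| ^ α : ℝ) : ℂ) *
    (1 - Complex.I * ((β * (SignType.sign x : ℝ) * w α x : ℝ) : ℂ))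

/-- The law `ν` on `ℝ` is the stable law `S(α, β, 1, 0)` (scale one, shift zero). -/
def IsStdStableLaw (α β : ℝ) (ν : Measure ℝ) : Prop :=
  ∀ u : ℝ, charFun ν u = Complex.exp (-stableExponent α β u)

/-- Paths of length `m + h + 1` live in this space. Coordinate `i` stands for the time
`t - m + i`: the coordinates `i ≤ m` are the observed ones, the others are the future ones. -/
abbrev PathSpace (m h : ℕ) : Type := EuclideanSpace ℝ (Fin (m + h + 1))

/-- The unit cylinder of a semi-norm. -/
def unitCylinder {m h : ℕ} (N : Seminorm ℝ (PathSpace m h)) : Set (PathSpace m h) :=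
  {s | N s = 1}

/-- Semi-norms which vanish exactly on the vectors whose first `m + 1` (observed)
coordinates are zero. -/
def IsPastSeminorm {m h : ℕ} (N : Seminorm ℝ (PathSpace m h)) : Prop :=
  ∀ x : PathSpace m h, N x = 0 ↔ ∀ i : Fin (m + h + 1), (i : ℕ) ≤ m → x i = 0

/-- A measure on a path space which is invariant under `s ↦ -s`. Applied to the law of a random
vector this says that the vector is symmetric. -/
def IsSymm {m h : ℕ} (ν : Measure (PathSpace m h)) : Prop :=
  ν.map (fun s => -s) = ν

/-- `(Γ, b)` is a spectral representation on the unit cylinder of `N` of a random vector with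
law `ν`. A measure on the cylinder is a Borel measure on the whole space that gives mass zero to
the complement. For a symmetric vector `Γ` has to be symmetric and there is no shift. -/
def IsSpectralRep {m h : ℕ} (α : ℝ) (N : Seminorm ℝ (PathSpace m h))
    (ν : Measure (PathSpace m h)) (Γ : Measure (PathSpace m h)) (b : PathSpace m h) : Prop :=
  Γ (unitCylinder N)ᶜ = 0 ∧
  (IsSymm ν →
    IsSymm Γ ∧ b = 0 ∧
    (∀ u : PathSpace m h, Integrable (fun s => |inner ℝ u s| ^ α) Γ) ∧
    (∀ u : PathSpace m h,
      charFun ν u = Complex.exp (-((∫ s, |inner ℝ u s| ^ α ∂Γ : ℝ) : ℂ)))) ∧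
  (¬ IsSymm ν →
    (α ≠ 1 → ∀ u : PathSpace m h, Integrable (fun s => |inner ℝ u s| ^ α) Γ) ∧
    (α = 1 → ∀ u : PathSpace m h,
      Integrable (fun s => |inner ℝ u s| * |Real.log (|inner ℝ u s|)|) Γ) ∧
    (∀ u : PathSpace m h,
      charFun ν u = Complex.exp
        (-(∫ s, stableExponent α 1 (inner ℝ u s) ∂Γ)
          + Complex.I * ((inner ℝ u b : ℝ) : ℂ))))

/-- A random vector with law `ν` is representable on the unit cylinder of `N`. -/
def IsRepresentable {m h : ℕ} (α : ℝ) (N : Seminorm ℝ (PathSpace m h))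
    (ν : Measure (PathSpace m h)) : Prop :=
  ∃ (Γ : Measure (PathSpace m h)) (b : PathSpace m h), IsSpectralRep α N ν Γ b

/-- The random vector `(X_{t-m}, …, X_t, X_{t+1}, …, X_{t+h})`. -/
def path {Ω : Type*} (X : ℤ → Ω → ℝ) (m h : ℕ) (t : ℤ) (ω : Ω) : PathSpace m h :=
  WithLp.toLp 2 (fun i : Fin (m + h + 1) => X (t - (m : ℤ) + ((i : ℕ) : ℤ)) ω)

/-- The law of the path `(X_{t-m}, …, X_{t+h})`. -/
def pathLaw {Ω : Type*} [MeasurableSpace Ω] (μ : Measure Ω) (X : ℤ → Ω → ℝ)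
    (m h : ℕ) (t : ℤ) : Measure (PathSpace m h) :=
  μ.map (path X m h t)

/-- `(m, h)`-past-representability of a process. -/
def IsPastRepresentableAt {Ω : Type*} [MeasurableSpace Ω] (μ : Measure Ω) (α : ℝ)
    (X : ℤ → Ω → ℝ) (m h : ℕ) : Prop :=
  ∃ N : Seminorm ℝ (PathSpace m h), IsPastSeminorm N ∧
    ∀ t : ℤ, IsRepresentable α N (pathLaw μ X m h t)

/-- Past-representability of a process. -/
def IsPastRepresentable {Ω : Type*} [MeasurableSpace Ω] (μ : Measure Ω) (α : ℝ)
    (X : ℤ → Ω → ℝ) : Prop :=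
  ∃ m h : ℕ, 1 ≤ h ∧ IsPastRepresentableAt μ α X m h

/-- The standing conditions on the coefficients of a moving average. -/
structure CoeffCondition (α β : ℝ) (d : ℤ → ℝ) : Prop where
  ne_zero : ∃ k, d k ≠ 0
  summable_rpow : (α ≠ 1 ∨ β = 0) →
    ∃ s : ℝ, 0 < s ∧ s < α ∧ s ≤ 1 ∧ Summable (fun k => |d k| ^ s)
  summable_log : α = 1 → β ≠ 0 → Summable (fun k => |d k| * |Real.log (|d k|)|)

/-- `X_t = ∑_k d_k ε_{t+k}`, the series being almost surely (unconditionally) convergent. -/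
def IsMovingAverage {Ω : Type*} [MeasurableSpace Ω] (μ : Measure Ω)
    (d : ℤ → ℝ) (ε X : ℤ → Ω → ℝ) : Prop :=
  ∀ t : ℤ, ∀ᵐ ω ∂μ, HasSum (fun k : ℤ => d k * ε (t + k) ω) (X t ω)

/-- `X` is the stable aggregate `X_t = ∑_j p_j X_{j,t}` of the latent moving averages `L j`,
with coefficients `d j` and errors `ε j`: the error sequences are mutually independent, and
each of them is i.i.d. with law `S(α, β_j, 1, 0)`. -/
structure IsStableAggregate {Ω : Type*} [MeasurableSpace Ω] (μ : Measure Ω) {J : ℕ}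
    (α : ℝ) (β p : Fin J → ℝ) (d : Fin J → ℤ → ℝ) (ε L : Fin J → ℤ → Ω → ℝ)
    (X : ℤ → Ω → ℝ) : Prop where
  skewness : ∀ j, β j ∈ Set.Icc (-1 : ℝ) 1
  weight_pos : ∀ j, 0 < p j
  coeff : ∀ j, CoeffCondition α (β j) (d j)
  measurable : ∀ j t, Measurable (ε j t)
  indep : iIndepFun (fun q : Fin J × ℤ => ε q.1 q.2) μ
  law : ∀ j t, IsStdStableLaw α (β j) (μ.map (ε j t))
  latent : ∀ j, IsMovingAverage μ (d j) (ε j) (L j)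
  aggregate : ∀ t, ∀ᵐ ω ∂μ, X t ω = ∑ j, p j * L j t ω

/-- The set of lengths `m ≥ 1` such that `d_{k+m} = … = d_{k+1} = 0` and `d_k ≠ 0`
for some `k`. -/
def zeroRuns (d : ℤ → ℝ) : Set ℕ :=
  {m | 1 ≤ m ∧ ∃ k : ℤ, (∀ i : ℕ, 1 ≤ i → i ≤ m → d (k + i) = 0) ∧ d k ≠ 0}

/-- The supremum of `zeroRuns d` in `ℕ ∪ {∞}`; it is zero when that set is empty. -/
def m₀ (d : ℤ → ℝ) : ℕ∞ := ⨆ m ∈ zeroRuns d, (m : ℕ∞)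

/-- The vector `(d_{k+m}, …, d_k, d_{k-1}, …, d_{k-h})`. -/
def coeffVec (d : ℤ → ℝ) (m h : ℕ) (k : ℤ) : PathSpace m h :=
  WithLp.toLp 2 (fun i : Fin (m + h + 1) => d (k + (m : ℤ) - ((i : ℕ) : ℤ)))

/-- `∑_k ‖d_k‖_e |ln (N(d_k) / ‖d_k‖_e)| < ∞`, where the term of a vector `d_k = 0` is zero and
`|ln 0| = ∞`, which the first conjunct expresses. -/
def LogSummable {m h : ℕ} (N : Seminorm ℝ (PathSpace m h)) (d : ℤ → ℝ) : Prop :=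
  (∀ k, N (coeffVec d m h k) = 0 → coeffVec d m h k = 0) ∧
  Summable (fun k : ℤ =>
    ‖coeffVec d m h k‖ * |Real.log (N (coeffVec d m h k) / ‖coeffVec d m h k‖)|)

/-- The measure `∑_j ∑_{θ = ±1} ∑_k ((1 + θ β_j) / 2) p_j^α N(d_{j,k})^α δ_{θ d_{j,k} / N(d_{j,k})}`;
the terms with `N(d_{j,k}) = 0` vanish. -/
def cylinderMeasure {m h J : ℕ} (α : ℝ) (β p : Fin J → ℝ) (d : Fin J → ℤ → ℝ)
    (N : Seminorm ℝ (PathSpace m h)) : Measure (PathSpace m h) :=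
  ∑ j : Fin J, ∑ θ ∈ ({1, -1} : Finset ℝ), Measure.sum (fun k : ℤ =>
    ENNReal.ofReal ((1 + θ * β j) / 2 * p j ^ α * N (coeffVec (d j) m h k) ^ α) •
      Measure.dirac ((θ / N (coeffVec (d j) m h k)) • coeffVec (d j) m h k))

/-- The term `-1_{α = 1} (2/π) p_j β_j d_{j,k} ln N(p_j d_{j,k})` of the shift vector. -/
def shiftTerm {m h J : ℕ} (α : ℝ) (β p : Fin J → ℝ) (d : Fin J → ℤ → ℝ)
    (N : Seminorm ℝ (PathSpace m h)) (j : Fin J) (k : ℤ) : PathSpace m h :=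
  (if α = 1 then
      -(2 / Real.pi) * (p j * β j * Real.log (N (p j • coeffVec (d j) m h k)))
    else 0) • coeffVec (d j) m h k

/-- The shift vector `-1_{α = 1} (2/π) ∑_j ∑_k p_j β_j d_{j,k} ln N(p_j d_{j,k})`. -/
def cylinderShift {m h J : ℕ} (α : ℝ) (β p : Fin J → ℝ) (d : Fin J → ℤ → ℝ)
    (N : Seminorm ℝ (PathSpace m h)) : PathSpace m h :=
  ∑ j : Fin J, ∑' k : ℤ, shiftTerm α β p d N j k

end StableAgg

end

set_option linter.unusedSectionVars false

noncomputable section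

/-! The characteristic function of a path is `exp (-ψ)`, where ψ(u) is the integral of
`stableExponent α 1 ⟨u, s⟩` against Γ₀ = `rawMeasure`, whose atoms are the unnormalised vectors ±
p_j d_{j,k} (`IsStableAggregate.charFun_pathLaw`). A spectral representation on a cylinder is
another measure with the same exponent up to a linear term. So two questions remain: how far the
exponent determines the measure, and when Γ₀ can be moved radially onto the cylinder.

For the first, spread a measure Γ along rays with density r^(-1-α) dr to get a Lévy measure. The
integral of e^{ixr} (1 - cos yr) over a ray is a fixed real-linear function of the second difference
of the stable exponent (`exists_integral_rayKernel`), and second differences ignore linear terms.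
Hence the exponent fixes, for every v, the Fourier transform of the finite measure with density 1 -
cos⟨v, x⟩ with respect to the Lévy measure, and so the Lévy measure off the origin. This in turn
fixes the radial projection `cylProj` (the mass of {N > 1} by direction) and tells whether Γ charges
{N = 0} minus the origin (`cylProj_eq_of_levyChar_eq`). A measure on the cylinder is its own
projection and does not charge that kernel. This gives uniqueness, and Γ₀ must not charge the kernel
either (`IsSpectralRep.eq_cylProj`). For Γ₀ that says that no nonzero window of coefficients
vanishes on its observed part, which is m₀ ≤ m (`kernel_coeffVec_iff_m₀_le`).

Conversely |x|^α, and for α ≠ 1 the whole stable exponent, is positively homogeneous, so the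
projection preserves the exponent. For α = 1 the logarithm leaves a linear term, the shift -(2/π) ∫
log N(s) s Γ₀(ds). Its absolute convergence is equivalent to admissibility of the projected measure
(`isAdmissible_cylProj_iff`) and, given the kernel condition, to log-summability
(`logSummable_iff`). For a symmetric path only the real part of the exponent is used, and no
logarithmic condition arises. -/

namespace StableAgg

/-! ### Cosine and compensated sine integrals along a ray -/

/-- The measure `r ^ (-1 - α) dr` on the positive half-line. -/
def rayMeasure (α : ℝ) : Measure ℝ :=
  (volume.restrict (Set.Ioi 0)).withDensity (fun r => ENNReal.ofReal (r ^ (-1 - α)))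

lemma measurable_rayDensity (α : ℝ) :
    Measurable (fun r : ℝ => ENNReal.ofReal (r ^ (-1 - α))) := by fun_prop

lemma integrable_rayMeasure_iff {α : ℝ} {f : ℝ → ℝ} :
    Integrable f (rayMeasure α) ↔ IntegrableOn (fun r => f r * r ^ (-1 - α)) (Set.Ioi 0) := by
  rw [rayMeasure, integrable_withDensity_iff (measurable_rayDensity α) (by simp)]
  refine integrable_congr ?_
  filter_upwards [self_mem_ae_restrict measurableSet_Ioi] with r hr
  rw [ENNReal.toReal_ofReal (Real.rpow_nonneg (le_of_lt hr) _)]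

lemma integral_rayMeasure {α : ℝ} (f : ℝ → ℝ) :
    ∫ r, f r ∂(rayMeasure α) = ∫ r in Set.Ioi 0, f r * r ^ (-1 - α) := by
  rw [rayMeasure, integral_withDensity_eq_integral_toReal_smul (measurable_rayDensity α) (by simp)]
  refine integral_congr_ae ?_
  filter_upwards [self_mem_ae_restrict measurableSet_Ioi] with r hr
  rw [ENNReal.toReal_ofReal (Real.rpow_nonneg (le_of_lt hr) _), smul_eq_mul, mul_comm]

instance (α : ℝ) : SFinite (rayMeasure α) := by unfold rayMeasure; infer_instance

lemma ae_rayMeasure_pos (α : ℝ) : ∀ᵐ r ∂(rayMeasure α), 0 < r :=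
  (withDensity_absolutelyContinuous _ _).ae_le (self_mem_ae_restrict measurableSet_Ioi)

/-- Near 0 the integrand is at most a multiple of r^(1-α), integrable since α < 2. Beyond 1 it is at
most a multiple of r^(-1-α), integrable since α > 0. -/
lemma integrable_rayMeasure_of_bound {α : ℝ} (hα₀ : 0 < α) (hα₂ : α < 2) {f : ℝ → ℝ}
    (hf : Measurable f) {C : ℝ} (h₁ : ∀ r, 0 < r → r ≤ 1 → |f r| ≤ C * r ^ 2)
    (h₂ : ∀ r, 1 < r → |f r| ≤ C) : Integrable f (rayMeasure α) := by
  rw [integrable_rayMeasure_iff]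
  have hm : Measurable (fun r : ℝ => f r * r ^ (-1 - α)) := by fun_prop
  rw [← Set.Ioc_union_Ioi_eq_Ioi (zero_le_one' ℝ)]
  refine IntegrableOn.union ?_ ?_
  · have h0 : IntegrableOn (fun r : ℝ => C * r ^ (1 - α)) (Set.Ioc 0 1) := by
      rw [integrableOn_Ioc_iff_integrableOn_Ioo]
      exact ((intervalIntegral.integrableOn_Ioo_rpow_iff one_pos).2 (by linarith)).const_mul _
    refine h0.mono' hm.aestronglyMeasurable ?_
    filter_upwards [self_mem_ae_restrict measurableSet_Ioc] with r hr
    rw [Real.norm_eq_abs, abs_mul, abs_of_nonneg (Real.rpow_nonneg hr.1.le _)]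
    calc |f r| * r ^ (-1 - α) ≤ C * r ^ 2 * r ^ (-1 - α) :=
          mul_le_mul_of_nonneg_right (h₁ r hr.1 hr.2) (Real.rpow_nonneg hr.1.le _)
      _ = C * r ^ (1 - α) := by
          rw [mul_assoc, ← Real.rpow_natCast, ← Real.rpow_add hr.1]; norm_num; left; ring_nf
  · have h0 : IntegrableOn (fun r : ℝ => C * r ^ (-1 - α)) (Set.Ioi 1) :=
      (integrableOn_Ioi_rpow_of_lt (by linarith) one_pos).const_mul _
    refine h0.mono' hm.aestronglyMeasurable ?_
    filter_upwards [self_mem_ae_restrict measurableSet_Ioi] with r hr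
    have hr' : (1 : ℝ) < r := hr
    have : 0 ≤ r ^ (-1 - α) := Real.rpow_nonneg (by linarith) _
    rw [Real.norm_eq_abs, abs_mul, abs_of_nonneg this]
    exact mul_le_mul_of_nonneg_right (h₂ r hr') this

lemma integrable_one_sub_cos {α : ℝ} (hα₀ : 0 < α) (hα₂ : α < 2) (x : ℝ) :
    Integrable (fun r => 1 - Real.cos (x * r)) (rayMeasure α) := by
  refine integrable_rayMeasure_of_bound (C := x ^ 2 + 2) hα₀ hα₂ (by fun_prop) ?_ ?_
  · intro r hr _
    rw [abs_of_nonneg (by linarith [Real.cos_le_one (x * r)])]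
    have := Real.one_sub_sq_div_two_le_cos (x := x * r)
    nlinarith [sq_nonneg (x * r), sq_nonneg r]
  · intro r _
    rw [abs_of_nonneg (by linarith [Real.cos_le_one (x * r)])]
    nlinarith [Real.neg_one_le_cos (x * r), sq_nonneg x]

/-- Substitute t = x r for x > 0 and use evenness otherwise. The rescaling rule holds for Bochner
integrals without integrability. -/
lemma integral_one_sub_cos (α : ℝ) (x : ℝ) (hα₀ : 0 < α) :
    ∫ r, (1 - Real.cos (x * r)) ∂(rayMeasure α)
      = |x| ^ α * ∫ r, (1 - Real.cos r) ∂(rayMeasure α) := by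
  have key : ∀ x : ℝ, 0 < x → ∫ r, (1 - Real.cos (x * r)) ∂(rayMeasure α)
      = x ^ α * ∫ r, (1 - Real.cos r) ∂(rayMeasure α) := by
    intro x hx
    rw [integral_rayMeasure, integral_rayMeasure]
    have h := integral_comp_mul_left_Ioi
      (fun t : ℝ => (1 - Real.cos t) * t ^ (-1 - α)) 0 hx
    have h2 : ∫ r in Set.Ioi (0 : ℝ), (1 - Real.cos (x * r)) * (x * r) ^ (-1 - α)
        = x ^ (-1 - α) * ∫ r in Set.Ioi (0 : ℝ), (1 - Real.cos (x * r)) * r ^ (-1 - α) := by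
      rw [← integral_const_mul]
      refine setIntegral_congr_fun measurableSet_Ioi fun r hr => ?_
      rw [Real.mul_rpow hx.le (le_of_lt hr)]; ring
    rw [mul_zero, smul_eq_mul, h2] at h
    have h3 : x ^ (-1 - α) * x ^ (1 + α) = 1 := by
      rw [← Real.rpow_add hx]; norm_num
    have h4 : x⁻¹ * x ^ (1 + α) = x ^ α := by
      rw [Real.rpow_add hx, Real.rpow_one]; field_simp
    calc _ = x ^ (-1 - α) * x ^ (1 + α) *
          ∫ r in Set.Ioi (0 : ℝ), (1 - Real.cos (x * r)) * r ^ (-1 - α) := by rw [h3, one_mul]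
      _ = x ^ (1 + α) * (x ^ (-1 - α) *
          ∫ r in Set.Ioi (0 : ℝ), (1 - Real.cos (x * r)) * r ^ (-1 - α)) := by ring
      _ = _ := by rw [h, ← h4]; ring
  rcases lt_trichotomy x 0 with hx | hx | hx
  · rw [← key |x| (abs_pos.2 hx.ne), abs_of_neg hx]
    simp
  · subst hx; simp [Real.zero_rpow hα₀.ne']
  · rw [abs_of_pos hx, key x hx]

lemma abs_sin_sub_self_le (t : ℝ) : |Real.sin t - t| ≤ 2 * t ^ 2 := by
  have key : ∀ t : ℝ, 0 < t → |Real.sin t - t| ≤ 2 * t ^ 2 := by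
    intro t ht
    have h1 := Real.sin_gt_sub_cube ht
    have h2 := Real.sin_le ht.le
    rw [abs_le]
    refine ⟨?_, by nlinarith⟩
    by_cases h : t ≤ 1
    · nlinarith [mul_nonneg (sq_nonneg t) (sub_nonneg.2 h), sq_nonneg t]
    · nlinarith [Real.neg_one_le_sin t]
  rcases lt_trichotomy t 0 with h | h | h
  · have := key (-t) (by linarith)
    rw [Real.sin_neg, neg_sq, ← abs_neg] at this
    convert this using 2; ring
  · subst h; simp
  · exact key t h

/-- The truncation `r` for `r ≤ a`, and `0` beyond. -/
def truncId (a r : ℝ) : ℝ := if r ≤ a then r else 0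

lemma measurable_truncId (a : ℝ) : Measurable (truncId a) :=
  Measurable.ite measurableSet_Iic measurable_id measurable_const

/-- For α ≥ 1 and x ≠ 0 the function sin(xr) alone is not integrable near 0. The compensator removes
its linear part and leaves O(r²). -/
lemma integrable_sin_sub {α : ℝ} (hα₀ : 0 < α) (hα₂ : α < 2) (x : ℝ) :
    Integrable (fun r => Real.sin (x * r) - x * truncId 1 r) (rayMeasure α) := by
  have := measurable_truncId 1
  refine integrable_rayMeasure_of_bound (C := 2 * x ^ 2 + 1) hα₀ hα₂ (by fun_prop) ?_ ?_
  · intro r hr hr1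
    rw [truncId, if_pos hr1]
    have := abs_sin_sub_self_le (x * r)
    nlinarith [sq_nonneg r]
  · intro r hr
    rw [truncId, if_neg (not_le.2 hr), mul_zero, sub_zero]
    nlinarith [Real.abs_sin_le_one (x * r), sq_nonneg x]

/-- Substituting t = x r in the compensated sine integral moves the cutoff from 1 to x. This is the
resulting correction, supported between 1 and x. The oriented interval integral takes care of the
sign. -/
lemma integral_truncId_sub (α : ℝ) {x : ℝ} (hx : 0 < x) :
    IntegrableOn (fun t => (truncId 1 t - truncId x t) * t ^ (-1 - α)) (Set.Ioi 0) ∧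
    ∫ t in Set.Ioi (0 : ℝ), (truncId 1 t - truncId x t) * t ^ (-1 - α)
      = -∫ t in (1 : ℝ)..x, t ^ (-α) := by
  have hpow : ∀ t : ℝ, 0 < t → t * t ^ (-1 - α) = t ^ (-α) := by
    intro t ht
    nth_rw 1 [← Real.rpow_one t]
    rw [← Real.rpow_add ht]; ring_nf
  have hi : IntervalIntegrable (fun t : ℝ => t ^ (-α)) volume 1 x :=
    intervalIntegral.intervalIntegrable_rpow (Or.inr (by
      rw [Set.mem_uIcc]; rintro (h | h) <;> linarith [h.1, h.2]))
  rcases le_total 1 x with h | h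
  · have e : ∀ t ∈ Set.Ioi (0 : ℝ), (truncId 1 t - truncId x t) * t ^ (-1 - α)
        = (Set.Ioc 1 x).indicator (fun t => -t ^ (-α)) t := by
      intro t ht
      by_cases h1 : t ≤ 1
      · rw [Set.indicator_of_notMem (fun hh => not_lt.2 h1 hh.1), truncId, truncId, if_pos h1,
          if_pos (h1.trans h), sub_self, zero_mul]
      · by_cases h2 : t ≤ x
        · rw [Set.indicator_of_mem (Set.mem_Ioc.2 ⟨not_le.1 h1, h2⟩), truncId, truncId, if_neg h1,
            if_pos h2, ← hpow t ht]; ring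
        · rw [Set.indicator_of_notMem (fun hh => h2 hh.2), truncId, truncId, if_neg h1, if_neg h2,
            sub_self, zero_mul]
    have hsub : Set.Ioc 1 x ∩ Set.Ioi 0 = Set.Ioc 1 x :=
      Set.inter_eq_left.2 fun t (ht : t ∈ Set.Ioc 1 x) => lt_trans one_pos ht.1
    constructor
    · rw [integrableOn_congr_fun e measurableSet_Ioi]
      exact ((intervalIntegrable_iff_integrableOn_Ioc_of_le h).1 hi).neg.integrable_indicator
        measurableSet_Ioc |>.integrableOn
    · rw [setIntegral_congr_fun measurableSet_Ioi e, integral_indicator measurableSet_Ioc,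
        Measure.restrict_restrict measurableSet_Ioc, hsub, integral_neg,
        intervalIntegral.integral_of_le h]
  · have e : ∀ t ∈ Set.Ioi (0 : ℝ), (truncId 1 t - truncId x t) * t ^ (-1 - α)
        = (Set.Ioc x 1).indicator (fun t => t ^ (-α)) t := by
      intro t ht
      by_cases h1 : t ≤ x
      · rw [Set.indicator_of_notMem (fun hh => not_lt.2 h1 hh.1), truncId, truncId, if_pos h1,
          if_pos (h1.trans h), sub_self, zero_mul]
      · by_cases h2 : t ≤ 1
        · rw [Set.indicator_of_mem (Set.mem_Ioc.2 ⟨not_le.1 h1, h2⟩), truncId, truncId, if_neg h1, if_pos h2,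
            ← hpow t ht]; ring
        · rw [Set.indicator_of_notMem (fun hh => h2 hh.2), truncId, truncId, if_neg h1, if_neg h2,
            sub_self, zero_mul]
    have hsub : Set.Ioc x 1 ∩ Set.Ioi 0 = Set.Ioc x 1 :=
      Set.inter_eq_left.2 fun t (ht : t ∈ Set.Ioc x 1) => lt_trans hx ht.1
    constructor
    · rw [integrableOn_congr_fun e measurableSet_Ioi]
      exact ((intervalIntegrable_iff_integrableOn_Ioc_of_le h).1 hi.symm).integrable_indicator
        measurableSet_Ioc |>.integrableOn
    · rw [setIntegral_congr_fun measurableSet_Ioi e, integral_indicator measurableSet_Ioc,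
        Measure.restrict_restrict measurableSet_Ioc, hsub, intervalIntegral.integral_symm, neg_neg,
        intervalIntegral.integral_of_le h]

/-- Scaling would give a pure factor x^α, were it not for the moved cutoff. The correction is log x
for α = 1, which is where the logarithm in `w 1` comes from. -/
lemma integral_sin_sub_of_pos {α : ℝ} (hα₀ : 0 < α) (hα₂ : α < 2) {x : ℝ} (hx : 0 < x) :
    ∫ r, (Real.sin (x * r) - x * truncId 1 r) ∂(rayMeasure α)
      = x ^ α * (∫ r, (Real.sin (1 * r) - 1 * truncId 1 r) ∂(rayMeasure α)
          - ∫ t in (1 : ℝ)..x, t ^ (-α)) := by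
  obtain ⟨hi, hI⟩ := integral_truncId_sub α hx
  have hs := integrable_rayMeasure_iff.1 (integrable_sin_sub hα₀ hα₂ 1)
  rw [integral_rayMeasure, integral_rayMeasure, sub_eq_add_neg (∫ r in _, _), ← hI,
    ← integral_add hs hi]
  have h := integral_comp_mul_left_Ioi
    (fun t : ℝ => (Real.sin (1 * t) - 1 * truncId 1 t) * t ^ (-1 - α)
      + (truncId 1 t - truncId x t) * t ^ (-1 - α)) 0 hx
  have h2 : ∫ r in Set.Ioi (0 : ℝ), ((Real.sin (1 * (x * r)) - 1 * truncId 1 (x * r))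
        * (x * r) ^ (-1 - α) + (truncId 1 (x * r) - truncId x (x * r)) * (x * r) ^ (-1 - α))
      = x ^ (-1 - α) * ∫ r in Set.Ioi (0 : ℝ),
          (Real.sin (x * r) - x * truncId 1 r) * r ^ (-1 - α) := by
    rw [← integral_const_mul]
    refine setIntegral_congr_fun measurableSet_Ioi fun r hr => ?_
    have : truncId x (x * r) = x * truncId 1 r := by
      unfold truncId
      by_cases h : r ≤ 1
      · rw [if_pos h, if_pos (by nlinarith)]
      · rw [if_neg h, if_neg (by push Not at h ⊢; nlinarith), mul_zero]
    rw [Real.mul_rpow hx.le (le_of_lt hr), this]; ring_nf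
  rw [mul_zero, smul_eq_mul, h2] at h
  have h3 : x ^ (-1 - α) * x ^ (1 + α) = 1 := by
    rw [← Real.rpow_add hx]; norm_num
  have h4 : x⁻¹ * x ^ (1 + α) = x ^ α := by
    rw [Real.rpow_add hx, Real.rpow_one]; field_simp
  calc _ = x ^ (-1 - α) * x ^ (1 + α) * ∫ r in Set.Ioi (0 : ℝ),
          (Real.sin (x * r) - x * truncId 1 r) * r ^ (-1 - α) := by rw [h3, one_mul]
    _ = x ^ (1 + α) * (x ^ (-1 - α) * ∫ r in Set.Ioi (0 : ℝ),
          (Real.sin (x * r) - x * truncId 1 r) * r ^ (-1 - α)) := by ring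
    _ = _ := by rw [h, ← h4]; ring

/-- Allows x^α to be written as a multiple of the imaginary part of the exponent when α ≠ 1. -/
lemma tan_half_pi_mul_ne_zero {α : ℝ} (hα₀ : 0 < α) (hα₂ : α < 2) (hα : α ≠ 1) :
    Real.tan (Real.pi * α / 2) ≠ 0 := by
  have hs : 0 < Real.sin (Real.pi * α / 2) :=
    Real.sin_pos_of_pos_of_lt_pi (by positivity) (by nlinarith [Real.pi_pos])
  have hc : Real.cos (Real.pi * α / 2) ≠ 0 := by
    rcases lt_or_gt_of_ne hα with h | h
    · exact (Real.cos_pos_of_mem_Ioo ⟨by nlinarith [Real.pi_pos], by nlinarith [Real.pi_pos]⟩).ne'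
    · exact (Real.cos_neg_of_pi_div_two_lt_of_lt (by nlinarith [Real.pi_pos])
        (by nlinarith [Real.pi_pos])).ne
  rw [Real.tan_eq_sin_div_cos]
  exact div_ne_zero hs.ne' hc

lemma stableExponent_re (α β x : ℝ) : (stableExponent α β x).re = |x| ^ α := by
  simp [stableExponent]

lemma stableExponent_im (α β x : ℝ) :
    (stableExponent α β x).im = -(|x| ^ α * (β * (SignType.sign x : ℝ) * w α x)) := by
  simp [stableExponent]

/-- Up to a linear term, the imaginary part of the stable exponent is a regularised sine integral. -/
lemma exists_integral_sin_sub {α : ℝ} (hα₀ : 0 < α) (hα₂ : α < 2) :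
    ∃ b c : ℝ, ∀ x : ℝ, ∫ r, (Real.sin (x * r) - x * truncId 1 r) ∂(rayMeasure α)
      = b * (stableExponent α 1 x).im + c * x := by
  -- Both sides are odd in x and vanish at 0.
  suffices h : ∃ b c : ℝ, ∀ x : ℝ, 0 < x →
      ∫ r, (Real.sin (x * r) - x * truncId 1 r) ∂(rayMeasure α)
        = b * (stableExponent α 1 x).im + c * x by
    obtain ⟨b, c, h⟩ := h
    refine ⟨b, c, fun x => ?_⟩
    rcases lt_trichotomy x 0 with hx | hx | hx
    · have h1 := h (-x) (by linarith)
      have h2 : ∫ r, (Real.sin (-x * r) - -x * truncId 1 r) ∂(rayMeasure α)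
          = -∫ r, (Real.sin (x * r) - x * truncId 1 r) ∂(rayMeasure α) := by
        rw [← integral_neg]; congr 1; ext r; rw [neg_mul, Real.sin_neg]; ring
      have h3 : (stableExponent α 1 (-x)).im = -(stableExponent α 1 x).im := by
        simp only [stableExponent_im, abs_neg, w, Left.sign_neg, SignType.coe_neg]; ring
      rw [h2, h3] at h1
      linarith
    · subst hx; simp [stableExponent_im]
    · exact h x hx
  obtain ⟨K, hK⟩ : ∃ K, K = ∫ r, (Real.sin (1 * r) - 1 * truncId 1 r) ∂(rayMeasure α) := ⟨_, rfl⟩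
  have him : ∀ x : ℝ, 0 < x → (stableExponent α 1 x).im = -(x ^ α * w α x) := by
    intro x hx
    rw [stableExponent_im, sign_pos hx, abs_of_pos hx]; simp
  by_cases hα : α = 1
  · subst hα
    -- For x > 0 the imaginary part is (2/π) x log x, and the integral is x (K - log x).
    refine ⟨-(Real.pi / 2), K, fun x hx => ?_⟩
    rw [integral_sin_sub_of_pos hα₀ hα₂ hx, him x hx, ← hK]
    have : ∫ t in (1 : ℝ)..x, t ^ (-1 : ℝ) = Real.log x := by
      rw [← div_one x, ← integral_one_div_of_pos one_pos hx, div_one]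
      congr 1; ext t; rw [Real.rpow_neg_one, one_div]
    rw [this, Real.rpow_one, w, if_pos rfl, abs_of_pos hx]
    have := Real.pi_ne_zero
    field_simp
    ring
  · have ht := tan_half_pi_mul_ne_zero hα₀ hα₂ hα
    have h1 : 1 - α ≠ 0 := fun h => hα (by linarith)
    -- The integral is x^α (K + 1/(1-α)) - x/(1-α), and the imaginary part is -x^α tan(πα/2). The
    -- value of K plays no role.
    refine ⟨-((K + 1 / (1 - α)) / Real.tan (Real.pi * α / 2)), -(1 / (1 - α)), fun x hx => ?_⟩
    rw [integral_sin_sub_of_pos hα₀ hα₂ hx, him x hx, w, if_neg hα, ← hK]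
    have hI : ∫ t in (1 : ℝ)..x, t ^ (-α) = (x ^ (1 - α) - 1) / (1 - α) := by
      rw [integral_rpow (Or.inr ⟨fun h => hα (by linarith), by
        rw [Set.mem_uIcc]; rintro (h | h) <;> linarith [h.1, h.2]⟩), Real.one_rpow]
      ring_nf
    have hx1 : x ^ α * x ^ (1 - α) = x := by rw [← Real.rpow_add hx]; simp
    rw [hI]
    have e1 : x ^ α * (K - (x ^ (1 - α) - 1) / (1 - α))
        = x ^ α * (K + 1 / (1 - α)) - (x ^ α * x ^ (1 - α)) / (1 - α) := by ring
    have e2 : -((K + 1 / (1 - α)) / Real.tan (Real.pi * α / 2))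
        * -(x ^ α * Real.tan (Real.pi * α / 2)) = x ^ α * (K + 1 / (1 - α)) := by
      rw [neg_mul_neg, mul_left_comm, div_mul_cancel₀ _ ht]
    rw [e1, hx1, e2]
    ring

/-! ### The weighted Fourier kernel on a ray and second differences -/

/-- The second difference of the stable exponent. -/
def secondDiff {V : Type*} [AddCommGroup V] (F : V → ℂ) (x y : V) : ℂ :=
  F (x + y) + F (x - y) - 2 * F x

lemma integrable_cos_mul {α : ℝ} (hα₀ : 0 < α) (hα₂ : α < 2) (x y : ℝ) :
    Integrable (fun r => Real.cos (x * r) * (1 - Real.cos (y * r))) (rayMeasure α) := by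
  refine (integrable_one_sub_cos hα₀ hα₂ y).mono' (by fun_prop) (ae_of_all _ fun r => ?_)
  rw [Real.norm_eq_abs, abs_mul, abs_of_nonneg (sub_nonneg.2 (Real.cos_le_one _))]
  exact mul_le_of_le_one_left (sub_nonneg.2 (Real.cos_le_one _)) (Real.abs_cos_le_one _)

lemma integrable_sin_mul {α : ℝ} (hα₀ : 0 < α) (hα₂ : α < 2) (x y : ℝ) :
    Integrable (fun r => Real.sin (x * r) * (1 - Real.cos (y * r))) (rayMeasure α) := by
  refine (integrable_one_sub_cos hα₀ hα₂ y).mono' (by fun_prop) (ae_of_all _ fun r => ?_)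
  rw [Real.norm_eq_abs, abs_mul, abs_of_nonneg (sub_nonneg.2 (Real.cos_le_one _))]
  exact mul_le_of_le_one_left (sub_nonneg.2 (Real.cos_le_one _)) (Real.abs_sin_le_one _)

/-- The integrand of the characteristic function of the Lévy measure. -/
def rayKernel (x y r : ℝ) : ℂ :=
  Complex.exp ((x * r : ℝ) * Complex.I) * ((1 - Real.cos (y * r) : ℝ) : ℂ)

lemma rayKernel_eq (x y r : ℝ) : rayKernel x y r =
    ((Real.cos (x * r) * (1 - Real.cos (y * r)) : ℝ) : ℂ)
      + ((Real.sin (x * r) * (1 - Real.cos (y * r)) : ℝ) : ℂ) * Complex.I := by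
  rw [rayKernel, Complex.exp_mul_I]; push_cast; ring

lemma norm_rayKernel (x y r : ℝ) : ‖rayKernel x y r‖ = 1 - Real.cos (y * r) := by
  rw [rayKernel, norm_mul, Complex.norm_exp_ofReal_mul_I, one_mul, Complex.norm_real,
    Real.norm_of_nonneg (sub_nonneg.2 (Real.cos_le_one _))]

/-- The ray integral of the kernel is a real-linear function of the second difference of the stable
exponent. -/
lemma exists_integral_rayKernel {α : ℝ} (hα₀ : 0 < α) (hα₂ : α < 2) :
    ∃ a b : ℝ, ∀ x y : ℝ, ∫ r, rayKernel x y r ∂(rayMeasure α)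
      = ((a * (secondDiff (stableExponent α 1) x y).re : ℝ) : ℂ)
        + ((b * (secondDiff (stableExponent α 1) x y).im : ℝ) : ℂ) * Complex.I := by
  obtain ⟨b, c, hH⟩ := exists_integral_sin_sub hα₀ hα₂
  set K := ∫ r, (1 - Real.cos r) ∂(rayMeasure α)
  refine ⟨K / 2, -(b / 2), fun x y => ?_⟩
  have hcos : ∫ r, Real.cos (x * r) * (1 - Real.cos (y * r)) ∂(rayMeasure α)
      = K / 2 * (|x + y| ^ α + |x - y| ^ α - 2 * |x| ^ α) := by
    have e : ∀ r, Real.cos (x * r) * (1 - Real.cos (y * r))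
        = (1 / 2) * (1 - Real.cos ((x + y) * r)) + (1 / 2) * (1 - Real.cos ((x - y) * r))
          - (1 - Real.cos (x * r)) := by
      intro r
      rw [add_mul, sub_mul, Real.cos_add, Real.cos_sub]; ring
    simp_rw [e]
    have i1 := (integrable_one_sub_cos hα₀ hα₂ (x + y)).const_mul (1 / 2)
    have i2 := (integrable_one_sub_cos hα₀ hα₂ (x - y)).const_mul (1 / 2)
    have i3 := integrable_one_sub_cos hα₀ hα₂ x
    have i4 : Integrable (fun r => (1 / 2) * (1 - Real.cos ((x + y) * r))
      + (1 / 2) * (1 - Real.cos ((x - y) * r))) (rayMeasure α) := i1.add i2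
    rw [integral_sub i4 i3, integral_add i1 i2, integral_const_mul, integral_const_mul,
      integral_one_sub_cos α _ hα₀, integral_one_sub_cos α _ hα₀, integral_one_sub_cos α _ hα₀]
    ring
  have hsin : ∫ r, Real.sin (x * r) * (1 - Real.cos (y * r)) ∂(rayMeasure α)
      = -(b / 2) * ((stableExponent α 1 (x + y)).im + (stableExponent α 1 (x - y)).im
          - 2 * (stableExponent α 1 x).im) := by
    -- Product-to-sum formula. The compensators may be inserted because x = (x+y)/2 + (x-y)/2. The
    -- same cancellation removes the linear term c x below.
    have e : ∀ r, Real.sin (x * r) * (1 - Real.cos (y * r))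
        = (Real.sin (x * r) - x * truncId 1 r)
          - (1 / 2) * (Real.sin ((x + y) * r) - (x + y) * truncId 1 r)
          - (1 / 2) * (Real.sin ((x - y) * r) - (x - y) * truncId 1 r) := by
      intro r
      rw [add_mul x y r, sub_mul x y r, Real.sin_add, Real.sin_sub]; ring
    simp_rw [e]
    have i1 := (integrable_sin_sub hα₀ hα₂ (x + y)).const_mul (1 / 2)
    have i2 := (integrable_sin_sub hα₀ hα₂ (x - y)).const_mul (1 / 2)
    have i3 := integrable_sin_sub hα₀ hα₂ x
    have i4 : Integrable (fun r => Real.sin (x * r) - x * truncId 1 r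
      - (1 / 2) * (Real.sin ((x + y) * r) - (x + y) * truncId 1 r)) (rayMeasure α) := i3.sub i1
    rw [integral_sub i4 i2, integral_sub i3 i1, integral_const_mul, integral_const_mul,
      hH, hH, hH]
    ring
  simp_rw [rayKernel_eq]
  rw [integral_add (integrable_cos_mul hα₀ hα₂ x y).ofReal
    ((integrable_sin_mul hα₀ hα₂ x y).ofReal.mul_const _), integral_mul_const,
    integral_complex_ofReal, integral_complex_ofReal, hcos, hsin]
  simp only [secondDiff, Complex.sub_re, Complex.sub_im, Complex.add_re, Complex.add_im,
    stableExponent_re, Complex.mul_re, Complex.mul_im, Complex.re_ofNat, Complex.im_ofNat,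
    zero_mul, sub_zero, add_zero]

/-! ### Lévy measures and radial projection on a cylinder -/

section LevyMeasure

variable {E : Type*} [NormedAddCommGroup E] [InnerProductSpace ℝ E] [FiniteDimensional ℝ E]
  [MeasurableSpace E] [BorelSpace E]

/-- The image of `Γ ⊗ r ^ (-1 - α) dr` under `(s, r) ↦ r s`. -/
def levyMeasure (α : ℝ) (Γ : Measure E) : Measure E :=
  (Γ.prod (rayMeasure α)).map (fun q => q.2 • q.1)

/-- The characteristic function at `u` of the Lévy measure weighted by `1 - cos ⟨v, x⟩`. -/
def levyChar (α : ℝ) (Γ : Measure E) (u v : E) : ℂ :=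
  ∫ s, ∫ r, rayKernel (inner ℝ u s) (inner ℝ v s) r ∂(rayMeasure α) ∂Γ

lemma measurable_ray_smul : Measurable (fun q : E × ℝ => q.2 • q.1) :=
  (continuous_snd.smul continuous_fst).measurable

lemma continuous_rayKernel (u v : E) :
    Continuous (fun q : E × ℝ => rayKernel (inner ℝ u q.1) (inner ℝ v q.1) q.2) := by
  unfold rayKernel; fun_prop

lemma abs_inner_rpow_le {α : ℝ} (hα₀ : 0 < α) (u s : E) :
    |inner ℝ u s| ^ α ≤ ‖u‖ ^ α * ‖s‖ ^ α := by
  rw [← Real.mul_rpow (norm_nonneg _) (norm_nonneg _)]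
  exact Real.rpow_le_rpow (abs_nonneg _) (abs_real_inner_le_norm u s) hα₀.le

lemma integrable_abs_inner_rpow {α : ℝ} (hα₀ : 0 < α) {Γ : Measure E}
    (hΓ : Integrable (fun s => ‖s‖ ^ α) Γ) (u : E) :
    Integrable (fun s => |inner ℝ u s| ^ α) Γ := by
  refine (hΓ.const_mul (‖u‖ ^ α)).mono' (Measurable.aestronglyMeasurable (by fun_prop)) (ae_of_all _ fun s => ?_)
  rw [Real.norm_of_nonneg (by positivity)]
  exact abs_inner_rpow_le hα₀ u s

/-- The modulus of the kernel is the weight 1 - cos(⟨v, s⟩ r), whose ray integral is a constant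
times |⟨v, s⟩|^α. The α-th moment of Γ therefore justifies Fubini. -/
lemma integrable_rayKernel {α : ℝ} (hα₀ : 0 < α) (hα₂ : α < 2) {Γ : Measure E}
    (hΓ : Integrable (fun s => ‖s‖ ^ α) Γ) (u v : E) :
    Integrable (fun q : E × ℝ => rayKernel (inner ℝ u q.1) (inner ℝ v q.1) q.2)
      (Γ.prod (rayMeasure α)) := by
  rw [integrable_prod_iff (continuous_rayKernel u v).aestronglyMeasurable]
  constructor
  · refine ae_of_all _ fun s => ?_
    refine (integrable_one_sub_cos hα₀ hα₂ (inner ℝ v s)).mono' ?_ (ae_of_all _ fun r => ?_)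
    · exact ((continuous_rayKernel u v).comp (Continuous.prodMk_right s)).aestronglyMeasurable
    · exact (norm_rayKernel _ _ _).le
  · simp_rw [norm_rayKernel, integral_one_sub_cos α _ hα₀]
    exact (integrable_abs_inner_rpow hα₀ hΓ v).mul_const _

lemma integrable_one_sub_cos_levy {α : ℝ} (hα₀ : 0 < α) (hα₂ : α < 2) {Γ : Measure E}
    (hΓ : Integrable (fun s => ‖s‖ ^ α) Γ) (v : E) :
    Integrable (fun x => 1 - Real.cos (inner ℝ v x)) (levyMeasure α Γ) := by
  rw [levyMeasure, integrable_map_measure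
    (Continuous.aestronglyMeasurable (by fun_prop)) measurable_ray_smul.aemeasurable]
  refine ((integrable_rayKernel hα₀ hα₂ hΓ 0 v).norm).congr (ae_of_all _ fun q => ?_)
  simp [norm_rayKernel, inner_smul_right, mul_comm]

lemma charFun_levy {α : ℝ} (hα₀ : 0 < α) (hα₂ : α < 2) {Γ : Measure E} [SFinite Γ]
    (hΓ : Integrable (fun s => ‖s‖ ^ α) Γ) (u v : E) :
    charFun ((levyMeasure α Γ).withDensity
      (fun x => ENNReal.ofReal (1 - Real.cos (inner ℝ v x)))) u = levyChar α Γ u v := by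
  rw [charFun_apply, integral_withDensity_eq_integral_toReal_smul (by fun_prop) (by simp),
    levyMeasure, integral_map measurable_ray_smul.aemeasurable
      (Measurable.aestronglyMeasurable (by fun_prop)), levyChar,
    ← integral_prod _ (integrable_rayKernel hα₀ hα₂ hΓ u v)]
  congr 1
  ext q
  rw [ENNReal.toReal_ofReal (sub_nonneg.2 (Real.cos_le_one _)), rayKernel, Complex.real_smul,
    inner_smul_right, inner_smul_left, real_inner_comm u]
  simp only [conj_trivial, mul_comm]

/-- With the weight 1 - cos⟨v, x⟩ the Lévy measure is finite, hence determined by its characteristic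
function `levyChar`. Dividing by the weight determines it where the weight is nonzero, and these
sets, for v in a countable dense set, cover everything but the origin. -/
lemma restrict_levyMeasure_eq {α : ℝ} (hα₀ : 0 < α) (hα₂ : α < 2) {Γ₁ Γ₂ : Measure E}
    [SFinite Γ₁] [SFinite Γ₂] (h₁ : Integrable (fun s => ‖s‖ ^ α) Γ₁)
    (h₂ : Integrable (fun s => ‖s‖ ^ α) Γ₂)
    (h : ∀ u v, levyChar α Γ₁ u v = levyChar α Γ₂ u v) :
    (levyMeasure α Γ₁).restrict {0}ᶜ = (levyMeasure α Γ₂).restrict {0}ᶜ := by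
  set f : E → E → ℝ≥0∞ := fun v x => ENNReal.ofReal (1 - Real.cos (inner ℝ v x)) with hf
  have hfm : ∀ v, Measurable (f v) := fun v => by rw [hf]; fun_prop
  have hd : ∀ v, (levyMeasure α Γ₁).withDensity (f v) = (levyMeasure α Γ₂).withDensity (f v) := by
    intro v
    have := isFiniteMeasure_withDensity_ofReal
      (integrable_one_sub_cos_levy hα₀ hα₂ h₁ v).hasFiniteIntegral
    have := isFiniteMeasure_withDensity_ofReal
      (integrable_one_sub_cos_levy hα₀ hα₂ h₂ v).hasFiniteIntegral
    refine Measure.ext_of_charFun ?_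
    ext u
    rw [charFun_levy hα₀ hα₂ h₁, charFun_levy hα₀ hα₂ h₂, h]
  have hs : ∀ v, MeasurableSet {x | f v x ≠ 0} := fun v =>
    (hfm v) (measurableSet_singleton 0).compl
  have hr : ∀ v, (levyMeasure α Γ₁).restrict {x | f v x ≠ 0}
      = (levyMeasure α Γ₂).restrict {x | f v x ≠ 0} := by
    intro v
    have inv : ∀ M : Measure E, ((M.withDensity (f v)).restrict {x | f v x ≠ 0}).withDensity
        (fun x => (f v x)⁻¹) = M.restrict {x | f v x ≠ 0} := by
      intro M
      rw [restrict_withDensity (hs v)]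
      exact withDensity_inv_same (hfm v) (self_mem_ae_restrict (hs v)) (by simp [hf])
    rw [← inv, ← inv (levyMeasure α Γ₂), hd]
  have hU : ({0}ᶜ : Set E) = ⋃ n : ℕ, {x | f (TopologicalSpace.denseSeq E n) x ≠ 0} := by
    ext x
    simp only [Set.mem_compl_iff, Set.mem_singleton_iff, Set.mem_iUnion, Set.mem_ofPred_eq]
    constructor
    · intro hx
      have hopen : IsOpen {v : E | Real.cos (inner ℝ v x) < 1} :=
        isOpen_lt (by fun_prop) continuous_const
      have hne : {v : E | Real.cos (inner ℝ v x) < 1}.Nonempty := by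
        -- This v has ⟨v, x⟩ = 1, and cos 1 < 1.
        refine ⟨(‖x‖ ^ 2)⁻¹ • x, ?_⟩
        have : ‖x‖ ^ 2 ≠ 0 := by simpa using hx
        rw [Set.mem_ofPred_eq, real_inner_smul_left, real_inner_self_eq_norm_sq,
          inv_mul_cancel₀ this]
        exact Real.cos_one_le.trans_lt (by norm_num)
      obtain ⟨v, hv, ⟨n, rfl⟩⟩ := (TopologicalSpace.denseRange_denseSeq E).inter_open_nonempty
        _ hopen hne
      refine ⟨n, ?_⟩
      simp only [hf, ne_eq, ENNReal.ofReal_eq_zero, not_le, sub_pos]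
      exact hv
    · rintro ⟨n, hn⟩ rfl
      simp [hf] at hn
  rw [hU]
  exact Measure.restrict_iUnion_congr.2 fun n => hr _

/-- The projection of a measure on the unit cylinder of `N`, with weights `N ^ α`. -/
def cylProj (α : ℝ) (N : Seminorm ℝ E) (Γ : Measure E) : Measure E :=
  (Γ.withDensity (fun s => ENNReal.ofReal (N s ^ α))).map (fun s => (N s)⁻¹ • s)

lemma rayMeasure_Ioi {α : ℝ} (hα₀ : 0 < α) {a : ℝ} (ha : 0 < a) :
    rayMeasure α (Set.Ioi a) = ENNReal.ofReal (a ^ (-α) / α) := by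
  rw [rayMeasure, withDensity_apply _ measurableSet_Ioi, Measure.restrict_restrict measurableSet_Ioi,
    Set.inter_eq_left.2 (Set.Ioi_subset_Ioi ha.le), ← ofReal_integral_eq_lintegral_ofReal
      (integrableOn_Ioi_rpow_of_lt (by linarith) ha), integral_Ioi_rpow_of_lt (by linarith) ha]
  · congr 1
    rw [show -1 - α + 1 = -α by ring, div_neg, neg_div, neg_neg]
  · filter_upwards [self_mem_ae_restrict measurableSet_Ioi] with r hr
    exact Real.rpow_nonneg (ha.trans hr).le _

lemma measurable_cylMap {N : Seminorm ℝ E} (hN : Continuous N) :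
    Measurable (fun s : E => (N s)⁻¹ • s) := by
  have := hN.measurable
  fun_prop

lemma seminorm_smul_pos (N : Seminorm ℝ E) {r : ℝ} (hr : 0 < r) (s : E) : N (r • s) = r * N s := by
  rw [map_smul_eq_mul, Real.norm_of_nonneg hr.le]

/-- On the ray through s the direction is constant, and N(rs) > 1 means r > 1 / N(s). That half-line
has ray mass N(s)^α / α. -/
lemma levyMeasure_tail {α : ℝ} (hα₀ : 0 < α) {N : Seminorm ℝ E} (hN : Continuous N)
    (Γ : Measure E) {A : Set E} (hA : MeasurableSet A) :
    levyMeasure α Γ {x | 1 < N x ∧ (N x)⁻¹ • x ∈ A}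
      = cylProj α N Γ A * ENNReal.ofReal (1 / α) := by
  have hNm := hN.measurable
  have hcyl := measurable_cylMap hN
  have hS : MeasurableSet {x | 1 < N x ∧ (N x)⁻¹ • x ∈ A} :=
    (measurableSet_lt measurable_const hNm).inter (hcyl hA)
  have hmeas : Measurable (fun s => ENNReal.ofReal (N s ^ α)) := by fun_prop
  rw [levyMeasure, Measure.map_apply measurable_ray_smul hS,
    Measure.prod_apply (measurable_ray_smul hS), cylProj, Measure.map_apply hcyl hA,
    withDensity_apply _ (hcyl hA), ← lintegral_indicator (hcyl hA),
    ← lintegral_mul_const _ (hmeas.indicator (hcyl hA))]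
  refine lintegral_congr fun s => ?_
  -- On the kernel of N no point of the ray has N > 1, and the weight 0^α vanishes as well.
  by_cases h0 : N s = 0
  · have : Prod.mk s ⁻¹' ((fun q : E × ℝ => q.2 • q.1) ⁻¹' {x | 1 < N x ∧ (N x)⁻¹ • x ∈ A}) = ∅ := by
      ext r
      simp [map_smul_eq_mul, h0]
    rw [this, measure_empty]
    by_cases hs : s ∈ (fun s => (N s)⁻¹ • s) ⁻¹' A
    · rw [Set.indicator_of_mem hs, h0, Real.zero_rpow hα₀.ne']; simp
    · rw [Set.indicator_of_notMem hs, zero_mul]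
  · have hp : 0 < N s := lt_of_le_of_ne (apply_nonneg N s) (Ne.symm h0)
    have hinv : ∀ r : ℝ, 0 < r → (N (r • s))⁻¹ • r • s = (N s)⁻¹ • s := by
      intro r hr
      rw [seminorm_smul_pos N hr, smul_smul, mul_inv, mul_right_comm, inv_mul_cancel₀ hr.ne', one_mul]
    by_cases hs : (N s)⁻¹ • s ∈ A
    · rw [Set.indicator_of_mem (show s ∈ (fun s => (N s)⁻¹ • s) ⁻¹' A from hs)]
      have : rayMeasure α (Prod.mk s ⁻¹' ((fun q : E × ℝ => q.2 • q.1) ⁻¹'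
          {x | 1 < N x ∧ (N x)⁻¹ • x ∈ A})) = rayMeasure α (Set.Ioi (N s)⁻¹) := by
        refine measure_congr ?_
        filter_upwards [ae_rayMeasure_pos α] with r hr
        refine propext ?_
        change (1 < N (r • s) ∧ (N (r • s))⁻¹ • r • s ∈ A) ↔ (N s)⁻¹ < r
        rw [hinv r hr, seminorm_smul_pos N hr, inv_lt_iff_one_lt_mul₀ hp, mul_comm]
        exact ⟨fun h => h.1, fun h => ⟨h, hs⟩⟩
      rw [this, rayMeasure_Ioi hα₀ (inv_pos.2 hp), ← ENNReal.ofReal_mul (by positivity),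
        Real.inv_rpow hp.le, Real.rpow_neg hp.le, inv_inv, mul_one_div]
    · rw [Set.indicator_of_notMem (show s ∉ (fun s => (N s)⁻¹ • s) ⁻¹' A from hs), zero_mul]
      have : rayMeasure α (Prod.mk s ⁻¹' ((fun q : E × ℝ => q.2 • q.1) ⁻¹'
          {x | 1 < N x ∧ (N x)⁻¹ • x ∈ A})) = rayMeasure α ∅ := by
        refine measure_congr ?_
        filter_upwards [ae_rayMeasure_pos α] with r hr
        refine propext ?_
        change (1 < N (r • s) ∧ (N (r • s))⁻¹ • r • s ∈ A) ↔ False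
        rw [hinv r hr]
        exact ⟨fun h => hs h.2, False.elim⟩
      rw [this, measure_empty]

/-- The set is invariant under positive dilations, so its Lévy mass is its Γ-mass times the total
ray mass. Only the fact that the latter is not zero is used. -/
lemma levyMeasure_kernel_eq_zero_iff {α : ℝ} (hα₀ : 0 < α) {N : Seminorm ℝ E} (hN : Continuous N)
    (Γ : Measure E) :
    levyMeasure α Γ {x | N x = 0 ∧ x ≠ 0} = 0 ↔ Γ {x | N x = 0 ∧ x ≠ 0} = 0 := by
  have hS : MeasurableSet {x | N x = 0 ∧ x ≠ 0} :=
    (hN.measurable (measurableSet_singleton 0)).inter (measurableSet_singleton 0).compl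
  have : levyMeasure α Γ {x | N x = 0 ∧ x ≠ 0}
      = Γ {x | N x = 0 ∧ x ≠ 0} * rayMeasure α Set.univ := by
    rw [levyMeasure, Measure.map_apply measurable_ray_smul hS,
      Measure.prod_apply (measurable_ray_smul hS), mul_comm, ← lintegral_indicator_const hS]
    refine lintegral_congr fun s => ?_
    by_cases hs : N s = 0 ∧ s ≠ 0
    · rw [Set.indicator_of_mem (show s ∈ {x | N x = 0 ∧ x ≠ 0} from hs)]
      refine measure_congr ?_
      filter_upwards [ae_rayMeasure_pos α] with r hr
      refine propext ?_
      change (N (r • s) = 0 ∧ r • s ≠ 0) ↔ True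
      rw [seminorm_smul_pos N hr, hs.1, mul_zero]
      simp [hs.2, hr.ne']
    · rw [Set.indicator_of_notMem (show s ∉ {x | N x = 0 ∧ x ≠ 0} from hs),
        ← measure_empty (μ := rayMeasure α)]
      refine measure_congr ?_
      filter_upwards [ae_rayMeasure_pos α] with r hr
      refine propext ?_
      change (N (r • s) = 0 ∧ r • s ≠ 0) ↔ False
      rw [seminorm_smul_pos N hr, mul_eq_zero, or_iff_right hr.ne', smul_ne_zero_iff]
      exact ⟨fun h => hs ⟨h.1, h.2.2⟩, False.elim⟩
  rw [this, mul_eq_zero, or_iff_left]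
  have h1 := measure_mono (μ := rayMeasure α) (Set.subset_univ (Set.Ioi 1))
  rw [rayMeasure_Ioi hα₀ one_pos, Real.one_rpow] at h1
  refine (lt_of_lt_of_le ?_ h1).ne'
  rw [ENNReal.ofReal_pos]; positivity

/-- The Lévy measure, hence the function `levyChar`, determines the projection on a cylinder. -/
theorem cylProj_eq_of_levyChar_eq {α : ℝ} (hα₀ : 0 < α) (hα₂ : α < 2) {Γ₁ Γ₂ : Measure E}
    [SFinite Γ₁] [SFinite Γ₂] (h₁ : Integrable (fun s => ‖s‖ ^ α) Γ₁)
    (h₂ : Integrable (fun s => ‖s‖ ^ α) Γ₂)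
    (h : ∀ u v, levyChar α Γ₁ u v = levyChar α Γ₂ u v) {N : Seminorm ℝ E} (hN : Continuous N) :
    cylProj α N Γ₁ = cylProj α N Γ₂ ∧
      (Γ₁ {x | N x = 0 ∧ x ≠ 0} = 0 ↔ Γ₂ {x | N x = 0 ∧ x ≠ 0} = 0) := by
  have hr := restrict_levyMeasure_eq hα₀ hα₂ h₁ h₂ h
  have key : ∀ S : Set E, MeasurableSet S → (0 : E) ∉ S →
      levyMeasure α Γ₁ S = levyMeasure α Γ₂ S := by
    intro S hS h0
    have e : S ∩ {0}ᶜ = S := Set.inter_eq_left.2 fun x hx hx0 => h0 (hx0 ▸ hx)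
    rw [← e, ← Measure.restrict_apply hS, ← Measure.restrict_apply hS, hr]
  have hNm := hN.measurable
  constructor
  · ext A hA
    have h1 := key {x | 1 < N x ∧ (N x)⁻¹ • x ∈ A}
      ((measurableSet_lt measurable_const hNm).inter ((measurable_cylMap hN) hA))
      (by simp)
    rw [levyMeasure_tail hα₀ hN _ hA, levyMeasure_tail hα₀ hN _ hA] at h1
    refine (ENNReal.mul_left_inj ?_ ENNReal.ofReal_ne_top).1 h1
    rw [ne_eq, ENNReal.ofReal_eq_zero, not_le]; positivity
  · rw [← levyMeasure_kernel_eq_zero_iff hα₀ hN Γ₁, ← levyMeasure_kernel_eq_zero_iff hα₀ hN Γ₂,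
      key {x | N x = 0 ∧ x ≠ 0} ((hN.measurable (measurableSet_singleton 0)).inter
        (measurableSet_singleton 0).compl) (by simp)]

lemma cylProj_eq_self {α : ℝ} {N : Seminorm ℝ E} {Γ : Measure E}
    (hΓ : Γ {s | N s = 1}ᶜ = 0) : cylProj α N Γ = Γ := by
  have hae : ∀ᵐ s ∂Γ, N s = 1 := hΓ
  have h1 : Γ.withDensity (fun s => ENNReal.ofReal (N s ^ α)) = Γ := by
    conv_rhs => rw [← withDensity_one (μ := Γ)]
    refine withDensity_congr_ae ?_
    filter_upwards [hae] with s hs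
    simp [hs]
  rw [cylProj, h1]
  conv_rhs => rw [← Measure.map_id (μ := Γ)]
  refine Measure.map_congr ?_
  filter_upwards [hae] with s hs
  simp [hs]

/-- Off the kernel of N the map lands on the cylinder. On the kernel the weight is zero. -/
lemma cylProj_compl {α : ℝ} (hα₀ : 0 < α) {N : Seminorm ℝ E} (hN : Continuous N) (Γ : Measure E) :
    cylProj α N Γ {s | N s = 1}ᶜ = 0 := by
  have hm : MeasurableSet {s | N s = 1}ᶜ := (hN.measurable (measurableSet_singleton 1)).compl
  have := hN.measurable
  rw [cylProj, Measure.map_apply (measurable_cylMap hN) hm, withDensity_apply _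
    ((measurable_cylMap hN) hm), setLIntegral_eq_zero_iff ((measurable_cylMap hN) hm) (by fun_prop)]
  refine ae_of_all _ fun s hs => ?_
  have hs' : ¬ N ((N s)⁻¹ • s) = 1 := hs
  have h0 : N s = 0 := by
    by_contra h0
    have hp : 0 < N s := lt_of_le_of_ne (apply_nonneg N s) (Ne.symm h0)
    exact hs' (by rw [seminorm_smul_pos N (inv_pos.2 hp), inv_mul_cancel₀ h0])
  simp [h0, Real.zero_rpow hα₀.ne']

lemma integrable_cylProj_iff {F : Type*} [NormedAddCommGroup F] [NormedSpace ℝ F] {α : ℝ}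
    {N : Seminorm ℝ E} (hN : Continuous N) {Γ : Measure E} {f : E → F}
    (hf : StronglyMeasurable f) :
    Integrable f (cylProj α N Γ) ↔ Integrable (fun s => N s ^ α • f ((N s)⁻¹ • s)) Γ := by
  have := hN.measurable
  rw [cylProj, integrable_map_measure hf.aestronglyMeasurable (measurable_cylMap hN).aemeasurable,
    integrable_withDensity_iff_integrable_smul' (by fun_prop) (by simp)]
  refine integrable_congr (ae_of_all _ fun s => ?_)
  simp only [Function.comp_apply]
  rw [ENNReal.toReal_ofReal (Real.rpow_nonneg (apply_nonneg N s) _)]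

lemma integral_cylProj {F : Type*} [NormedAddCommGroup F] [NormedSpace ℝ F] {α : ℝ}
    {N : Seminorm ℝ E} (hN : Continuous N) {Γ : Measure E} {f : E → F}
    (hf : StronglyMeasurable f) :
    ∫ s, f s ∂(cylProj α N Γ) = ∫ s, N s ^ α • f ((N s)⁻¹ • s) ∂Γ := by
  have := hN.measurable
  rw [cylProj, integral_map (measurable_cylMap hN).aemeasurable hf.aestronglyMeasurable,
    integral_withDensity_eq_integral_toReal_smul (by fun_prop) (by simp)]
  refine integral_congr_ae (ae_of_all _ fun s => ?_)
  simp only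
  rw [ENNReal.toReal_ofReal (Real.rpow_nonneg (apply_nonneg N s) _)]

end LevyMeasure

/-! ### Domination and continuity of the stable exponent -/

/-- A weight which dominates the stable exponent. -/
def growth (α x : ℝ) : ℝ := |x| ^ α * (if α = 1 then 1 + |Real.log x| else 1)

lemma growth_nonneg (α x : ℝ) : 0 ≤ growth α x := by
  unfold growth; split_ifs <;> positivity

lemma growth_one (x : ℝ) : growth 1 x = |x| * (1 + |Real.log x|) := by simp [growth]

lemma growth_of_ne_one {α : ℝ} (hα : α ≠ 1) (x : ℝ) : growth α x = |x| ^ α := by simp [growth, hα]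

lemma measurable_growth (α : ℝ) : Measurable (growth α) := by
  unfold growth
  split_ifs
  · have : Measurable (fun x : ℝ => |Real.log x|) := Real.measurable_log.abs
    have h : Measurable (fun x : ℝ => |x|) := measurable_id.abs
    fun_prop
  · have h : Measurable (fun x : ℝ => |x|) := measurable_id.abs
    fun_prop

lemma rpow_le_growth (α x : ℝ) : |x| ^ α ≤ growth α x := by
  unfold growth
  refine le_mul_of_one_le_right (by positivity) ?_
  split_ifs
  · linarith [abs_nonneg (Real.log x)]
  · exact le_rfl

lemma growth_abs (α x : ℝ) : growth α |x| = growth α x := by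
  simp [growth]

/-- The summand 1 is what makes this monotone, since x |log x| alone decreases between 1/e and 1.
Below 1 the key bound is x log(y/x) ≤ y - x. -/
lemma mul_one_add_abs_log_mono {x y : ℝ} (hx : 0 < x) (hxy : x ≤ y) :
    x * (1 + |Real.log x|) ≤ y * (1 + |Real.log y|) := by
  have hy : 0 < y := hx.trans_le hxy
  have small : ∀ x y : ℝ, 0 < x → x ≤ y → y ≤ 1 →
      x * (1 + |Real.log x|) ≤ y * (1 + |Real.log y|) := by
    intro x y hx hxy hy1
    have hy : 0 < y := hx.trans_le hxy
    rw [abs_of_nonpos (Real.log_nonpos hx.le (hxy.trans hy1)),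
      abs_of_nonpos (Real.log_nonpos hy.le hy1)]
    have h1 : Real.log (y / x) ≤ y / x - 1 := Real.log_le_sub_one_of_pos (by positivity)
    rw [Real.log_div hy.ne' hx.ne'] at h1
    have h2 : x * (Real.log y - Real.log x) ≤ y - x := by
      calc _ ≤ x * (y / x - 1) := mul_le_mul_of_nonneg_left h1 hx.le
        _ = y - x := by field_simp
    nlinarith [mul_nonneg (sub_nonneg.2 hxy) (neg_nonneg.2 (Real.log_nonpos hy.le hy1))]
  have large : ∀ x y : ℝ, 1 ≤ x → x ≤ y →
      x * (1 + |Real.log x|) ≤ y * (1 + |Real.log y|) := by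
    intro x y hx hxy
    have hl : 0 ≤ Real.log x := Real.log_nonneg hx
    have hl2 : Real.log x ≤ Real.log y := Real.log_le_log (by linarith) hxy
    rw [abs_of_nonneg hl, abs_of_nonneg (hl.trans hl2)]
    exact mul_le_mul hxy (by linarith) (by linarith) (by linarith)
  rcases le_total y 1 with h | h
  · exact small x y hx hxy h
  · rcases le_total x 1 with h' | h'
    · exact (small x 1 hx h' le_rfl).trans (large 1 y le_rfl h)
    · exact large x y h' hxy

lemma growth_mono {α : ℝ} (hα₀ : 0 < α) {x y : ℝ} (hxy : |x| ≤ |y|) :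
    growth α x ≤ growth α y := by
  by_cases hα : α = 1
  · subst hα
    rw [← growth_abs 1 x, ← growth_abs 1 y, growth_one, growth_one, abs_abs, abs_abs]
    rcases (abs_nonneg x).eq_or_lt with h | h
    · rw [← h, zero_mul]; positivity
    · exact mul_one_add_abs_log_mono h hxy
  · rw [growth_of_ne_one hα, growth_of_ne_one hα]
    exact Real.rpow_le_rpow (abs_nonneg _) hxy hα₀.le

/-- For α = 1 this comes from 1 + a + b ≤ (1 + a)(1 + b). Together with monotonicity it passes
bounds between linear forms, coordinates and norms. -/
lemma growth_mul_le (α x y : ℝ) : growth α (x * y) ≤ growth α x * growth α y := by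
  by_cases hα : α = 1
  · subst hα
    rw [growth_one, growth_one, growth_one, abs_mul]
    by_cases hx : x = 0
    · simp [hx]
    by_cases hy : y = 0
    · simp [hy]
    rw [Real.log_mul hx hy]
    calc |x| * |y| * (1 + |Real.log x + Real.log y|)
        ≤ |x| * |y| * ((1 + |Real.log x|) * (1 + |Real.log y|)) := by
          refine mul_le_mul_of_nonneg_left ?_ (by positivity)
          have := abs_add_le (Real.log x) (Real.log y)
          nlinarith [mul_nonneg (abs_nonneg (Real.log x)) (abs_nonneg (Real.log y))]
      _ = _ := by ring
  · rw [growth_of_ne_one hα, growth_of_ne_one hα, growth_of_ne_one hα, abs_mul,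
      Real.mul_rpow (abs_nonneg _) (abs_nonneg _)]

lemma abs_sign_le_one (x : ℝ) : |(SignType.sign x : ℝ)| ≤ 1 := by
  rcases lt_trichotomy x 0 with h | h | h <;> simp [h]

/-- One constant serves both cases: for α = 1 the bound 2/π ≤ 1 suffices and the tangent term is
nonnegative slack. -/
lemma norm_stableExponent_le (α x : ℝ) :
    ‖stableExponent α 1 x‖ ≤ (1 + |Real.tan (Real.pi * α / 2)|) * growth α x := by
  have hn : ‖stableExponent α 1 x‖ ≤ |x| ^ α * (1 + |w α x|) := by
    rw [stableExponent, norm_mul, Complex.norm_real, Real.norm_of_nonneg (by positivity)]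
    refine mul_le_mul_of_nonneg_left ?_ (by positivity)
    refine (norm_sub_le _ _).trans ?_
    rw [norm_one, norm_mul, Complex.norm_I, one_mul, Complex.norm_real, Real.norm_eq_abs, one_mul,
      abs_mul]
    gcongr
    exact mul_le_of_le_one_left (abs_nonneg _) (abs_sign_le_one x)
  refine hn.trans ?_
  rw [growth, mul_left_comm]
  refine mul_le_mul_of_nonneg_left ?_ (by positivity)
  by_cases hα : α = 1
  · rw [w, if_pos hα, if_pos hα, Real.log_abs, abs_mul, abs_neg,
      abs_of_pos (div_pos two_pos Real.pi_pos)]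
    have h1 : 2 / Real.pi ≤ 1 := by
      rw [div_le_one Real.pi_pos]; linarith [Real.pi_gt_three]
    have h2 := mul_le_of_le_one_left (abs_nonneg (Real.log x)) h1
    have h3 : 0 ≤ |Real.tan (Real.pi * α / 2)| * (1 + |Real.log x|) := by positivity
    linarith
  · rw [w, if_neg hα, if_neg hα, mul_one]

lemma stableExponent_zero {α : ℝ} (hα₀ : 0 < α) (β : ℝ) : stableExponent α β 0 = 0 := by
  simp [stableExponent, Real.zero_rpow hα₀.ne']

lemma stableExponent_neg (α x : ℝ) :
    stableExponent α 1 (-x) = (starRingEnd ℂ) (stableExponent α 1 x) := by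
  apply Complex.ext
  · simp [stableExponent_re]
  · have hw : w α (-x) = w α x := by simp [w]
    rw [Complex.conj_im, stableExponent_im, stableExponent_im, hw, abs_neg, Left.sign_neg,
      SignType.coe_neg]
    ring

lemma stableExponent_one_eq (β x : ℝ) : stableExponent 1 β x
    = (|x| : ℝ) + ((β * (2 / Real.pi * (x * Real.log x)) : ℝ) : ℂ) * Complex.I := by
  apply Complex.ext
  · simp [stableExponent_re]
  · rw [stableExponent_im, w, if_pos rfl, Real.rpow_one, Real.log_abs]
    simp only [Complex.add_im, Complex.ofReal_im, Complex.mul_im, Complex.ofReal_re, Complex.I_re,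
      Complex.I_im, mul_zero, mul_one, zero_add, add_zero]
    calc _ = β * (2 / Real.pi * (|x| * (SignType.sign x : ℝ) * Real.log x)) := by ring
      _ = _ := by rw [abs_mul_sign]

/-- The jump of the sign at 0 is absorbed by |x|^α. For α = 1 the imaginary part is a multiple of x
log x. -/
lemma continuous_stableExponent {α : ℝ} (hα₀ : 0 < α) : Continuous (stableExponent α 1) := by
  by_cases hα : α = 1
  · subst hα
    have h : Continuous (fun x : ℝ => x * Real.log x) := Real.continuous_mul_log
    simp_rw [funext fun x => stableExponent_one_eq 1 x]
    fun_prop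
  · have h0 : Continuous (fun x : ℝ => |x| ^ α) :=
      continuous_abs.rpow_const fun _ => Or.inr hα₀.le
    have h1 : Continuous (fun x : ℝ => |x| ^ α * (SignType.sign x : ℝ)) := by
      rw [continuous_iff_continuousAt]
      intro x
      by_cases hx : x = 0
      · subst hx
        rw [ContinuousAt, sign_zero, SignType.coe_zero, mul_zero]
        refine squeeze_zero_norm (a := fun x : ℝ => |x| ^ α) (fun x => ?_) ?_
        · rw [norm_mul, Real.norm_of_nonneg (by positivity), Real.norm_eq_abs]
          exact mul_le_of_le_one_right (by positivity) (abs_sign_le_one x)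
        · have := h0.tendsto 0
          simpa [Real.zero_rpow hα₀.ne'] using this
      · refine h0.continuousAt.mul ?_
        exact (continuous_of_discreteTopology (f := fun s : SignType => (s : ℝ))).continuousAt.comp
          (continuousAt_sign_of_ne_zero hx)
    have h2 : stableExponent α 1 = fun x => ((|x| ^ α : ℝ) : ℂ)
        - Complex.I * ((|x| ^ α * (SignType.sign x : ℝ) : ℝ) : ℂ)
          * ((Real.tan (Real.pi * α / 2) : ℝ) : ℂ) := by
      ext x
      rw [stableExponent, w, if_neg hα]; push_cast; ring
    rw [h2]
    fun_prop

/-! ### The exponent attached to a measure -/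

section Exponent

variable {E : Type*} [NormedAddCommGroup E] [InnerProductSpace ℝ E] [FiniteDimensional ℝ E]
  [MeasurableSpace E] [BorelSpace E]

/-- Measures whose exponent is well defined. -/
def IsAdmissible (α : ℝ) (Γ : Measure E) : Prop := Integrable (fun s => growth α ‖s‖) Γ

/-- The exponent attached to a measure. -/
def specExponent (α : ℝ) (Γ : Measure E) (u : E) : ℂ :=
  ∫ s, stableExponent α 1 (inner ℝ u s) ∂Γ

lemma growth_inner_le {α : ℝ} (hα₀ : 0 < α) (u s : E) :
    growth α (inner ℝ u s) ≤ growth α ‖u‖ * growth α ‖s‖ := by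
  refine (growth_mono hα₀ ?_).trans (growth_mul_le α ‖u‖ ‖s‖)
  rw [abs_of_nonneg (mul_nonneg (norm_nonneg u) (norm_nonneg s))]
  exact abs_real_inner_le_norm u s

lemma measurable_growth_norm (α : ℝ) : Measurable (fun s : E => growth α ‖s‖) :=
  (measurable_growth α).comp measurable_norm

lemma measurable_inner_right (u : E) : Measurable (fun s : E => (inner ℝ u s : ℝ)) := by fun_prop

lemma IsAdmissible.moment {α : ℝ} {Γ : Measure E} (h : IsAdmissible α Γ) :
    Integrable (fun s => ‖s‖ ^ α) Γ := by
  refine h.mono' (Measurable.aestronglyMeasurable (by fun_prop)) (ae_of_all _ fun s => ?_)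
  rw [Real.norm_of_nonneg (by positivity)]
  have := rpow_le_growth α ‖s‖
  rwa [abs_norm] at this

lemma aestronglyMeasurable_stableExponent {α : ℝ} (hα₀ : 0 < α) (Γ : Measure E) (u : E) :
    AEStronglyMeasurable (fun s => stableExponent α 1 (inner ℝ u s)) Γ := by
  have := continuous_stableExponent hα₀
  exact Continuous.aestronglyMeasurable (by fun_prop)

lemma IsAdmissible.integrable_growth_inner {α : ℝ} (hα₀ : 0 < α) {Γ : Measure E}
    (h : IsAdmissible α Γ) (u : E) : Integrable (fun s => growth α (inner ℝ u s)) Γ := by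
  refine (Integrable.const_mul h (growth α ‖u‖)).mono'
    ((measurable_growth α).comp (measurable_inner_right u)).aestronglyMeasurable
    (ae_of_all _ fun s => ?_)
  rw [Real.norm_of_nonneg (growth_nonneg _ _)]
  exact growth_inner_le hα₀ u s

lemma IsAdmissible.integrable_stableExponent {α : ℝ} (hα₀ : 0 < α) {Γ : Measure E}
    (h : IsAdmissible α Γ) (u : E) :
    Integrable (fun s => stableExponent α 1 (inner ℝ u s)) Γ :=
  ((h.integrable_growth_inner hα₀ u).const_mul _).mono'
    (aestronglyMeasurable_stableExponent hα₀ Γ u)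
    (ae_of_all _ fun _ => norm_stableExponent_le α _)

lemma specExponent_zero {α : ℝ} (hα₀ : 0 < α) (Γ : Measure E) : specExponent α Γ 0 = 0 := by
  simp [specExponent, stableExponent_zero hα₀]

lemma specExponent_neg (α : ℝ) (Γ : Measure E) (u : E) :
    specExponent α Γ (-u) = (starRingEnd ℂ) (specExponent α Γ u) := by
  simp only [specExponent, inner_neg_left, stableExponent_neg]
  exact integral_conj

lemma IsAdmissible.specExponent_re {α : ℝ} (hα₀ : 0 < α) {Γ : Measure E}
    (h : IsAdmissible α Γ) (u : E) : (specExponent α Γ u).re = ∫ s, |inner ℝ u s| ^ α ∂Γ := by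
  rw [specExponent, ← Complex.reCLM_apply,
    ← Complex.reCLM.integral_comp_comm (h.integrable_stableExponent hα₀ u)]
  simp [stableExponent_re]

lemma IsAdmissible.continuous_specExponent {α : ℝ} (hα₀ : 0 < α) {Γ : Measure E}
    (h : IsAdmissible α Γ) : Continuous (specExponent α Γ) := by
  rw [continuous_iff_continuousAt]
  intro u₀
  refine continuousAt_of_dominated (bound := fun s => (1 + |Real.tan (Real.pi * α / 2)|)
    * (growth α (‖u₀‖ + 1) * growth α ‖s‖)) ?_ ?_ ((Integrable.const_mul h _).const_mul _) ?_
  · exact Filter.Eventually.of_forall fun u => aestronglyMeasurable_stableExponent hα₀ Γ u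
  · filter_upwards [Metric.ball_mem_nhds u₀ one_pos] with u hu
    refine ae_of_all _ fun s => (norm_stableExponent_le α _).trans ?_
    refine mul_le_mul_of_nonneg_left ((growth_inner_le hα₀ u s).trans ?_) (by positivity)
    refine mul_le_mul_of_nonneg_right (growth_mono hα₀ ?_) (growth_nonneg _ _)
    rw [abs_norm, abs_of_nonneg (by positivity)]
    have : ‖u - u₀‖ < 1 := by simpa [dist_eq_norm] using hu
    have := norm_sub_norm_le u u₀
    linarith
  · refine ae_of_all _ fun s => ?_
    have := continuous_stableExponent hα₀
    exact Continuous.continuousAt (by fun_prop)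

/-- Continuous logarithms which agree at the origin are equal. -/
lemma eq_of_exp_eq {F G : E → ℂ} (hF : Continuous F) (hG : Continuous G) (h0 : F 0 = G 0)
    (h : ∀ u, Complex.exp (F u) = Complex.exp (G u)) : F = G := by
  have hpi : (2 * Real.pi * Complex.I : ℂ) ≠ 0 := Complex.two_pi_I_ne_zero
  have hn : ∀ u, ∃ n : ℤ, (F u - G u) / (2 * Real.pi * Complex.I) = n := by
    intro u
    obtain ⟨n, hn⟩ := Complex.exp_eq_exp_iff_exists_int.1 (h u)
    exact ⟨n, by rw [hn]; field_simp; ring⟩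
  choose n hn using hn
  have hcont : Continuous n := by
    have h1 : Continuous (fun u => (F u - G u) / (2 * Real.pi * Complex.I)) := by fun_prop
    have h2 : Continuous (fun u => ((F u - G u) / (2 * Real.pi * Complex.I)).re) := by fun_prop
    have h3 : (fun u => ((F u - G u) / (2 * Real.pi * Complex.I)).re) = fun u => (n u : ℝ) := by
      ext u; rw [hn u]; simp
    rw [h3] at h2
    exact Int.isClosedEmbedding_coe_real.isEmbedding.continuous_iff.2 h2
  ext u
  have h1 : n u = n 0 :=
    isPreconnected_univ.constant hcont.continuousOn (Set.mem_univ _) (Set.mem_univ _)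
  have h2 : (F u - G u) / (2 * Real.pi * Complex.I) = 0 := by
    rw [hn u, h1, ← hn 0, h0, sub_self, zero_div]
  exact sub_eq_zero.1 ((div_eq_zero_iff.1 h2).resolve_right hpi)

lemma integrable_integral_rayKernel {α : ℝ} (hα₀ : 0 < α) (hα₂ : α < 2) {Γ : Measure E} [SFinite Γ]
    (hΓ : Integrable (fun s => ‖s‖ ^ α) Γ) (u v : E) :
    Integrable (fun s => ∫ r, rayKernel (inner ℝ u s) (inner ℝ v s) r ∂(rayMeasure α)) Γ :=
  (integrable_rayKernel hα₀ hα₂ hΓ u v).integral_prod_left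

/-- `levyChar` is a real-linear function of the second difference of the exponent, and its real part
only depends on the real part of the exponent. -/
lemma exists_levyChar_eq {α : ℝ} (hα₀ : 0 < α) (hα₂ : α < 2) :
    ∃ a b : ℝ, (∀ (Γ : Measure E) [SFinite Γ], Integrable (fun s => ‖s‖ ^ α) Γ → ∀ u v,
        (levyChar α Γ u v).re = a * (∫ s, |inner ℝ (u + v) s| ^ α ∂Γ
          + ∫ s, |inner ℝ (u - v) s| ^ α ∂Γ - 2 * ∫ s, |inner ℝ u s| ^ α ∂Γ)) ∧
      ∀ (Γ : Measure E) [SFinite Γ], IsAdmissible α Γ → ∀ u v,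
        (levyChar α Γ u v).im = b * (secondDiff (specExponent α Γ) u v).im := by
  obtain ⟨a, b, hk⟩ := exists_integral_rayKernel hα₀ hα₂
  -- The real part needs only the α-th moment, which is what a symmetric representation provides.
  -- The imaginary part needs a convergent exponent.
  refine ⟨a, b, fun Γ _ hΓ u v => ?_, fun Γ _ hΓ u v => ?_⟩
  · have i1 := integrable_abs_inner_rpow hα₀ hΓ (u + v)
    have i2 := integrable_abs_inner_rpow hα₀ hΓ (u - v)
    have i3 := (integrable_abs_inner_rpow hα₀ hΓ u).const_mul 2
    have i4 : Integrable (fun s => |inner ℝ (u + v) s| ^ α + |inner ℝ (u - v) s| ^ α) Γ := i1.add i2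
    rw [levyChar, ← Complex.reCLM_apply,
      ← Complex.reCLM.integral_comp_comm (integrable_integral_rayKernel hα₀ hα₂ hΓ u v),
      ← integral_add i1 i2, ← integral_const_mul, ← integral_sub i4 i3, ← integral_const_mul]
    refine integral_congr_ae (ae_of_all _ fun s => ?_)
    simp only [hk, secondDiff, Complex.reCLM_apply, Complex.add_re, Complex.ofReal_re,
      Complex.mul_re, Complex.sub_re, stableExponent_re, inner_add_left, inner_sub_left,
      Complex.ofReal_im, Complex.I_re, Complex.I_im, Complex.re_ofNat, Complex.im_ofNat]
    ring
  · have i1 := hΓ.integrable_stableExponent hα₀ (u + v)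
    have i2 := hΓ.integrable_stableExponent hα₀ (u - v)
    have i3 := (hΓ.integrable_stableExponent hα₀ u).const_mul 2
    have i4 : Integrable (fun s => stableExponent α 1 (inner ℝ (u + v) s)
      + stableExponent α 1 (inner ℝ (u - v) s)) Γ := i1.add i2
    have i5 : Integrable (fun s => stableExponent α 1 (inner ℝ (u + v) s)
      + stableExponent α 1 (inner ℝ (u - v) s) - 2 * stableExponent α 1 (inner ℝ u s)) Γ :=
      i4.sub i3
    rw [levyChar, ← Complex.imCLM_apply,
      ← Complex.imCLM.integral_comp_comm (integrable_integral_rayKernel hα₀ hα₂ hΓ.moment u v),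
      secondDiff, specExponent, specExponent, specExponent, ← integral_add i1 i2,
      ← integral_const_mul, ← integral_sub i4 i3, ← Complex.imCLM_apply,
      ← Complex.imCLM.integral_comp_comm i5, ← integral_const_mul]
    refine integral_congr_ae (ae_of_all _ fun s => ?_)
    simp [hk, secondDiff, inner_add_left, inner_sub_left]

/-- The weight 1 - cos is even and e^{i⟨u, x⟩} is conjugated by reflection. For a symmetric Γ this
makes `levyChar` real without any logarithmic moment. -/
lemma levyChar_map_neg {α : ℝ} (Γ : Measure E) (u v : E) :
    levyChar α (Γ.map (fun s => -s)) u v = (starRingEnd ℂ) (levyChar α Γ u v) := by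
  have hk : ∀ s : E, ∫ r, rayKernel (inner ℝ u (-s)) (inner ℝ v (-s)) r ∂(rayMeasure α)
      = (starRingEnd ℂ) (∫ r, rayKernel (inner ℝ u s) (inner ℝ v s) r ∂(rayMeasure α)) := by
    intro s
    rw [← integral_conj]
    congr 1
    ext r
    simp only [rayKernel, inner_neg_right, neg_mul, Real.cos_neg, map_mul, Complex.conj_ofReal,
      ← Complex.exp_conj, Complex.conj_I, Complex.ofReal_neg, mul_neg]
  change ∫ s, _ ∂(Γ.map (MeasurableEquiv.neg E)) = _
  rw [(MeasurableEquiv.neg E).measurableEmbedding.integral_map, levyChar, ← integral_conj]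
  exact integral_congr_ae (ae_of_all _ hk)

lemma cylProj_map_neg {α : ℝ} {N : Seminorm ℝ E} (hN : Continuous N) (Γ : Measure E) :
    cylProj α N (Γ.map (fun s => -s)) = (cylProj α N Γ).map (fun s => -s) := by
  have := hN.measurable
  have hneg : Measurable (fun s : E => -s) := measurable_neg
  have hc := measurable_cylMap hN
  ext A hA
  rw [Measure.map_apply hneg hA, cylProj, cylProj, Measure.map_apply hc hA,
    Measure.map_apply hc (hneg hA), withDensity_apply _ (hc hA), withDensity_apply _ (hc (hneg hA)),
    ← lintegral_indicator (hc hA), ← lintegral_indicator (hc (hneg hA)),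
    lintegral_map (Measurable.indicator (by fun_prop) (hc hA)) hneg]
  refine lintegral_congr fun s => ?_
  have hmem : (-s ∈ (fun s => (N s)⁻¹ • s) ⁻¹' A)
      = (s ∈ (fun s => (N s)⁻¹ • s) ⁻¹' ((fun s : E => -s) ⁻¹' A)) := by
    change ((N (-s))⁻¹ • -s ∈ A) = (-((N s)⁻¹ • s) ∈ A)
    rw [map_neg_eq_map, smul_neg]
  by_cases hs : s ∈ (fun s => (N s)⁻¹ • s) ⁻¹' ((fun s : E => -s) ⁻¹' A)
  · rw [Set.indicator_of_mem hs, Set.indicator_of_mem (hmem.mpr hs), map_neg_eq_map]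
  · rw [Set.indicator_of_notMem hs, Set.indicator_of_notMem (fun h => hs (hmem.mp h))]

/-- If the exponent is real, the projection on a cylinder is symmetric. -/
lemma cylProj_symm {α : ℝ} (hα₀ : 0 < α) (hα₂ : α < 2) {Γ : Measure E} [SFinite Γ]
    (hΓ : IsAdmissible α Γ) (h : ∀ u, (specExponent α Γ u).im = 0) {N : Seminorm ℝ E}
    (hN : Continuous N) : (cylProj α N Γ).map (fun s => -s) = cylProj α N Γ := by
  obtain ⟨a, b, -, him⟩ := exists_levyChar_eq (E := E) hα₀ hα₂
  have h0 : ∀ u v, (levyChar α Γ u v).im = 0 := by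
    intro u v
    rw [him Γ hΓ]
    simp [secondDiff, h]
  rw [← cylProj_map_neg hN]
  refine (cylProj_eq_of_levyChar_eq hα₀ hα₂ ?_ hΓ.moment (fun u v => ?_) hN).1
  · rw [integrable_map_measure (Measurable.aestronglyMeasurable (by fun_prop))
      measurable_neg.aemeasurable]
    simpa [Function.comp_def] using hΓ.moment
  · rw [levyChar_map_neg, Complex.conj_eq_iff_im.2 (h0 u v)]

end Exponent

/-! ### Uniqueness and existence of representations on a cylinder -/

section Representation

variable {m h : ℕ}

lemma exists_seminorm_le (N : Seminorm ℝ (PathSpace m h)) : ∃ C, 0 < C ∧ ∀ x, N x ≤ C * ‖x‖ := by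
  set b := EuclideanSpace.basisFun (Fin (m + h + 1)) ℝ
  refine ⟨∑ i, N (b i) + 1, by positivity, fun x => ?_⟩
  have hle : N x ≤ ∑ i, N (b.repr x i • b i) := by
    conv_lhs => rw [← b.sum_repr x]
    exact Finset.le_sum_of_subadditive N (map_zero N).le (map_add_le_add N) _ _
  refine hle.trans ?_
  rw [add_mul, Finset.sum_mul]
  refine le_add_of_le_of_nonneg (Finset.sum_le_sum fun i _ => ?_) (by positivity)
  rw [map_smul_eq_mul, mul_comm]
  refine mul_le_mul_of_nonneg_left ?_ (apply_nonneg N _)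
  exact PiLp.norm_apply_le x i

lemma continuous_seminorm (N : Seminorm ℝ (PathSpace m h)) : Continuous N := by
  obtain ⟨C, hC, hN⟩ := exists_seminorm_le N
  refine (LipschitzWith.of_dist_le_mul (K := ⟨C, hC.le⟩) fun x y => ?_).continuous
  rw [Real.dist_eq, dist_eq_norm]
  exact (abs_sub_map_le_sub N x y).trans (hN (x - y))

lemma exists_norm_le_coord (x : PathSpace m h) : ∃ i, ‖x‖ ≤ (m + h + 1 : ℕ) * |x i| := by
  obtain ⟨i, hi⟩ := Finite.exists_max (fun i => |x i|)
  refine ⟨i, ?_⟩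
  refine abs_le_of_sq_le_sq' ?_ (by positivity) |>.2
  rw [EuclideanSpace.norm_sq_eq]
  calc ∑ j, ‖x j‖ ^ 2 ≤ ∑ _j : Fin (m + h + 1), |x i| ^ 2 :=
        Finset.sum_le_sum fun j _ => by
          rw [Real.norm_eq_abs]; exact pow_le_pow_left₀ (abs_nonneg _) (hi j) 2
    _ = (m + h + 1 : ℕ) * |x i| ^ 2 := by simp
    _ ≤ ((m + h + 1 : ℕ) * |x i|) ^ 2 := by
        rw [mul_pow]
        refine mul_le_mul_of_nonneg_right ?_ (by positivity)
        have : (1 : ℝ) ≤ (m + h + 1 : ℕ) := by exact_mod_cast Nat.succ_le_succ (Nat.zero_le _)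
        nlinarith

/-- With n the dimension, ‖s‖ is at most n times the largest |s_i|, so F(‖s‖) ≤ F(n) ∑ F(s_i). It is
applied to F = |x|^α and to F = `growth α`. -/
lemma integrable_norm_of_coord {F : ℝ → ℝ} (hm : Measurable F) (h0 : ∀ x, 0 ≤ F x)
    (hmono : ∀ x y, |x| ≤ |y| → F x ≤ F y) (hmul : ∀ x y, F (x * y) ≤ F x * F y)
    {Γ : Measure (PathSpace m h)} (hi : ∀ i, Integrable (fun s : PathSpace m h => F (s i)) Γ) :
    Integrable (fun s => F ‖s‖) Γ := by
  refine ((integrable_finsetSum Finset.univ fun i _ => hi i).const_mul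
    (F (m + h + 1 : ℕ))).mono' (hm.comp measurable_norm).aestronglyMeasurable
    (ae_of_all _ fun s => ?_)
  rw [Real.norm_of_nonneg (h0 _)]
  obtain ⟨i, hs⟩ := exists_norm_le_coord s
  calc F ‖s‖ ≤ F ((m + h + 1 : ℕ) * s i) := hmono _ _ (by
        rwa [abs_norm, abs_mul, abs_of_nonneg (Nat.cast_nonneg _)])
    _ ≤ F (m + h + 1 : ℕ) * F (s i) := hmul _ _
    _ ≤ _ := mul_le_mul_of_nonneg_left
        (Finset.single_le_sum (f := fun i => F (s i)) (fun j _ => h0 _) (Finset.mem_univ i)) (h0 _)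

lemma inner_single_one (i : Fin (m + h + 1)) (c : ℝ) (s : PathSpace m h) :
    inner ℝ (EuclideanSpace.single i c) s = c * s i := by
  simp [EuclideanSpace.inner_single_left]

lemma integrable_norm_rpow {α : ℝ} (hα₀ : 0 < α) {Γ : Measure (PathSpace m h)}
    (hi : ∀ u : PathSpace m h, Integrable (fun s => |inner ℝ u s| ^ α) Γ) :
    Integrable (fun s => ‖s‖ ^ α) Γ := by
  have := integrable_norm_of_coord (F := fun x => |x| ^ α) (Γ := Γ) (by fun_prop)
    (fun x => by positivity) (fun x y hxy => Real.rpow_le_rpow (abs_nonneg _) hxy hα₀.le)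
    (fun x y => by rw [abs_mul, Real.mul_rpow (abs_nonneg _) (abs_nonneg _)])
    (fun i => by simpa [inner_single_one] using hi (EuclideanSpace.single i 1))
  simpa using this

/-- For α = 1, |x| |log |x|| does not control |x| near |x| = 1. Testing with both e_i and 2 e_i
repairs this, because log 2 ≤ |log |2x|| + |log |x||. -/
lemma isAdmissible_of_integrable {α : ℝ} (hα₀ : 0 < α) {Γ : Measure (PathSpace m h)}
    (h₁ : α ≠ 1 → ∀ u : PathSpace m h, Integrable (fun s => |inner ℝ u s| ^ α) Γ)
    (h₂ : α = 1 → ∀ u : PathSpace m h,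
      Integrable (fun s => |inner ℝ u s| * |Real.log (|inner ℝ u s|)|) Γ) :
    IsAdmissible α Γ := by
  refine integrable_norm_of_coord (measurable_growth α) (growth_nonneg α)
    (fun x y => growth_mono hα₀) (growth_mul_le α) fun i => ?_
  by_cases hα : α = 1
  · subst hα
    have i1 := h₂ rfl (EuclideanSpace.single i 1)
    have i2 := h₂ rfl (EuclideanSpace.single i 2)
    simp only [inner_single_one, one_mul, Real.log_abs] at i1 i2
    have hl : 0 < Real.log 2 := Real.log_pos one_lt_two
    refine (((i2.add i1).const_mul (Real.log 2)⁻¹).add i1).mono'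
      ((measurable_growth 1).comp (by fun_prop)).aestronglyMeasurable (ae_of_all _ fun s => ?_)
    rw [Real.norm_of_nonneg (growth_nonneg _ _), growth_one]
    simp only [Pi.add_apply]
    have key : |s i| * Real.log 2 ≤ |2 * s i| * |Real.log (2 * s i)| + |s i| * |Real.log (s i)| := by
      by_cases hs : s i = 0
      · simp [hs]
      have e := Real.log_mul two_ne_zero hs
      have h1 : Real.log 2 ≤ |Real.log (2 * s i)| + |Real.log (s i)| := by
        have := le_abs_self (Real.log (2 * s i))
        have := neg_abs_le (Real.log (s i))
        linarith
      have h2 := mul_le_mul_of_nonneg_left h1 (abs_nonneg (s i))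
      have h3 : |s i| ≤ |2 * s i| := by rw [abs_mul, abs_two]; linarith [abs_nonneg (s i)]
      have h4 := mul_le_mul_of_nonneg_right h3 (abs_nonneg (Real.log (2 * s i)))
      linarith
    have h5 : |s i| ≤ (Real.log 2)⁻¹
        * (|2 * s i| * |Real.log (2 * s i)| + |s i| * |Real.log (s i)|) := by
      rw [inv_mul_eq_div, le_div_iff₀ hl]; exact key
    linarith
  · simp_rw [growth_of_ne_one hα]
    simpa [inner_single_one] using h₁ hα (EuclideanSpace.single i 1)

/-- On the cylinder 1 = N(s) ≤ C ‖s‖, so the constant 1 is dominated by C^α ‖s‖^α. Finiteness is not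
part of the definition of a representation, and Fubini requires it. -/
lemma isFiniteMeasure_of_cylinder {α : ℝ} (hα₀ : 0 < α) {N : Seminorm ℝ (PathSpace m h)}
    {Γ : Measure (PathSpace m h)} (hΓ : Γ (unitCylinder N)ᶜ = 0)
    (hm : Integrable (fun s => ‖s‖ ^ α) Γ) : IsFiniteMeasure Γ := by
  obtain ⟨C, hC, hN⟩ := exists_seminorm_le N
  have hae : ∀ᵐ s ∂Γ, N s = 1 := hΓ
  have : Integrable (fun _ : PathSpace m h => (1 : ℝ)) Γ := by
    refine (hm.const_mul (C ^ α)).mono' aestronglyMeasurable_const ?_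
    filter_upwards [hae] with s hs
    rw [norm_one, ← Real.mul_rpow hC.le (norm_nonneg _)]
    exact Real.one_le_rpow (hs ▸ hN s) hα₀.le
  exact (integrable_const_iff.1 this).resolve_left one_ne_zero

/-- Symmetry makes the characteristic function even, so -ψ and its conjugate are continuous
logarithms of the same function that both vanish at 0. -/
lemma specExponent_im_eq_zero {α : ℝ} (hα₀ : 0 < α) {ν Γ₀ : Measure (PathSpace m h)}
    (hΓ₀ : IsAdmissible α Γ₀) (hν : ∀ u, charFun ν u = Complex.exp (-specExponent α Γ₀ u))
    (hs : IsSymm ν) (u : PathSpace m h) : (specExponent α Γ₀ u).im = 0 := by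
  have hc := hΓ₀.continuous_specExponent hα₀
  have hcc : Continuous (fun u => (starRingEnd ℂ) (specExponent α Γ₀ u)) :=
    Complex.continuous_conj.comp hc
  have hneg : ∀ u, charFun ν u = charFun ν (-u) := by
    intro u
    conv_lhs => rw [← hs]
    rw [charFun_apply, charFun_apply]
    change ∫ s, _ ∂(ν.map (MeasurableEquiv.neg _)) = _
    rw [(MeasurableEquiv.neg _).measurableEmbedding.integral_map]
    simp
  have := eq_of_exp_eq (F := fun u => -specExponent α Γ₀ u)
    (G := fun u => -(starRingEnd ℂ) (specExponent α Γ₀ u)) hc.neg hcc.neg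
    (by simp [specExponent_zero hα₀]) fun u => by
      rw [← hν, hneg, hν, specExponent_neg]
  have h1 := congrFun this u
  exact Complex.conj_eq_iff_im.1 (neg_injective h1).symm

/-- A spectral representation on a cylinder is determined by any other representation of the
exponent. -/
lemma IsSpectralRep.eq_cylProj {α : ℝ} (hα₀ : 0 < α) (hα₂ : α < 2)
    {ν Γ₀ : Measure (PathSpace m h)} [SFinite Γ₀] (hΓ₀ : IsAdmissible α Γ₀)
    (hν : ∀ u, charFun ν u = Complex.exp (-specExponent α Γ₀ u)) {N : Seminorm ℝ (PathSpace m h)}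
    {Γ : Measure (PathSpace m h)} {b : PathSpace m h} (hr : IsSpectralRep α N ν Γ b) :
    Γ = cylProj α N Γ₀ ∧ Γ₀ {x | N x = 0 ∧ x ≠ 0} = 0 ∧
      (¬ IsSymm ν → IsAdmissible α Γ ∧
        ∀ u, specExponent α Γ u - Complex.I * ((inner ℝ u b : ℝ) : ℂ) = specExponent α Γ₀ u) := by
  obtain ⟨hcyl, hsym, hns⟩ := hr
  have hN := continuous_seminorm N
  obtain ⟨a, c, hre, him⟩ := exists_levyChar_eq (E := PathSpace m h) hα₀ hα₂
  have key : IsFiniteMeasure Γ → Integrable (fun s => ‖s‖ ^ α) Γ →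
      (∀ u v, levyChar α Γ u v = levyChar α Γ₀ u v) →
      Γ = cylProj α N Γ₀ ∧ Γ₀ {x | N x = 0 ∧ x ≠ 0} = 0 := by
    intro _ hm hl
    obtain ⟨h1, h2⟩ := cylProj_eq_of_levyChar_eq hα₀ hα₂ hm hΓ₀.moment hl hN
    -- Γ lives on {N = 1}, so it is its own projection and gives no mass to {N = 0}.
    rw [cylProj_eq_self hcyl] at h1
    refine ⟨h1, h2.1 (measure_mono_null ?_ hcyl)⟩
    rintro x ⟨hx, -⟩ (hx1 : N x = 1)
    rw [hx] at hx1
    exact zero_ne_one hx1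
  by_cases hs : IsSymm ν
  · obtain ⟨hΓs, -, hi, hchar⟩ := hsym hs
    have hm := integrable_norm_rpow hα₀ hi
    have hfin := isFiniteMeasure_of_cylinder hα₀ hcyl hm
    have him0 := specExponent_im_eq_zero hα₀ hΓ₀ hν hs
    have hre0 : ∀ u, ∫ s, |inner ℝ u s| ^ α ∂Γ = ∫ s, |inner ℝ u s| ^ α ∂Γ₀ := by
      intro u
      have h1 := (hchar u).symm.trans (hν u)
      have h2 : specExponent α Γ₀ u = ((∫ s, |inner ℝ u s| ^ α ∂Γ₀ : ℝ) : ℂ) := by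
        apply Complex.ext
        · rw [hΓ₀.specExponent_re hα₀, Complex.ofReal_re]
        · rw [him0, Complex.ofReal_im]
      rw [h2] at h1
      -- Both exponents are real here, so the real exponential can be inverted directly.
      have h3 := Real.exp_injective (a₁ := -∫ s, |inner ℝ u s| ^ α ∂Γ)
        (a₂ := -∫ s, |inner ℝ u s| ^ α ∂Γ₀) (by exact_mod_cast h1)
      exact neg_injective h3
    obtain ⟨h1, h2⟩ := key hfin hm fun u v => by
      apply Complex.ext
      · rw [hre Γ hm, hre Γ₀ hΓ₀.moment, hre0, hre0, hre0]
      · rw [him Γ₀ hΓ₀]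
        -- For α = 1 the exponent of Γ need not converge absolutely, so the reality of `levyChar` is
        -- read off the symmetry of Γ.
        have e := levyChar_map_neg (α := α) Γ u v
        rw [show Γ.map (fun s => -s) = Γ from hΓs] at e
        rw [Complex.conj_eq_iff_im.1 e.symm]
        simp [secondDiff, him0]
    exact ⟨h1, h2, fun hh => absurd hs hh⟩
  · obtain ⟨hi1, hi2, hchar⟩ := hns hs
    have hΓ := isAdmissible_of_integrable hα₀ hi1 hi2
    have hfin := isFiniteMeasure_of_cylinder hα₀ hcyl hΓ.moment
    have hψ : ∀ u, specExponent α Γ u - Complex.I * ((inner ℝ u b : ℝ) : ℂ)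
        = specExponent α Γ₀ u := by
      have hc1 := hΓ.continuous_specExponent hα₀
      have hc2 := hΓ₀.continuous_specExponent hα₀
      have := eq_of_exp_eq (F := fun u => -specExponent α Γ u
          + Complex.I * ((inner ℝ u b : ℝ) : ℂ)) (G := fun u => -specExponent α Γ₀ u)
        (by fun_prop) hc2.neg (by simp [specExponent_zero hα₀])
        fun u => (hchar u).symm.trans (hν u)
      intro u
      have h1 : -specExponent α Γ u + Complex.I * ((inner ℝ u b : ℝ) : ℂ)
        = -specExponent α Γ₀ u := congrFun this u
      linear_combination -h1
    obtain ⟨h1, h2⟩ := key hfin hΓ.moment fun u v => by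
      -- The two exponents differ by a linear term, which second differences annihilate.
      have hsd : secondDiff (specExponent α Γ) u v = secondDiff (specExponent α Γ₀) u v := by
        simp only [secondDiff, ← hψ, inner_add_left, inner_sub_left]
        push_cast; ring
      apply Complex.ext
      · have e1 := hΓ.specExponent_re hα₀
        have e2 := hΓ₀.specExponent_re hα₀
        have e3 : ∀ u, (specExponent α Γ u).re = (specExponent α Γ₀ u).re := by
          intro u
          rw [← hψ u]; simp
        rw [hre Γ hΓ.moment, hre Γ₀ hΓ₀.moment, ← e1, ← e1, ← e1, ← e2, ← e2, ← e2, e3, e3, e3]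
      · rw [him Γ hΓ, him Γ₀ hΓ₀, hsd]
    exact ⟨h1, h2, fun _ => ⟨hΓ, hψ⟩⟩

lemma ae_eq_zero_of_seminorm {N : Seminorm ℝ (PathSpace m h)} {Γ : Measure (PathSpace m h)}
    (hK : Γ {x | N x = 0 ∧ x ≠ 0} = 0) : ∀ᵐ s ∂Γ, N s = 0 → s = 0 := by
  have : ∀ᵐ s ∂Γ, ¬ (N s = 0 ∧ s ≠ 0) := by
    rw [ae_iff]; simpa using hK
  filter_upwards [this] with s hs h0
  by_contra hne
  exact hs ⟨h0, hne⟩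

lemma rpow_smul_abs_inner {α : ℝ} (hα₀ : 0 < α) {N : Seminorm ℝ (PathSpace m h)}
    (u s : PathSpace m h) (hs : N s = 0 → s = 0) :
    N s ^ α • |inner ℝ u ((N s)⁻¹ • s)| ^ α = |inner ℝ u s| ^ α := by
  by_cases h0 : N s = 0
  · rw [hs h0]; simp [Real.zero_rpow hα₀.ne']
  · have hp : 0 < N s := lt_of_le_of_ne (apply_nonneg N s) (Ne.symm h0)
    rw [inner_smul_right, abs_mul, abs_of_pos (inv_pos.2 hp), smul_eq_mul,
      ← Real.mul_rpow hp.le (by positivity), ← mul_assoc, mul_inv_cancel₀ h0, one_mul]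

lemma rpow_smul_stableExponent {α : ℝ} (hα₀ : 0 < α) (hα : α ≠ 1)
    {N : Seminorm ℝ (PathSpace m h)} (u s : PathSpace m h) (hs : N s = 0 → s = 0) :
    N s ^ α • stableExponent α 1 (inner ℝ u ((N s)⁻¹ • s)) = stableExponent α 1 (inner ℝ u s) := by
  have h1 := rpow_smul_abs_inner hα₀ u s hs
  by_cases h0 : N s = 0
  · rw [hs h0]; simp [stableExponent_zero hα₀, Real.zero_rpow hα₀.ne']
  · have hp : 0 < N s := lt_of_le_of_ne (apply_nonneg N s) (Ne.symm h0)
    have hsg : SignType.sign (inner ℝ u ((N s)⁻¹ • s)) = SignType.sign (inner ℝ u s) := by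
      rw [inner_smul_right, sign_mul, sign_pos (inv_pos.2 hp), one_mul]
    rw [smul_eq_mul] at h1
    rw [stableExponent, stableExponent, hsg, ← h1, w, w, if_neg hα, if_neg hα, Complex.real_smul]
    push_cast; ring

/-- For α = 1 homogeneity fails through log(x / N) = log x - log N. The defect is linear in u, and
its integral is the shift. -/
lemma smul_stableExponent_one {N : Seminorm ℝ (PathSpace m h)} (u s : PathSpace m h)
    (hs : N s = 0 → s = 0) :
    N s ^ (1 : ℝ) • stableExponent 1 1 (inner ℝ u ((N s)⁻¹ • s))
      = stableExponent 1 1 (inner ℝ u s)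
        - ((2 / Real.pi * inner ℝ u (Real.log (N s) • s) : ℝ) : ℂ) * Complex.I := by
  by_cases h0 : N s = 0
  · rw [hs h0]; simp [stableExponent_zero one_pos]
  · have hp : 0 < N s := lt_of_le_of_ne (apply_nonneg N s) (Ne.symm h0)
    rw [inner_smul_right, inner_smul_right, Real.rpow_one]
    by_cases hx : (inner ℝ u s : ℝ) = 0
    · simp [hx, stableExponent_zero one_pos]
    rw [stableExponent_one_eq, stableExponent_one_eq, abs_mul, abs_of_pos (inv_pos.2 hp),
      Real.log_mul (inv_ne_zero h0) hx, Real.log_inv, Complex.real_smul]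
    push_cast
    have : (N s : ℂ) ≠ 0 := by exact_mod_cast h0
    field_simp
    ring

lemma integrable_abs_inner_cylProj {α : ℝ} (hα₀ : 0 < α) {Γ₀ : Measure (PathSpace m h)}
    (hΓ₀ : IsAdmissible α Γ₀) {N : Seminorm ℝ (PathSpace m h)}
    (hK : Γ₀ {x | N x = 0 ∧ x ≠ 0} = 0) (u : PathSpace m h) :
    Integrable (fun s => |inner ℝ u s| ^ α) (cylProj α N Γ₀) ∧
      ∫ s, |inner ℝ u s| ^ α ∂(cylProj α N Γ₀) = ∫ s, |inner ℝ u s| ^ α ∂Γ₀ := by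
  have hN := continuous_seminorm N
  have hsm : StronglyMeasurable (fun s : PathSpace m h => |inner ℝ u s| ^ α) :=
    Measurable.stronglyMeasurable (by fun_prop)
  have hae : (fun s => N s ^ α • |inner ℝ u ((N s)⁻¹ • s)| ^ α)
      =ᵐ[Γ₀] fun s => |inner ℝ u s| ^ α := by
    filter_upwards [ae_eq_zero_of_seminorm hK] with s hs
    exact rpow_smul_abs_inner hα₀ u s hs
  constructor
  · rw [integrable_cylProj_iff hN hsm]
    exact (integrable_abs_inner_rpow hα₀ hΓ₀.moment u).congr hae.symm
  · rw [integral_cylProj hN hsm]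
    exact integral_congr_ae hae

/-- Only |x|^α enters, which is homogeneous for every α. Hence no logarithmic integrability is
required, even for α = 1. -/
lemma isSpectralRep_cylProj_of_symm {α : ℝ} (hα₀ : 0 < α) (hα₂ : α < 2)
    {ν Γ₀ : Measure (PathSpace m h)} [SFinite Γ₀] (hΓ₀ : IsAdmissible α Γ₀)
    (hν : ∀ u, charFun ν u = Complex.exp (-specExponent α Γ₀ u)) {N : Seminorm ℝ (PathSpace m h)}
    (hK : Γ₀ {x | N x = 0 ∧ x ≠ 0} = 0) (hs : IsSymm ν) :
    IsSpectralRep α N ν (cylProj α N Γ₀) 0 := by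
  have hN := continuous_seminorm N
  have him := specExponent_im_eq_zero hα₀ hΓ₀ hν hs
  refine ⟨cylProj_compl hα₀ hN Γ₀, fun _ => ⟨cylProj_symm hα₀ hα₂ hΓ₀ him hN, rfl,
    fun u => (integrable_abs_inner_cylProj hα₀ hΓ₀ hK u).1, fun u => ?_⟩, fun hh => absurd hs hh⟩
  rw [(integrable_abs_inner_cylProj hα₀ hΓ₀ hK u).2, hν]
  congr 2
  apply Complex.ext
  · rw [hΓ₀.specExponent_re hα₀, Complex.ofReal_re]
  · rw [him, Complex.ofReal_im]

lemma specExponent_cylProj {α : ℝ} (hα₀ : 0 < α) (hα : α ≠ 1) {Γ₀ : Measure (PathSpace m h)}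
    {N : Seminorm ℝ (PathSpace m h)} (hK : Γ₀ {x | N x = 0 ∧ x ≠ 0} = 0) (u : PathSpace m h) :
    specExponent α (cylProj α N Γ₀) u = specExponent α Γ₀ u := by
  have hc := continuous_stableExponent hα₀
  rw [specExponent, integral_cylProj (continuous_seminorm N)
    (Continuous.stronglyMeasurable (by fun_prop)), specExponent]
  refine integral_congr_ae ?_
  filter_upwards [ae_eq_zero_of_seminorm hK] with s hs
  exact rpow_smul_stableExponent hα₀ hα u s hs

lemma isSpectralRep_cylProj {α : ℝ} (hα₀ : 0 < α) (hα : α ≠ 1)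
    {ν Γ₀ : Measure (PathSpace m h)} (hΓ₀ : IsAdmissible α Γ₀)
    (hν : ∀ u, charFun ν u = Complex.exp (-specExponent α Γ₀ u)) {N : Seminorm ℝ (PathSpace m h)}
    (hK : Γ₀ {x | N x = 0 ∧ x ≠ 0} = 0) (hs : ¬ IsSymm ν) :
    IsSpectralRep α N ν (cylProj α N Γ₀) 0 := by
  refine ⟨cylProj_compl hα₀ (continuous_seminorm N) Γ₀, fun hh => absurd hh hs, fun _ =>
    ⟨fun _ u => (integrable_abs_inner_cylProj hα₀ hΓ₀ hK u).1, fun hh => absurd hh hα, fun u => ?_⟩⟩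
  have := specExponent_cylProj hα₀ hα hK u
  rw [specExponent] at this
  rw [this, hν]; simp

/-- The shift which comes with the projection on a cylinder when `α = 1`. -/
def cylShift (N : Seminorm ℝ (PathSpace m h)) (Γ : Measure (PathSpace m h)) : PathSpace m h :=
  (-(2 / Real.pi)) • ∫ s, Real.log (N s) • s ∂Γ

lemma specExponent_one_cylProj {Γ₀ : Measure (PathSpace m h)} (hΓ₀ : IsAdmissible 1 Γ₀)
    {N : Seminorm ℝ (PathSpace m h)} (hK : Γ₀ {x | N x = 0 ∧ x ≠ 0} = 0)
    (hL : Integrable (fun s => Real.log (N s) • s) Γ₀) (u : PathSpace m h) :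
    specExponent 1 (cylProj 1 N Γ₀) u
      = specExponent 1 Γ₀ u + Complex.I * ((inner ℝ u (cylShift N Γ₀) : ℝ) : ℂ) := by
  have hc := continuous_stableExponent one_pos
  have hin : Integrable (fun s => 2 / Real.pi * inner ℝ u (Real.log (N s) • s)) Γ₀ :=
    (hL.const_inner u).const_mul _
  have hin' : Integrable (fun s =>
      ((2 / Real.pi * inner ℝ u (Real.log (N s) • s) : ℝ) : ℂ) * Complex.I) Γ₀ :=
    hin.ofReal.mul_const _
  have hint : ∫ s, inner ℝ u (Real.log (N s) • s) ∂Γ₀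
      = inner ℝ u (∫ s, Real.log (N s) • s ∂Γ₀) := integral_inner hL u
  rw [specExponent, integral_cylProj (continuous_seminorm N)
    (Continuous.stronglyMeasurable (by fun_prop))]
  have hae : (fun s => N s ^ (1 : ℝ) • stableExponent 1 1 (inner ℝ u ((N s)⁻¹ • s)))
      =ᵐ[Γ₀] fun s => stableExponent 1 1 (inner ℝ u s)
        - ((2 / Real.pi * inner ℝ u (Real.log (N s) • s) : ℝ) : ℂ) * Complex.I := by
    filter_upwards [ae_eq_zero_of_seminorm hK] with s hs
    exact smul_stableExponent_one u s hs
  rw [integral_congr_ae hae, integral_sub (hΓ₀.integrable_stableExponent one_pos u)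
    hin', integral_mul_const, integral_complex_ofReal, integral_const_mul,
    hint, cylShift, inner_smul_right, specExponent]
  push_cast; ring

/-- Off the kernel, N times the growth weight of ‖s‖ / N is ‖s‖ (1 + |log ‖s‖ - log N|). Since ‖s‖
(1 + |log ‖s‖|) is already integrable, what remains is ‖s‖ |log N|. -/
lemma isAdmissible_cylProj_iff {Γ₀ : Measure (PathSpace m h)} (hΓ₀ : IsAdmissible 1 Γ₀)
    {N : Seminorm ℝ (PathSpace m h)} (hK : Γ₀ {x | N x = 0 ∧ x ≠ 0} = 0) :
    IsAdmissible 1 (cylProj 1 N Γ₀) ↔ Integrable (fun s => Real.log (N s) • s) Γ₀ := by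
  have hN := continuous_seminorm N
  have hNm := hN.measurable
  have hlm : Measurable (fun s : PathSpace m h => Real.log (N s)) := by fun_prop
  have hlm2 : Measurable (fun s : PathSpace m h => Real.log ‖s‖) := by fun_prop
  have hpt : ∀ s : PathSpace m h, (N s = 0 → s = 0) →
      N s ^ (1 : ℝ) • growth 1 ‖(N s)⁻¹ • s‖
        = ‖s‖ * (1 + |Real.log ‖s‖ - Real.log (N s)|) := by
    intro s hs
    by_cases h0 : N s = 0
    · rw [hs h0]; simp [growth_one]
    · have hp : 0 < N s := lt_of_le_of_ne (apply_nonneg N s) (Ne.symm h0)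
      have hs0 : s ≠ 0 := by rintro rfl; simp at h0
      rw [growth_one, norm_smul, norm_inv, Real.norm_of_nonneg hp.le, Real.rpow_one, smul_eq_mul,
        abs_of_nonneg (by positivity), Real.log_mul (inv_ne_zero h0) (norm_ne_zero_iff.2 hs0),
        Real.log_inv, neg_add_eq_sub]
      field_simp
  rw [IsAdmissible, integrable_cylProj_iff hN (measurable_growth_norm 1).stronglyMeasurable]
  have hg : Integrable (fun s => ‖s‖ * (1 + |Real.log ‖s‖|)) Γ₀ := by
    refine Integrable.congr hΓ₀ (ae_of_all _ fun s => ?_)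
    simp [growth_one]
  constructor
  · intro hi
    refine (hi.add hg).mono' (hlm.smul measurable_id).aestronglyMeasurable ?_
    filter_upwards [ae_eq_zero_of_seminorm hK] with s hs
    rw [Pi.add_apply, hpt s hs, norm_smul, Real.norm_eq_abs]
    have h1 : |Real.log (N s)| ≤ |Real.log ‖s‖ - Real.log (N s)| + |Real.log ‖s‖| := by
      have := abs_sub_le (Real.log (N s)) (Real.log ‖s‖) 0
      rwa [sub_zero, sub_zero, abs_sub_comm] at this
    nlinarith [norm_nonneg s]
  · intro hL
    have hae : (fun s => N s ^ (1 : ℝ) • growth 1 ‖(N s)⁻¹ • s‖)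
        =ᵐ[Γ₀] fun s => ‖s‖ * (1 + |Real.log ‖s‖ - Real.log (N s)|) := by
      filter_upwards [ae_eq_zero_of_seminorm hK] with s hs using hpt s hs
    rw [integrable_congr hae]
    refine (hL.norm.add hg).mono' (Measurable.aestronglyMeasurable (by fun_prop))
      (ae_of_all _ fun s => ?_)
    rw [Pi.add_apply, Real.norm_of_nonneg (by positivity), norm_smul, Real.norm_eq_abs]
    have h1 := abs_sub (Real.log ‖s‖) (Real.log (N s))
    nlinarith [norm_nonneg s]

lemma isSpectralRep_cylProj_one {ν Γ₀ : Measure (PathSpace m h)} (hΓ₀ : IsAdmissible 1 Γ₀)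
    (hν : ∀ u, charFun ν u = Complex.exp (-specExponent 1 Γ₀ u)) {N : Seminorm ℝ (PathSpace m h)}
    (hK : Γ₀ {x | N x = 0 ∧ x ≠ 0} = 0) (hs : ¬ IsSymm ν)
    (hL : Integrable (fun s => Real.log (N s) • s) Γ₀) :
    IsSpectralRep 1 N ν (cylProj 1 N Γ₀) (cylShift N Γ₀) := by
  have hadm := (isAdmissible_cylProj_iff hΓ₀ hK).2 hL
  refine ⟨cylProj_compl one_pos (continuous_seminorm N) Γ₀, fun hh => absurd hh hs, fun _ =>
    ⟨fun hh => absurd rfl hh, fun _ u => ?_, fun u => ?_⟩⟩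
  · refine (hadm.integrable_growth_inner one_pos u).mono'
      (Measurable.aestronglyMeasurable (by fun_prop)) (ae_of_all _ fun s => ?_)
    rw [growth_one, Real.norm_of_nonneg (by positivity), Real.log_abs]
    exact mul_le_mul_of_nonneg_left (by linarith) (abs_nonneg _)
  · have := specExponent_one_cylProj hΓ₀ hK hL u
    rw [specExponent] at this
    rw [this, hν]
    congr 1; ring

/-- When the exponent is real, the shift is zero. -/
lemma cylShift_eq_zero {Γ₀ : Measure (PathSpace m h)} [SFinite Γ₀] (hΓ₀ : IsAdmissible 1 Γ₀)
    {N : Seminorm ℝ (PathSpace m h)} (hK : Γ₀ {x | N x = 0 ∧ x ≠ 0} = 0)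
    (hL : Integrable (fun s => Real.log (N s) • s) Γ₀)
    (him : ∀ u, (specExponent 1 Γ₀ u).im = 0) : cylShift N Γ₀ = 0 := by
  have hsym := cylProj_symm one_pos one_lt_two hΓ₀ him (continuous_seminorm N)
  refine ext_inner_left ℝ fun u => ?_
  rw [inner_zero_right]
  -- By `h1` and `him` the projected exponent has imaginary part ⟨u, shift⟩. By `h2`, which uses the
  -- symmetry of the projection, that part is zero.
  have h1 := specExponent_one_cylProj hΓ₀ hK hL u
  have h2 : specExponent 1 (cylProj 1 N Γ₀) (-u) = specExponent 1 (cylProj 1 N Γ₀) u := by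
    conv_rhs => rw [← hsym]
    rw [specExponent, specExponent]
    change _ = ∫ s, _ ∂((cylProj 1 N Γ₀).map (MeasurableEquiv.neg _))
    rw [(MeasurableEquiv.neg _).measurableEmbedding.integral_map]
    simp
  rw [specExponent_neg] at h2
  have h3 := Complex.conj_eq_iff_im.1 h2
  rw [h1, Complex.add_im, him] at h3
  simpa using h3

end Representation

/-! ### Purely atomic measures -/

section Atoms

variable {m h : ℕ}

/-- The measure with mass `c` at each point of a sequence. -/
def atomMeasure (c : ℝ) (x : ℤ → PathSpace m h) : Measure (PathSpace m h) :=
  Measure.sum fun k => ENNReal.ofReal c • Measure.dirac (x k)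

instance (c : ℝ) (x : ℤ → PathSpace m h) : SFinite (atomMeasure c x) := by
  unfold atomMeasure
  have : ∀ k, SFinite (ENNReal.ofReal c • Measure.dirac (x k)) := fun k => inferInstance
  infer_instance

lemma integrable_atomMeasure_iff {F : Type*} [NormedAddCommGroup F] {c : ℝ} (hc : 0 ≤ c)
    {x : ℤ → PathSpace m h} {f : PathSpace m h → F} :
    Integrable f (atomMeasure c x) ↔ (c = 0 ∨ Summable (fun k => ‖f (x k)‖)) := by
  rw [atomMeasure, integrable_sum_dirac_iff (fun _ => ENNReal.ofReal_ne_top),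
    ENNReal.toReal_ofReal hc]
  by_cases h0 : c = 0
  · simp [h0]
  · rw [summable_mul_left_iff h0]; simp [h0]

lemma integral_atomMeasure {F : Type*} [NormedAddCommGroup F] [NormedSpace ℝ F]
    [FiniteDimensional ℝ F] {c : ℝ} (hc : 0 ≤ c) {x : ℤ → PathSpace m h} {f : PathSpace m h → F} :
    ∫ s, f s ∂(atomMeasure c x) = ∑' k, c • f (x k) := by
  rw [atomMeasure, integral_sum_dirac (fun _ => ENNReal.ofReal_ne_top), ENNReal.toReal_ofReal hc]

lemma atomMeasure_eq_zero_iff {c : ℝ} {x : ℤ → PathSpace m h} {A : Set (PathSpace m h)}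
    (hA : MeasurableSet A) : atomMeasure c x A = 0 ↔ (c ≤ 0 ∨ ∀ k, x k ∉ A) := by
  rw [atomMeasure, Measure.sum_apply _ hA, ENNReal.tsum_eq_zero]
  simp only [Measure.smul_apply, Measure.dirac_apply' _ hA, smul_eq_mul, mul_eq_zero,
    ENNReal.ofReal_eq_zero, Set.indicator_apply_eq_zero, Pi.one_apply, one_ne_zero, imp_false]
  by_cases h : c ≤ 0 <;> simp [h]

lemma cylProj_atomMeasure (α : ℝ) (N : Seminorm ℝ (PathSpace m h)) {c : ℝ} (hc : 0 ≤ c)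
    (x : ℤ → PathSpace m h) :
    cylProj α N (atomMeasure c x) = Measure.sum fun k =>
      ENNReal.ofReal (c * N (x k) ^ α) • Measure.dirac ((N (x k))⁻¹ • x k) := by
  have hN := continuous_seminorm N
  rw [cylProj, atomMeasure, withDensity_sum, Measure.map_sum (measurable_cylMap hN).aemeasurable]
  congr 1
  ext1 k
  rw [withDensity_smul_measure, dirac_withDensity, Measure.map_smul, Measure.map_smul,
    Measure.map_dirac, smul_smul, ENNReal.ofReal_mul hc]

lemma cylProj_add (α : ℝ) (N : Seminorm ℝ (PathSpace m h)) (Γ₁ Γ₂ : Measure (PathSpace m h)) :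
    cylProj α N (Γ₁ + Γ₂) = cylProj α N Γ₁ + cylProj α N Γ₂ := by
  rw [cylProj, withDensity_add_measure,
    Measure.map_add _ _ (measurable_cylMap (continuous_seminorm N)), cylProj, cylProj]

lemma cylProj_finsetSum {ι : Type*} (α : ℝ) (N : Seminorm ℝ (PathSpace m h)) (S : Finset ι)
    (Γ : ι → Measure (PathSpace m h)) :
    cylProj α N (∑ j ∈ S, Γ j) = ∑ j ∈ S, cylProj α N (Γ j) := by
  classical
  induction S using Finset.induction_on with
  | empty => simp [cylProj]
  | insert j S hj ih => rw [Finset.sum_insert hj, Finset.sum_insert hj, cylProj_add, ih]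

end Atoms

/-! ### The representing measure built from the coefficient vectors -/

section RawMeasure

variable {m h J : ℕ}

/-- The representing measure of the vector of partial sums, restricted to the components in `S`: the
atoms are the vectors `± p_j d_{j,k}` themselves. -/
def rawMeasure (m h : ℕ) (S : Finset (Fin J)) (β p : Fin J → ℝ) (d : Fin J → ℤ → ℝ) :
    Measure (PathSpace m h) :=
  ∑ j ∈ S, (atomMeasure ((1 + β j) / 2) (fun k => p j • coeffVec (d j) m h k)
    + atomMeasure ((1 - β j) / 2) (fun k => -(p j • coeffVec (d j) m h k)))

instance (S : Finset (Fin J)) (β p : Fin J → ℝ) (d : Fin J → ℤ → ℝ) :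
    SFinite (rawMeasure m h S β p d) :=
  Finset.sum_induction _ SFinite (fun _ _ _ _ => inferInstance) inferInstance
    fun _ _ => inferInstance

variable {S : Finset (Fin J)} {β p : Fin J → ℝ} {d : Fin J → ℤ → ℝ}

/-- Integrability of an even function with respect to `rawMeasure`. -/
lemma integrable_rawMeasure_iff {F : Type*} [NormedAddCommGroup F]
    (hβ : ∀ j, β j ∈ Set.Icc (-1 : ℝ) 1) {f : PathSpace m h → F} (hf : ∀ x, ‖f (-x)‖ = ‖f x‖) :
    Integrable f (rawMeasure m h S β p d) ↔
      ∀ j ∈ S, Summable (fun k => ‖f (p j • coeffVec (d j) m h k)‖) := by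
  rw [rawMeasure, integrable_finsetSum_measure]
  refine forall₂_congr fun j _ => ?_
  have h1 : 0 ≤ (1 + β j) / 2 := by linarith [(hβ j).1]
  have h2 : 0 ≤ (1 - β j) / 2 := by linarith [(hβ j).2]
  rw [integrable_add_measure, integrable_atomMeasure_iff h1, integrable_atomMeasure_iff h2]
  simp only [hf]
  constructor
  -- The weights (1 + β_j)/2 and (1 - β_j)/2 sum to 1, so they cannot both vanish.
  · rintro ⟨h3 | h3, h4 | h4⟩
    · linarith
    · exact h4
    · exact h3
    · exact h3
  · exact fun h3 => ⟨Or.inr h3, Or.inr h3⟩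

lemma integral_rawMeasure {F : Type*} [NormedAddCommGroup F] [NormedSpace ℝ F]
    [FiniteDimensional ℝ F] (hβ : ∀ j, β j ∈ Set.Icc (-1 : ℝ) 1) {f : PathSpace m h → F}
    (hf : ∀ j ∈ S, Summable (fun k => f (p j • coeffVec (d j) m h k)))
    (hf' : ∀ j ∈ S, Summable (fun k => f (-(p j • coeffVec (d j) m h k)))) :
    ∫ s, f s ∂(rawMeasure m h S β p d) = ∑ j ∈ S, ∑' k,
      (((1 + β j) / 2) • f (p j • coeffVec (d j) m h k)
        + ((1 - β j) / 2) • f (-(p j • coeffVec (d j) m h k))) := by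
  have h1 : ∀ j, 0 ≤ (1 + β j) / 2 := fun j => by linarith [(hβ j).1]
  have h2 : ∀ j, 0 ≤ (1 - β j) / 2 := fun j => by linarith [(hβ j).2]
  have i1 : ∀ j ∈ S, Integrable f
      (atomMeasure ((1 + β j) / 2) (fun k => p j • coeffVec (d j) m h k)) := fun j hj =>
    (integrable_atomMeasure_iff (h1 j)).2 (Or.inr (hf j hj).norm)
  have i2 : ∀ j ∈ S, Integrable f
      (atomMeasure ((1 - β j) / 2) (fun k => -(p j • coeffVec (d j) m h k))) := fun j hj =>
    (integrable_atomMeasure_iff (h2 j)).2 (Or.inr (hf' j hj).norm)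
  rw [rawMeasure, integral_finsetSum_measure fun j hj => (i1 j hj).add_measure (i2 j hj)]
  refine Finset.sum_congr rfl fun j hj => ?_
  rw [integral_add_measure (i1 j hj) (i2 j hj), integral_atomMeasure (h1 j),
    integral_atomMeasure (h2 j),
    ((hf j hj).const_smul _).tsum_add ((hf' j hj).const_smul _)]

lemma rawMeasure_kernel_iff (hp : ∀ j, 0 < p j)
    (N : Seminorm ℝ (PathSpace m h)) :
    rawMeasure m h Finset.univ β p d {x | N x = 0 ∧ x ≠ 0} = 0 ↔
      ∀ j k, N (coeffVec (d j) m h k) = 0 → coeffVec (d j) m h k = 0 := by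
  have hA : MeasurableSet {x | N x = 0 ∧ x ≠ 0} :=
    ((continuous_seminorm N).measurable (measurableSet_singleton 0)).inter
      (measurableSet_singleton 0).compl
  rw [rawMeasure, Measure.finsetSum_apply, Finset.sum_eq_zero_iff]
  simp only [Finset.mem_univ, forall_const, Measure.add_apply, add_eq_zero,
    atomMeasure_eq_zero_iff hA]
  refine forall_congr' fun j => ?_
  have hmem : ∀ k, (p j • coeffVec (d j) m h k ∉ {x | N x = 0 ∧ x ≠ 0}) ↔
      (N (coeffVec (d j) m h k) = 0 → coeffVec (d j) m h k = 0) := by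
    intro k
    change ¬ (N (p j • coeffVec (d j) m h k) = 0 ∧ p j • coeffVec (d j) m h k ≠ 0) ↔ _
    rw [seminorm_smul_pos N (hp j), mul_eq_zero, or_iff_right (hp j).ne', smul_ne_zero_iff]
    have := (hp j).ne'
    tauto
  have hmem' : ∀ k, (-(p j • coeffVec (d j) m h k) ∉ {x | N x = 0 ∧ x ≠ 0}) ↔
      (N (coeffVec (d j) m h k) = 0 → coeffVec (d j) m h k = 0) := by
    intro k
    rw [← hmem k]
    change ¬ (N (-(p j • coeffVec (d j) m h k)) = 0 ∧ -(p j • coeffVec (d j) m h k) ≠ 0) ↔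
      ¬ (N (p j • coeffVec (d j) m h k) = 0 ∧ p j • coeffVec (d j) m h k ≠ 0)
    rw [map_neg_eq_map, neg_ne_zero]
  simp only [hmem, hmem']
  constructor
  · rintro ⟨h1 | h1, h2 | h2⟩
    · linarith
    · exact h2
    · exact h1
    · exact h1
  · exact fun h3 => ⟨Or.inr h3, Or.inr h3⟩

lemma rawMeasure_kernel_subset {N : Seminorm ℝ (PathSpace m h)}
    (hK : rawMeasure m h Finset.univ β p d {x | N x = 0 ∧ x ≠ 0} = 0) :
    rawMeasure m h S β p d {x | N x = 0 ∧ x ≠ 0} = 0 := by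
  rw [rawMeasure, Measure.finsetSum_apply] at hK ⊢
  rw [Finset.sum_eq_zero_iff] at hK ⊢
  exact fun j _ => hK j (Finset.mem_univ j)

lemma cylProj_rawMeasure (α : ℝ) (hβ : ∀ j, β j ∈ Set.Icc (-1 : ℝ) 1) (hp : ∀ j, 0 < p j)
    (N : Seminorm ℝ (PathSpace m h)) :
    cylProj α N (rawMeasure m h Finset.univ β p d) = cylinderMeasure α β p d N := by
  rw [rawMeasure, cylProj_finsetSum, cylinderMeasure]
  refine Finset.sum_congr rfl fun j _ => ?_
  have h1 : 0 ≤ (1 + β j) / 2 := by linarith [(hβ j).1]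
  have h2 : 0 ≤ (1 - β j) / 2 := by linarith [(hβ j).2]
  rw [cylProj_add, cylProj_atomMeasure _ _ h1, cylProj_atomMeasure _ _ h2,
    Finset.sum_pair (by norm_num)]
  have hN : ∀ k, N (p j • coeffVec (d j) m h k) = p j * N (coeffVec (d j) m h k) := fun k =>
    seminorm_smul_pos N (hp j) _
  have hpow : ∀ k, (p j * N (coeffVec (d j) m h k)) ^ α = p j ^ α * N (coeffVec (d j) m h k) ^ α :=
    fun k => Real.mul_rpow (hp j).le (apply_nonneg N _)
  have hdiv : ∀ k, (p j * N (coeffVec (d j) m h k))⁻¹ * p j = 1 / N (coeffVec (d j) m h k) := by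
    intro k
    rw [mul_inv, mul_right_comm, inv_mul_cancel₀ (hp j).ne', one_mul, one_div]
  congr 1
  · congr 1; ext1 k
    rw [hN, hpow, smul_smul, hdiv, one_mul, mul_assoc]
  · congr 1; ext1 k
    rw [map_neg_eq_map, hN, hpow, smul_neg, smul_smul, hdiv, ← neg_smul, neg_one_mul, ← neg_div,
      mul_assoc]
    rfl

/-- Summability of the weights of the coefficients. -/
def HasSummableGrowth (α : ℝ) (d : Fin J → ℤ → ℝ) : Prop :=
  ∀ j, Summable (fun k => growth α (d j k))

/-- Each coordinate of the window is a translate of the sequence, and the largest coordinate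
controls the norm. -/
lemma summable_growth_coeffVec {α : ℝ} (hα₀ : 0 < α) {e : ℤ → ℝ}
    (he : Summable (fun k => growth α (e k))) :
    Summable (fun k => growth α ‖coeffVec e m h k‖) := by
  have hi : ∀ i : Fin (m + h + 1), Summable (fun k : ℤ => growth α (e (k + m - i))) := by
    intro i
    have := (Equiv.addRight ((m : ℤ) - i)).summable_iff.2 he
    refine this.congr fun k => ?_
    simp [add_sub_assoc]
  refine Summable.of_nonneg_of_le (fun k => growth_nonneg _ _) (fun k => ?_)
    ((summable_sum (s := Finset.univ) fun i _ => hi i).mul_left (growth α (m + h + 1 : ℕ)))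
  obtain ⟨i, hs⟩ := exists_norm_le_coord (coeffVec e m h k)
  calc growth α ‖coeffVec e m h k‖ ≤ growth α ((m + h + 1 : ℕ) * coeffVec e m h k i) :=
        growth_mono hα₀ (by rwa [abs_norm, abs_mul, abs_of_nonneg (Nat.cast_nonneg _)])
    _ ≤ growth α (m + h + 1 : ℕ) * growth α (coeffVec e m h k i) := growth_mul_le _ _ _
    _ ≤ _ := mul_le_mul_of_nonneg_left
        (Finset.single_le_sum (f := fun i : Fin (m + h + 1) => growth α (e (k + m - i)))
          (fun _ _ => growth_nonneg _ _) (Finset.mem_univ i)) (growth_nonneg _ _)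

lemma isAdmissible_rawMeasure {α : ℝ} (hα₀ : 0 < α) (hβ : ∀ j, β j ∈ Set.Icc (-1 : ℝ) 1)
    (hd : HasSummableGrowth α d) : IsAdmissible α (rawMeasure m h S β p d) := by
  rw [IsAdmissible, integrable_rawMeasure_iff hβ fun x => by rw [norm_neg]]
  intro j _
  refine Summable.of_nonneg_of_le (fun k => norm_nonneg _) (fun k => ?_)
    ((summable_growth_coeffVec (m := m) (h := h) hα₀ (hd j)).mul_left (growth α (p j)))
  rw [Real.norm_of_nonneg (growth_nonneg _ _), norm_smul]
  exact (growth_mul_le _ _ _).trans_eq (by rw [Real.norm_eq_abs, growth_abs])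

/-- Skewness b is a mixture of the totally skewed exponents at x and -x. This is why the atoms come
in pairs ± with weights (1 ± β_j)/2. -/
lemma stableExponent_decomp (α b x : ℝ) :
    ((1 + b) / 2) • stableExponent α 1 x + ((1 - b) / 2) • stableExponent α 1 (-x)
      = stableExponent α b x := by
  rw [stableExponent_neg]
  apply Complex.ext
  · simp only [Complex.add_re, Complex.smul_re, Complex.conj_re, stableExponent_re, smul_eq_mul]
    ring
  · simp only [Complex.add_im, Complex.smul_im, Complex.conj_im, stableExponent_im, smul_eq_mul]
    ring

lemma summable_stableExponent_one {α : ℝ} (hα₀ : 0 < α) (hd : HasSummableGrowth α d)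
    (j : Fin J) (c : ℝ) (u : PathSpace m h) :
    Summable (fun k => stableExponent α 1 (c * inner ℝ u (coeffVec (d j) m h k))) := by
  refine Summable.of_norm_bounded (((summable_growth_coeffVec (m := m) (h := h) hα₀ (hd j)).mul_left
    (growth α c * growth α ‖u‖)).mul_left (1 + |Real.tan (Real.pi * α / 2)|)) fun k => ?_
  refine (norm_stableExponent_le _ _).trans (mul_le_mul_of_nonneg_left ?_ (by positivity))
  refine (growth_mul_le _ _ _).trans ?_
  rw [mul_assoc]
  exact mul_le_mul_of_nonneg_left (growth_inner_le hα₀ _ _) (growth_nonneg _ _)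

lemma summable_stableExponent {α : ℝ} (hα₀ : 0 < α) (hd : HasSummableGrowth α d)
    (j : Fin J) (b c : ℝ) (u : PathSpace m h) :
    Summable (fun k => stableExponent α b (c * inner ℝ u (coeffVec (d j) m h k))) := by
  simp_rw [← stableExponent_decomp α b, ← neg_mul]
  exact ((summable_stableExponent_one hα₀ hd j c u).const_smul _).add
    ((summable_stableExponent_one hα₀ hd j (-c) u).const_smul _)

lemma specExponent_rawMeasure {α : ℝ} (hα₀ : 0 < α) (hβ : ∀ j, β j ∈ Set.Icc (-1 : ℝ) 1)
    (hd : HasSummableGrowth α d) (u : PathSpace m h) :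
    specExponent α (rawMeasure m h S β p d) u
      = ∑ j ∈ S, ∑' k, stableExponent α (β j) (p j * inner ℝ u (coeffVec (d j) m h k)) := by
  rw [specExponent, integral_rawMeasure hβ]
  · refine Finset.sum_congr rfl fun j _ => tsum_congr fun k => ?_
    rw [inner_neg_right, inner_smul_right, stableExponent_decomp]
  · intro j _
    simp only [inner_smul_right]
    exact summable_stableExponent_one hα₀ hd j (p j) u
  · intro j _
    simp only [inner_neg_right, inner_smul_right, ← neg_mul]
    exact summable_stableExponent_one hα₀ hd j (-p j) u

/-- Components with β_j = 0 have a real exponent. They must be dropped when the logarithmic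
integrability is only known for the others. -/
lemma specExponent_rawMeasure_im_filter {α : ℝ} (hα₀ : 0 < α)
    (hβ : ∀ j, β j ∈ Set.Icc (-1 : ℝ) 1) (hd : HasSummableGrowth α d) (u : PathSpace m h) :
    (specExponent α (rawMeasure m h (Finset.univ.filter fun j => β j ≠ 0) β p d) u).im
      = (specExponent α (rawMeasure m h Finset.univ β p d) u).im := by
  rw [specExponent_rawMeasure hα₀ hβ hd, specExponent_rawMeasure hα₀ hβ hd, Complex.im_sum,
    Complex.im_sum, Finset.sum_filter]
  refine Finset.sum_congr rfl fun j _ => ?_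
  split_ifs with hj
  · rfl
  · push Not at hj
    rw [Complex.im_tsum (summable_stableExponent hα₀ hd j _ _ u)]
    simp [hj, stableExponent_im]

lemma integrable_log_rawMeasure_iff (hβ : ∀ j, β j ∈ Set.Icc (-1 : ℝ) 1)
    {N : Seminorm ℝ (PathSpace m h)} :
    Integrable (fun s => Real.log (N s) • s) (rawMeasure m h S β p d) ↔
      ∀ j ∈ S, Summable (fun k => ‖Real.log (N (p j • coeffVec (d j) m h k)) •
        p j • coeffVec (d j) m h k‖) :=
  integrable_rawMeasure_iff hβ fun x => by rw [map_neg_eq_map, smul_neg, norm_neg]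

lemma shiftTerm_one (N : Seminorm ℝ (PathSpace m h)) (j : Fin J) (k : ℤ) :
    shiftTerm 1 β p d N j k = (-(2 / Real.pi) * β j) •
      (Real.log (N (p j • coeffVec (d j) m h k)) • p j • coeffVec (d j) m h k) := by
  rw [shiftTerm, if_pos rfl, smul_smul, smul_smul]
  congr 1; ring

lemma cylShift_rawMeasure (hβ : ∀ j, β j ∈ Set.Icc (-1 : ℝ) 1) {N : Seminorm ℝ (PathSpace m h)}
    (hL : Integrable (fun s => Real.log (N s) • s) (rawMeasure m h S β p d)) :
    cylShift N (rawMeasure m h S β p d) = ∑ j ∈ S, ∑' k, shiftTerm 1 β p d N j k := by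
  have hs := (integrable_log_rawMeasure_iff hβ).1 hL
  have hs1 : ∀ j ∈ S, Summable (fun k => Real.log (N (p j • coeffVec (d j) m h k)) •
      p j • coeffVec (d j) m h k) := fun j hj => (hs j hj).of_norm
  have e := integral_rawMeasure (f := fun s => Real.log (N s) • s) hβ hs1 fun j hj => by
    simp only [map_neg_eq_map, smul_neg]
    exact (hs1 j hj).neg
  rw [cylShift, e, Finset.smul_sum]
  refine Finset.sum_congr rfl fun j hj => ?_
  rw [← tsum_const_smul'']
  refine tsum_congr fun k => ?_
  rw [map_neg_eq_map, shiftTerm_one, smul_neg, smul_neg, ← sub_eq_add_neg, ← sub_smul, smul_smul]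
  congr 1; ring

/-- Summability of the shift terms says nothing about components with β_j = 0, whose terms vanish.
The remaining components carry the whole shift, and for them the nonzero factor -(2/π) β_j can be
divided out. -/
lemma cylShift_rawMeasure_filter (hβ : ∀ j, β j ∈ Set.Icc (-1 : ℝ) 1)
    {N : Seminorm ℝ (PathSpace m h)} (hs : ∀ j, Summable (shiftTerm 1 β p d N j)) :
    Integrable (fun s => Real.log (N s) • s)
        (rawMeasure m h (Finset.univ.filter fun j => β j ≠ 0) β p d) ∧
      cylShift N (rawMeasure m h (Finset.univ.filter fun j => β j ≠ 0) β p d)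
        = cylinderShift 1 β p d N := by
  have hL : Integrable (fun s => Real.log (N s) • s)
      (rawMeasure m h (Finset.univ.filter fun j => β j ≠ 0) β p d) := by
    rw [integrable_log_rawMeasure_iff hβ]
    intro j hj
    have hβj : β j ≠ 0 := (Finset.mem_filter.1 hj).2
    have hc : -(2 / Real.pi) * β j ≠ 0 :=
      mul_ne_zero (neg_ne_zero.2 (div_ne_zero two_ne_zero Real.pi_ne_zero)) hβj
    have h1 := (hs j).congr (shiftTerm_one N j)
    have h2 := h1.const_smul (-(2 / Real.pi) * β j)⁻¹
    simp only [inv_smul_smul₀ hc] at h2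
    exact h2.norm
  refine ⟨hL, ?_⟩
  rw [cylShift_rawMeasure hβ hL, cylinderShift, Finset.sum_filter]
  refine Finset.sum_congr rfl fun j _ => ?_
  split_ifs with hj
  · rfl
  · push Not at hj
    simp [shiftTerm, hj]

/-- The log-summability condition as an integrability condition. -/
lemma logSummable_iff (hβ : ∀ j, β j ∈ Set.Icc (-1 : ℝ) 1) (hp : ∀ j, 0 < p j)
    (hd : HasSummableGrowth 1 d) {N : Seminorm ℝ (PathSpace m h)} :
    (∀ j, LogSummable N (d j)) ↔
      rawMeasure m h Finset.univ β p d {x | N x = 0 ∧ x ≠ 0} = 0 ∧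
        Integrable (fun s => Real.log (N s) • s) (rawMeasure m h Finset.univ β p d) := by
  rw [rawMeasure_kernel_iff hp, integrable_log_rawMeasure_iff hβ]
  simp only [LogSummable, forall_and, Finset.mem_univ, forall_const]
  refine and_congr_right fun hK => forall_congr' fun j => ?_
  have hg := summable_growth_coeffVec (m := m) (h := h) one_pos (hd j)
  have hnorm : ∀ k, ‖Real.log (N (p j • coeffVec (d j) m h k)) • p j • coeffVec (d j) m h k‖
      = p j * (‖coeffVec (d j) m h k‖ * |Real.log (N (p j • coeffVec (d j) m h k))|) := by
    intro k
    rw [norm_smul, norm_smul, Real.norm_eq_abs, Real.norm_of_nonneg (hp j).le]; ring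
  simp_rw [hnorm]
  rw [summable_mul_left_iff (hp j).ne']
  -- Splits off the logarithm of the condition. The rest, log p_j + log ‖d_{j,k}‖, is summable
  -- against ‖d_{j,k}‖ by the growth hypothesis.
  have hlog : ∀ k, coeffVec (d j) m h k ≠ 0 →
      Real.log (N (p j • coeffVec (d j) m h k))
        = Real.log (N (coeffVec (d j) m h k) / ‖coeffVec (d j) m h k‖)
          + (Real.log (p j) + Real.log ‖coeffVec (d j) m h k‖) := by
    intro k hk
    have h1 : N (coeffVec (d j) m h k) ≠ 0 := fun h0 => hk (hK j k h0)
    rw [seminorm_smul_pos N (hp j), Real.log_mul (hp j).ne' h1,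
      Real.log_div h1 (norm_ne_zero_iff.2 hk)]
    ring
  have hrest : Summable (fun k => ‖coeffVec (d j) m h k‖
      * |Real.log (p j) + Real.log ‖coeffVec (d j) m h k‖|) := by
    refine Summable.of_nonneg_of_le (fun k => by positivity) (fun k => ?_)
      (hg.mul_left (1 + |Real.log (p j)|))
    rw [growth_one, abs_norm]
    have h1 := abs_add_le (Real.log (p j)) (Real.log ‖coeffVec (d j) m h k‖)
    have h2 : |Real.log (p j) + Real.log ‖coeffVec (d j) m h k‖|
        ≤ (1 + |Real.log (p j)|) * (1 + |Real.log ‖coeffVec (d j) m h k‖|) := by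
      nlinarith [mul_nonneg (abs_nonneg (Real.log (p j)))
        (abs_nonneg (Real.log ‖coeffVec (d j) m h k‖))]
    calc _ ≤ ‖coeffVec (d j) m h k‖
          * ((1 + |Real.log (p j)|) * (1 + |Real.log ‖coeffVec (d j) m h k‖|)) :=
          mul_le_mul_of_nonneg_left h2 (norm_nonneg _)
      _ = _ := by ring
  have hle : ∀ a b c v : ℝ, 0 ≤ v → (v ≠ 0 → a = b + c) → v * |a| ≤ v * |b| + v * |c| := by
    intro a b c v hv hab
    rcases hv.eq_or_lt with h0 | h0
    · simp [← h0]
    · rw [hab h0.ne', ← mul_add]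
      exact mul_le_mul_of_nonneg_left (abs_add_le _ _) hv
  constructor
  · intro hs
    refine Summable.of_nonneg_of_le (fun k => by positivity) (fun k => ?_) (hs.add hrest)
    exact hle _ _ _ _ (norm_nonneg _) fun hv => hlog k (norm_ne_zero_iff.1 hv)
  · intro hs
    refine Summable.of_nonneg_of_le (fun k => by positivity) (fun k => ?_) (hs.add hrest)
    have := hle (Real.log (N (coeffVec (d j) m h k) / ‖coeffVec (d j) m h k‖))
      (Real.log (N (p j • coeffVec (d j) m h k)))
      (-(Real.log (p j) + Real.log ‖coeffVec (d j) m h k‖)) _ (norm_nonneg (coeffVec (d j) m h k))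
      fun hv => by rw [hlog k (norm_ne_zero_iff.1 hv)]; ring
    rwa [abs_neg] at this

end RawMeasure

/-! ### The characteristic function of a path -/

section Law

/-- For α ≠ 1, or α = 1 and β = 0, eventually |d_k| ≤ 1, and the power s < α absorbs |d_k|^α or the
logarithm. For α = 1 and β ≠ 0 the standing condition does not bound ∑ |d_k|: it holds for d ≡ 1.
With d_k → 0 as extra input, eventually |log |d_k|| ≥ 1. -/
lemma summable_growth_of_coeffCondition {α β : ℝ} {d : ℤ → ℝ} (hd : CoeffCondition α β d)
    (h0 : α = 1 → β ≠ 0 → Filter.Tendsto d Filter.cofinite (nhds 0)) :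
    Summable (fun k => growth α (d k)) := by
  have hsmall : ∀ s : ℝ, 0 < s → Summable (fun k => |d k| ^ s) →
      ∀ᶠ k in Filter.cofinite, |d k| ≤ 1 := by
    intro s hs hsum
    filter_upwards [hsum.tendsto_cofinite_zero.eventually (gt_mem_nhds one_pos)] with k hk
    by_contra hlt
    push Not at hlt
    exact absurd (Real.one_le_rpow hlt.le hs.le) (not_le.2 hk)
  by_cases hα : α = 1
  · subst hα
    by_cases hβ : β = 0
    · obtain ⟨s, hs0, hs1, -, hsum⟩ := hd.summable_rpow (Or.inr hβ)
      have h1s : 0 < 1 - s := by linarith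
      refine Summable.of_norm_bounded_eventually (hsum.mul_left (1 + 1 / (1 - s))) ?_
      filter_upwards [hsmall s hs0 hsum] with k hk
      rw [Real.norm_of_nonneg (growth_nonneg _ _), growth_one]
      rcases (abs_nonneg (d k)).eq_or_lt with h | h
      · rw [← h, zero_mul]; positivity
      have h2 := Real.abs_log_mul_self_rpow_lt _ _ h hk h1s
      rw [Real.log_abs, abs_mul, abs_of_nonneg (Real.rpow_nonneg h.le (1 - s))] at h2
      have h3 : |d k| = |d k| ^ s * |d k| ^ (1 - s) := by rw [← Real.rpow_add h]; simp
      have h4 : |d k| ^ (1 - s) ≤ 1 := Real.rpow_le_one h.le hk h1s.le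
      have h5 : 0 ≤ |d k| ^ s := Real.rpow_nonneg h.le _
      calc |d k| * (1 + |Real.log (d k)|)
          = |d k| ^ s * (|d k| ^ (1 - s) + |Real.log (d k)| * |d k| ^ (1 - s)) := by
            nth_rw 1 [h3]; ring
        _ ≤ |d k| ^ s * (1 + 1 / (1 - s)) := mul_le_mul_of_nonneg_left (by linarith) h5
        _ = _ := by ring
    · have hsum := hd.summable_log rfl hβ
      refine Summable.of_norm_bounded_eventually (hsum.mul_left 2) ?_
      have h1 := (h0 rfl hβ).abs
      rw [abs_zero] at h1
      filter_upwards [h1.eventually (gt_mem_nhds (Real.exp_pos (-1)))] with k hk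
      rw [Real.norm_of_nonneg (growth_nonneg _ _), growth_one, Real.log_abs]
      rcases (abs_nonneg (d k)).eq_or_lt with h | h
      · rw [← h]; simp
      have h2 : Real.log |d k| < -1 := (Real.log_lt_iff_lt_exp h).2 hk
      rw [Real.log_abs] at h2
      have h3 : 1 ≤ |Real.log (d k)| := by
        rw [abs_of_neg (by linarith)]; linarith
      nlinarith
  · obtain ⟨s, hs0, hsα, -, hsum⟩ := hd.summable_rpow (Or.inl hα)
    refine Summable.of_norm_bounded_eventually hsum ?_
    filter_upwards [hsmall s hs0 hsum] with k hk
    rw [Real.norm_of_nonneg (growth_nonneg _ _), growth_of_ne_one hα]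
    rcases (abs_nonneg (d k)).eq_or_lt with h | h
    · rw [← h, Real.zero_rpow (by linarith : α ≠ 0)]; positivity
    · exact Real.rpow_le_rpow_of_exponent_ge h hk hsα.le

variable {Ω : Type*} [MeasurableSpace Ω] {μ : Measure Ω} [IsProbabilityMeasure μ]

/-- The terms of a convergent series tend to 0 almost surely, so the characteristic functions of d_k
Y_k at 1 tend to 1. Their moduli are exp(-|d_k|). -/
lemma tendsto_zero_of_hasSum {b : ℝ} {d : ℤ → ℝ} {Y : ℤ → Ω → ℝ} {Z : Ω → ℝ}
    (hY : ∀ k, Measurable (Y k)) (hlaw : ∀ k, IsStdStableLaw 1 b (μ.map (Y k)))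
    (hs : ∀ᵐ ω ∂μ, HasSum (fun k => d k * Y k ω) (Z ω)) :
    Filter.Tendsto d Filter.cofinite (nhds 0) := by
  -- Dominated convergence along a filter needs it to be countably generated.
  have hcg : (Filter.cofinite : Filter ℤ).IsCountablyGenerated := by
    rw [Int.cofinite_eq]; infer_instance
  have h1 : Filter.Tendsto (fun k => ∫ ω, Complex.exp ((d k * Y k ω : ℝ) * Complex.I) ∂μ)
      Filter.cofinite (nhds (∫ _, (1 : ℂ) ∂μ)) := by
    refine tendsto_integral_filter_of_dominated_convergence (fun _ => 1) ?_ ?_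
      (integrable_const _) ?_
    · refine Filter.Eventually.of_forall fun k => ?_
      have := hY k
      exact Measurable.aestronglyMeasurable (by fun_prop)
    · exact Filter.Eventually.of_forall fun k => ae_of_all _ fun ω =>
        (Complex.norm_exp_ofReal_mul_I _).le
    · filter_upwards [hs] with ω hω
      have h2 := hω.summable.tendsto_cofinite_zero
      have h3 : Continuous (fun x : ℝ => Complex.exp (x * Complex.I)) := by fun_prop
      have h4 := (h3.tendsto 0).comp h2
      simpa only [Function.comp_def, Complex.ofReal_zero, zero_mul, Complex.exp_zero] using h4
  have h2 : ∀ k, ‖∫ ω, Complex.exp ((d k * Y k ω : ℝ) * Complex.I) ∂μ‖ = Real.exp (-|d k|) := by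
    intro k
    have h3 := hlaw k (d k)
    rw [charFun_apply_real, integral_map (hY k).aemeasurable
      (Continuous.aestronglyMeasurable (by fun_prop))] at h3
    push_cast
    rw [h3, Complex.norm_exp, Complex.neg_re, stableExponent_re, Real.rpow_one]
  have h3 := h1.norm
  simp only [h2, integral_const, probReal_univ, one_smul, norm_one] at h3
  have h4 := (Real.continuousAt_log one_ne_zero).tendsto.comp h3
  simp only [Function.comp_def, Real.log_exp, Real.log_one] at h4
  rw [tendsto_zero_iff_abs_tendsto_zero]
  simpa [Function.comp_def] using h4.neg

variable {J : ℕ} {α : ℝ} {β p : Fin J → ℝ} {d : Fin J → ℤ → ℝ} {ε L : Fin J → ℤ → Ω → ℝ}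
  {X : ℤ → Ω → ℝ}

lemma IsStableAggregate.hasSummableGrowth (hX : IsStableAggregate μ α β p d ε L X) :
    HasSummableGrowth α d := by
  intro j
  refine summable_growth_of_coeffCondition (hX.coeff j) fun hα _ => ?_
  subst hα
  refine tendsto_zero_of_hasSum (Y := fun k => ε j (0 + k)) (fun k => hX.measurable j _)
    (fun k => hX.law j _) (hX.latent j 0)

/-- Latent processes are only given as almost sure limits. Measurability comes from the partial sums
over finite sets, a countably generated net. -/
lemma IsStableAggregate.aemeasurable_latent (hX : IsStableAggregate μ α β p d ε L X)
    (j : Fin J) (t : ℤ) : AEMeasurable (L j t) μ := by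
  refine aemeasurable_of_tendsto_metrizable_ae (Filter.atTop : Filter (Finset ℤ))
    (f := fun s ω => ∑ k ∈ s, d j k * ε j (t + k) ω) (fun s => ?_) (hX.latent j t)
  have := hX.measurable j
  exact Measurable.aemeasurable (by fun_prop)

lemma IsStableAggregate.aemeasurable (hX : IsStableAggregate μ α β p d ε L X) (t : ℤ) :
    AEMeasurable (X t) μ := by
  refine AEMeasurable.congr ?_ (Filter.EventuallyEq.symm (hX.aggregate t))
  have := hX.aemeasurable_latent
  fun_prop

lemma IsStableAggregate.aemeasurable_path (hX : IsStableAggregate μ α β p d ε L X)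
    (m h : ℕ) (t : ℤ) : AEMeasurable (path X m h t) μ := by
  have h1 : AEMeasurable (fun ω => fun i : Fin (m + h + 1) => X (t - m + i) ω) μ :=
    aemeasurable_pi_lambda _ fun i => hX.aemeasurable _
  exact (MeasurableEquiv.toLp 2 (Fin (m + h + 1) → ℝ)).measurable.comp_aemeasurable h1

/-- Almost surely, the linear forms of a path are sums of linear forms of the coefficient vectors. -/
lemma IsStableAggregate.hasSum_inner_path (hX : IsStableAggregate μ α β p d ε L X)
    (m h : ℕ) (t : ℤ) (u : PathSpace m h) :
    ∀ᵐ ω ∂μ, Filter.Tendsto (fun s : Finset ℤ => ∑ q ∈ Finset.univ ×ˢ s,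
        (p q.1 * inner ℝ u (coeffVec (d q.1) m h q.2)) * ε q.1 (t + q.2) ω)
      Filter.atTop (nhds (inner ℝ (path X m h t ω) u)) := by
  have h1 : ∀ᵐ ω ∂μ, ∀ i : Fin (m + h + 1), X (t - m + i) ω = ∑ j, p j * L j (t - m + i) ω :=
    ae_all_iff.2 fun i => hX.aggregate _
  have h2 : ∀ᵐ ω ∂μ, ∀ j, ∀ i : Fin (m + h + 1),
      HasSum (fun k : ℤ => d j k * ε j (t - m + i + k) ω) (L j (t - m + i) ω) :=
    ae_all_iff.2 fun j => ae_all_iff.2 fun i => hX.latent j _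
  filter_upwards [h1, h2] with ω hω1 hω2
  have hj : ∀ j, HasSum (fun l : ℤ => (p j * inner ℝ u (coeffVec (d j) m h l)) * ε j (t + l) ω)
      (p j * ∑ i : Fin (m + h + 1), u i * L j (t - m + i) ω) := by
    intro j
    have hi : ∀ i : Fin (m + h + 1), HasSum (fun l : ℤ => u i * (d j (l + m - i) * ε j (t + l) ω))
        (u i * L j (t - m + i) ω) := by
      intro i
      refine HasSum.mul_left _ ?_
      -- Reindexing by k = l + m - i attaches the same error, at time t + l, to index l in every
      -- coordinate.
      have := (Equiv.addRight ((m : ℤ) - i)).hasSum_iff.2 (hω2 j i)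
      have hf : (fun l : ℤ => d j (l + m - i) * ε j (t + l) ω)
          = (fun k : ℤ => d j k * ε j (t - m + i + k) ω) ∘ Equiv.addRight ((m : ℤ) - i) := by
        ext l
        simp only [Function.comp_apply, Equiv.coe_addRight]
        rw [show l + ((m : ℤ) - i) = l + m - i by ring,
          show t - (m : ℤ) + i + (l + m - i) = t + l by ring]
      rw [hf]
      exact this
    have hsum := (hasSum_sum (s := Finset.univ) fun i _ => hi i).mul_left (p j)
    have hf : (fun l : ℤ => (p j * inner ℝ u (coeffVec (d j) m h l)) * ε j (t + l) ω)
        = fun l => p j * ∑ i : Fin (m + h + 1), u i * (d j (l + m - i) * ε j (t + l) ω) := by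
      ext l
      rw [PiLp.inner_apply, mul_assoc, Finset.sum_mul]
      congr 1
      refine Finset.sum_congr rfl fun i _ => ?_
      simp only [coeffVec, RCLike.inner_apply, conj_trivial]
      ring
    rw [hf]
    exact hsum
  have hlim := tendsto_finsetSum (Finset.univ : Finset (Fin J)) fun j _ => hj j
  have e : inner ℝ (path X m h t ω) u
      = ∑ j, p j * ∑ i : Fin (m + h + 1), u i * L j (t - m + i) ω := by
    rw [PiLp.inner_apply]
    simp only [path, RCLike.inner_apply, conj_trivial, hω1, Finset.mul_sum]
    rw [Finset.sum_comm]
    refine Finset.sum_congr rfl fun j _ => Finset.sum_congr rfl fun i _ => ?_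
    ring
  rw [e]
  refine hlim.congr fun s => ?_
  rw [Finset.sum_product]

/-- Independence factorises the characteristic function of each finite partial sum. One side of the
limit is dominated convergence, the other is summability of the exponents. -/
lemma IsStableAggregate.charFun_pathLaw (hX : IsStableAggregate μ α β p d ε L X)
    (hα₀ : 0 < α) (m h : ℕ) (t : ℤ) (u : PathSpace m h) :
    charFun (pathLaw μ X m h t) u
      = Complex.exp (-specExponent α (rawMeasure m h Finset.univ β p d) u) := by
  have hd := hX.hasSummableGrowth
  set c : Fin J × ℤ → ℝ := fun q => p q.1 * inner ℝ u (coeffVec (d q.1) m h q.2) with hc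
  have hm := hX.measurable
  have hpart : ∀ s : Finset ℤ,
      ∫ ω, Complex.exp ((∑ q ∈ Finset.univ ×ˢ s, c q * ε q.1 (t + q.2) ω : ℝ) * Complex.I) ∂μ
        = Complex.exp (-∑ j, ∑ k ∈ s, stableExponent α (β j) (c (j, k))) := by
    intro s
    have hZ : Measurable (fun ω => ∑ q ∈ Finset.univ ×ˢ s, c q * ε q.1 (t + q.2) ω) := by fun_prop
    have e1 : ∫ ω, Complex.exp
        ((∑ q ∈ Finset.univ ×ˢ s, c q * ε q.1 (t + q.2) ω : ℝ) * Complex.I) ∂μ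
        = charFun (μ.map (fun ω => ∑ q ∈ Finset.univ ×ˢ s, c q * ε q.1 (t + q.2) ω)) 1 := by
      rw [charFun_apply_real, integral_map hZ.aemeasurable
        (Continuous.aestronglyMeasurable (by fun_prop))]
      simp
    have hind : iIndepFun (fun q : Fin J × ℤ => fun ω => c q * ε q.1 (t + q.2) ω) μ := by
      have hinj : Function.Injective (fun q : Fin J × ℤ => (q.1, t + q.2)) := by
        rintro ⟨a, b⟩ ⟨a', b'⟩ hab
        simpa using hab
      exact (hX.indep.precomp hinj).comp (fun q x => c q * x) fun q => by fun_prop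
    rw [e1, iIndepFun.charFun_map_fun_finsetSum_eq_prod
      (X := fun q : Fin J × ℤ => fun ω => c q * ε q.1 (t + q.2) ω)
      (fun q _ => Measurable.aemeasurable (by fun_prop))
      (hind.precomp (g := ((↑) : (Finset.univ ×ˢ s : Finset (Fin J × ℤ)) → Fin J × ℤ))
        Subtype.val_injective), Finset.prod_apply]
    have e2 : ∀ q : Fin J × ℤ, charFun (μ.map (fun ω => c q * ε q.1 (t + q.2) ω)) 1
        = Complex.exp (-stableExponent α (β q.1) (c q)) := by
      intro q
      rw [charFun_map_mul_comp (hm _ _).aemeasurable, mul_one, hX.law]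
    simp_rw [e2]
    rw [← Complex.exp_sum, Finset.sum_neg_distrib, Finset.sum_product]
  have hlim1 : Filter.Tendsto (fun s : Finset ℤ =>
      ∫ ω, Complex.exp ((∑ q ∈ Finset.univ ×ˢ s, c q * ε q.1 (t + q.2) ω : ℝ) * Complex.I) ∂μ)
      Filter.atTop (nhds (charFun (pathLaw μ X m h t) u)) := by
    rw [pathLaw, charFun_apply, integral_map (hX.aemeasurable_path m h t)
      (Continuous.aestronglyMeasurable (by fun_prop))]
    refine tendsto_integral_filter_of_dominated_convergence (fun _ => 1) ?_ ?_
      (integrable_const _) ?_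
    · exact Filter.Eventually.of_forall fun s => Measurable.aestronglyMeasurable (by fun_prop)
    · exact Filter.Eventually.of_forall fun s => ae_of_all _ fun ω =>
        (Complex.norm_exp_ofReal_mul_I _).le
    · filter_upwards [hX.hasSum_inner_path m h t u] with ω hω
      have h3 : Continuous (fun x : ℝ => Complex.exp (x * Complex.I)) := by fun_prop
      exact (h3.tendsto _).comp hω
  have hlim2 : Filter.Tendsto (fun s : Finset ℤ =>
      Complex.exp (-∑ j, ∑ k ∈ s, stableExponent α (β j) (c (j, k)))) Filter.atTop
      (nhds (Complex.exp (-specExponent α (rawMeasure m h Finset.univ β p d) u))) := by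
    refine (Complex.continuous_exp.tendsto _).comp (Filter.Tendsto.neg ?_)
    rw [specExponent_rawMeasure hα₀ hX.skewness hd]
    exact tendsto_finsetSum _ fun j _ =>
      (summable_stableExponent hα₀ hd j (β j) (p j) u).hasSum
  simp_rw [hpart] at hlim1
  exact tendsto_nhds_unique hlim1 hlim2

/-- Stationarity: the exponent does not involve t. Thus symmetry at one time gives symmetry at all
times. -/
lemma IsStableAggregate.pathLaw_eq (hX : IsStableAggregate μ α β p d ε L X) (hα₀ : 0 < α)
    (m h : ℕ) (t t' : ℤ) : pathLaw μ X m h t = pathLaw μ X m h t' := by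
  have h1 : ∀ t, IsFiniteMeasure (pathLaw μ X m h t) := fun t => by
    unfold pathLaw; infer_instance
  refine Measure.ext_of_charFun ?_
  ext u
  rw [hX.charFun_pathLaw hα₀, hX.charFun_pathLaw hα₀]

/-- A latent moving average is a stable aggregate with one component. -/
lemma IsStableAggregate.single (hX : IsStableAggregate μ α β p d ε L X) (j : Fin J) :
    IsStableAggregate μ α (fun _ : Fin 1 => β j) (fun _ => 1) (fun _ => d j) (fun _ => ε j)
      (fun _ => L j) (L j) where
  skewness _ := hX.skewness j
  weight_pos _ := one_pos
  coeff _ := hX.coeff j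
  measurable _ t := hX.measurable j t
  indep := by
    have hinj : Function.Injective (fun q : Fin 1 × ℤ => (j, q.2)) := by
      rintro ⟨a, b⟩ ⟨a', b'⟩ hab
      have : b = b' := by simpa using hab
      exact Prod.ext (Subsingleton.elim _ _) this
    exact hX.indep.precomp hinj
  law _ t := hX.law j t
  latent _ := hX.latent j
  aggregate t := ae_of_all _ fun ω => by simp

end Law

/-! ### Comparison of past semi-norms and runs of zeros -/

section PastSeminorm

variable {m h : ℕ}

/-- The restriction to the observed coordinates. -/
def observed (m h : ℕ) : PathSpace m h →ₗ[ℝ] (Fin (m + 1) → ℝ) where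
  toFun x i := x ⟨i, by omega⟩
  map_add' _ _ := rfl
  map_smul' _ _ := rfl

lemma exists_pastSeminorm (m h : ℕ) : ∃ N : Seminorm ℝ (PathSpace m h), IsPastSeminorm N := by
  refine ⟨(normSeminorm ℝ (Fin (m + 1) → ℝ)).comp (observed m h), fun x => ?_⟩
  rw [Seminorm.comp_apply, coe_normSeminorm, norm_eq_zero, funext_iff]
  constructor
  · exact fun hx i hi => hx ⟨i, by omega⟩
  · exact fun hx i => hx ⟨i, by omega⟩ (by simp only; omega)

/-- The vector with the future coordinates replaced by zero. -/
def truncFuture (x : PathSpace m h) : PathSpace m h :=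
  WithLp.toLp 2 fun i => if (i : ℕ) ≤ m then x i else 0

lemma seminorm_truncFuture {N : Seminorm ℝ (PathSpace m h)} (hN : IsPastSeminorm N)
    (x : PathSpace m h) : N (truncFuture x) = N x := by
  have h0 : N (truncFuture x - x) = 0 := by
    rw [hN]
    intro i hi
    simp [truncFuture, hi]
  have h1 := abs_sub_map_le_sub N (truncFuture x) x
  rw [h0] at h1
  exact sub_eq_zero.1 (abs_nonpos_iff.1 h1)

/-- Past semi-norms ignore the future coordinates and are norms on the observed ones, where
compactness of the unit sphere compares them. -/
lemma exists_le_mul_pastSeminorm {N N' : Seminorm ℝ (PathSpace m h)} (hN : IsPastSeminorm N)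
    (hN' : IsPastSeminorm N') : ∃ C, 0 < C ∧ ∀ x, N x ≤ C * N' x := by
  obtain ⟨C, hC, hle⟩ := exists_seminorm_le N
  set K : Set (PathSpace m h) := Metric.sphere 0 1 ∩ {x | ∀ i : Fin (m + h + 1), m < i → x i = 0}
    with hKdef
  have hK : IsCompact K := by
    refine (isCompact_sphere 0 1).inter_right ?_
    simp only [Set.ofPred_forall]
    exact isClosed_iInter fun i => isClosed_iInter fun _ =>
      isClosed_eq (by fun_prop) continuous_const
  have hne : K.Nonempty := by
    refine ⟨EuclideanSpace.single 0 1, by simp, fun i hi => ?_⟩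
    have : i ≠ 0 := by rintro rfl; simp at hi
    simp [this]
  obtain ⟨z, hz, hmin⟩ := hK.exists_isMinOn hne (continuous_seminorm N').continuousOn
  have hpos : 0 < N' z := by
    refine lt_of_le_of_ne (apply_nonneg N' z) fun h0 => ?_
    have h1 := (hN' z).1 h0.symm
    have h2 : z = 0 := by
      ext i
      by_cases hi : (i : ℕ) ≤ m
      · exact h1 i hi
      · exact hz.2 i (not_le.1 hi)
    have h3 : ‖z‖ = 1 := by simpa using hz.1
    rw [h2, norm_zero] at h3
    exact zero_ne_one h3
  refine ⟨C / N' z, div_pos hC hpos, fun x => ?_⟩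
  rw [← seminorm_truncFuture hN x, ← seminorm_truncFuture hN' x]
  set y := truncFuture x with hy
  refine (hle y).trans ?_
  by_cases h0 : y = 0
  · simp [h0]
  · have hny : 0 < ‖y‖ := norm_pos_iff.2 h0
    have hmem : ‖y‖⁻¹ • y ∈ K := by
      refine ⟨by simp [norm_smul, hny.ne'], fun i hi => ?_⟩
      simp [hy, truncFuture, not_le.2 hi]
    have h1 : N' z ≤ N' (‖y‖⁻¹ • y) := hmin hmem
    rw [seminorm_smul_pos N' (inv_pos.2 hny), inv_mul_eq_div, le_div_iff₀ hny] at h1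
    rw [div_mul_eq_mul_div, mul_div_assoc]
    refine mul_le_mul_of_nonneg_left ?_ hC.le
    rw [le_div_iff₀ hpos, mul_comm]
    exact h1

lemma pastSeminorm_kernel {N N' : Seminorm ℝ (PathSpace m h)} (hN : IsPastSeminorm N)
    (hN' : IsPastSeminorm N') :
    {x : PathSpace m h | N x = 0 ∧ x ≠ 0} = {x | N' x = 0 ∧ x ≠ 0} :=
  Set.ext fun x => and_congr_left fun _ => (hN x).trans (hN' x).symm

/-- By comparability log N - log N' is bounded off the common kernel, and ‖s‖ is integrable. So the
logarithmic condition does not depend on the past semi-norm. -/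
lemma integrable_log_of_pastSeminorm {N N' : Seminorm ℝ (PathSpace m h)} (hN : IsPastSeminorm N)
    (hN' : IsPastSeminorm N') {Γ : Measure (PathSpace m h)} (hΓ : IsAdmissible 1 Γ)
    (hi : Integrable (fun s => Real.log (N' s) • s) Γ) :
    Integrable (fun s => Real.log (N s) • s) Γ := by
  obtain ⟨C, hC, h1⟩ := exists_le_mul_pastSeminorm hN hN'
  obtain ⟨C', hC', h2⟩ := exists_le_mul_pastSeminorm hN' hN
  have hm : Integrable (fun s : PathSpace m h => ‖s‖) Γ := by simpa using hΓ.moment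
  have hlm : Measurable (fun s : PathSpace m h => Real.log (N s)) := by
    have := (continuous_seminorm N).measurable
    fun_prop
  refine (hi.norm.add (hm.const_mul (|Real.log C| + |Real.log C'|))).mono'
    (hlm.smul measurable_id).aestronglyMeasurable (ae_of_all _ fun s => ?_)
  rw [Pi.add_apply, norm_smul, norm_smul, ← add_mul, Real.norm_eq_abs, Real.norm_eq_abs]
  refine mul_le_mul_of_nonneg_right ?_ (norm_nonneg s)
  by_cases h0 : N s = 0
  · have h0' : N' s = 0 := (hN' s).2 ((hN s).1 h0)
    rw [h0, h0', Real.log_zero, abs_zero]; positivity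
  · have h0' : N' s ≠ 0 := fun h => h0 ((hN s).2 ((hN' s).1 h))
    have hp : 0 < N s := lt_of_le_of_ne (apply_nonneg N s) (Ne.symm h0)
    have hp' : 0 < N' s := lt_of_le_of_ne (apply_nonneg N' s) (Ne.symm h0')
    have e1 := Real.log_le_log hp (h1 s)
    have e2 := Real.log_le_log hp' (h2 s)
    rw [Real.log_mul hC.ne' h0'] at e1
    rw [Real.log_mul hC'.ne' h0] at e2
    have a1 := le_abs_self (Real.log C)
    have a2 := le_abs_self (Real.log C')
    have a3 := le_abs_self (Real.log (N' s))
    have a4 := neg_abs_le (Real.log (N' s))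
    have a5 := abs_nonneg (Real.log C)
    have a6 := abs_nonneg (Real.log C')
    rw [abs_le]
    constructor <;> linarith

/-- The coefficient vectors avoid the kernel of a past semi-norm if and only if runs of zeros have
length at most `m`. -/
lemma kernel_coeffVec_iff_m₀_le {N : Seminorm ℝ (PathSpace m h)} (hN : IsPastSeminorm N)
    (hh : 1 ≤ h) (d : ℤ → ℝ) :
    (∀ k, N (coeffVec d m h k) = 0 → coeffVec d m h k = 0) ↔ m₀ d ≤ (m : ℕ∞) := by
  rw [m₀, iSup₂_le_iff]
  constructor
  · rintro H M ⟨-, k, hz, hk⟩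
    by_contra hlt
    have hMm : m < M := by exact_mod_cast not_le.1 hlt
    -- More than m zeros after index k fill the observed block k+1, …, k+1+m of the window at k + 1.
    -- Its first future coordinate, which exists as h ≥ 1, is d_k.
    have h0 : coeffVec d m h (k + 1) = 0 := by
      apply H
      rw [hN]
      intro i hi
      have := hz (m + 1 - i) (by omega) (by omega)
      change d (k + 1 + m - (i : ℕ)) = 0
      rwa [show k + 1 + m - ((i : ℕ) : ℤ) = k + ((m + 1 - i : ℕ) : ℤ) by omega]
    have h1 : coeffVec d m h (k + 1) ⟨m + 1, by omega⟩ = 0 := by rw [h0]; rfl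
    apply hk
    change d (k + 1 + m - ((m + 1 : ℕ) : ℤ)) = 0 at h1
    rwa [show k + 1 + m - ((m + 1 : ℕ) : ℤ) = k by omega] at h1
  · intro H k hk
    rw [hN] at hk
    by_contra hne
    -- The first nonzero coordinate n of the window lies beyond m and is preceded by n zeros, which
    -- is a run of length n > m.
    have hex : ∃ n : ℕ, n < m + h + 1 ∧ d (k + m - n) ≠ 0 := by
      by_contra hcon
      push Not at hcon
      exact hne (by ext i; exact hcon i i.2)
    classical
    have hspec := Nat.find_spec hex
    have hmin := fun n => Nat.find_min hex (m := n)
    set n := Nat.find hex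
    have hn : m < n := by
      by_contra hle
      exact hspec.2 (hk ⟨n, hspec.1⟩ (not_lt.1 hle))
    have hmem : n ∈ zeroRuns d := by
      refine ⟨by omega, k + m - n, fun i hi1 hi2 => ?_, hspec.2⟩
      by_contra hd
      refine hmin (n - i) (by omega) ⟨by omega, ?_⟩
      rwa [show k + m - ((n - i : ℕ) : ℤ) = k + m - n + i by omega]
    have := H n hmem
    exact absurd hn (not_lt.2 (by exact_mod_cast this))

end PastSeminorm

/-! ### Spectral representations in terms of the projected measure -/

section Characterisation

variable {m h : ℕ}

lemma isSpectralRep_iff_of_symm {α : ℝ} (hα₀ : 0 < α) (hα₂ : α < 2)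
    {ν Γ₀ : Measure (PathSpace m h)} [SFinite Γ₀] (hΓ₀ : IsAdmissible α Γ₀)
    (hν : ∀ u, charFun ν u = Complex.exp (-specExponent α Γ₀ u)) {N : Seminorm ℝ (PathSpace m h)}
    (hK : Γ₀ {x | N x = 0 ∧ x ≠ 0} = 0) (hs : IsSymm ν) (Γ : Measure (PathSpace m h))
    (b : PathSpace m h) : IsSpectralRep α N ν Γ b ↔ Γ = cylProj α N Γ₀ ∧ b = 0 := by
  constructor
  · exact fun hr => ⟨(hr.eq_cylProj hα₀ hα₂ hΓ₀ hν).1, (hr.2.1 hs).2.1⟩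
  · rintro ⟨rfl, rfl⟩
    exact isSpectralRep_cylProj_of_symm hα₀ hα₂ hΓ₀ hν hK hs

lemma isSpectralRep_iff_of_ne_one {α : ℝ} (hα₀ : 0 < α) (hα₂ : α < 2) (hα : α ≠ 1)
    {ν Γ₀ : Measure (PathSpace m h)} [SFinite Γ₀] (hΓ₀ : IsAdmissible α Γ₀)
    (hν : ∀ u, charFun ν u = Complex.exp (-specExponent α Γ₀ u)) {N : Seminorm ℝ (PathSpace m h)}
    (hK : Γ₀ {x | N x = 0 ∧ x ≠ 0} = 0) (Γ : Measure (PathSpace m h)) (b : PathSpace m h) :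
    IsSpectralRep α N ν Γ b ↔ Γ = cylProj α N Γ₀ ∧ b = 0 := by
  by_cases hs : IsSymm ν
  · exact isSpectralRep_iff_of_symm hα₀ hα₂ hΓ₀ hν hK hs Γ b
  constructor
  · intro hr
    obtain ⟨h1, -, h3⟩ := hr.eq_cylProj hα₀ hα₂ hΓ₀ hν
    refine ⟨h1, ext_inner_left ℝ fun u => ?_⟩
    have h4 := (h3 hs).2 u
    rw [h1, specExponent_cylProj hα₀ hα hK] at h4
    simpa using h4
  · rintro ⟨rfl, rfl⟩
    exact isSpectralRep_cylProj hα₀ hα hΓ₀ hν hK hs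

lemma isSpectralRep_iff_of_integrable {ν Γ₀ : Measure (PathSpace m h)} [SFinite Γ₀]
    (hΓ₀ : IsAdmissible 1 Γ₀) (hν : ∀ u, charFun ν u = Complex.exp (-specExponent 1 Γ₀ u))
    {N : Seminorm ℝ (PathSpace m h)} (hK : Γ₀ {x | N x = 0 ∧ x ≠ 0} = 0) (hs : ¬ IsSymm ν)
    (hL : Integrable (fun s => Real.log (N s) • s) Γ₀) (Γ : Measure (PathSpace m h))
    (b : PathSpace m h) :
    IsSpectralRep 1 N ν Γ b ↔ Γ = cylProj 1 N Γ₀ ∧ b = cylShift N Γ₀ := by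
  constructor
  · intro hr
    obtain ⟨h1, -, h3⟩ := hr.eq_cylProj one_pos one_lt_two hΓ₀ hν
    refine ⟨h1, ext_inner_left ℝ fun u => ?_⟩
    have h4 := (h3 hs).2 u
    rw [h1, specExponent_one_cylProj hΓ₀ hK hL, add_sub_assoc, add_eq_left, ← mul_sub,
      mul_eq_zero, or_iff_right Complex.I_ne_zero, sub_eq_zero] at h4
    exact (Complex.ofReal_injective h4).symm
  · rintro ⟨rfl, rfl⟩
    exact isSpectralRep_cylProj_one hΓ₀ hν hK hs hL

end Characterisation

/-! ### Representability of the aggregate -/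

section Aggregate

variable {Ω : Type*} [MeasurableSpace Ω] {μ : Measure Ω} [IsProbabilityMeasure μ] {J : ℕ} {α : ℝ}
  {β p : Fin J → ℝ} {d : Fin J → ℤ → ℝ} {ε L : Fin J → ℤ → Ω → ℝ} {X : ℤ → Ω → ℝ} {m h : ℕ}

lemma rawMeasure_kernel_iff_iSup_le (hp : ∀ j, 0 < p j) {N : Seminorm ℝ (PathSpace m h)}
    (hN : IsPastSeminorm N) (hh : 1 ≤ h) :
    rawMeasure m h Finset.univ β p d {x | N x = 0 ∧ x ≠ 0} = 0 ↔
      (⨆ j, m₀ (d j)) ≤ (m : ℕ∞) := by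
  rw [rawMeasure_kernel_iff hp, iSup_le_iff]
  exact forall_congr' fun j => kernel_coeffVec_iff_m₀_le hN hh (d j)

lemma IsStableAggregate.kernel_eq_zero (hX : IsStableAggregate μ α β p d ε L X) (hα₀ : 0 < α)
    (hα₂ : α < 2) (hr : IsPastRepresentableAt μ α X m h) {N : Seminorm ℝ (PathSpace m h)}
    (hN : IsPastSeminorm N) :
    rawMeasure m h Finset.univ β p d {x | N x = 0 ∧ x ≠ 0} = 0 := by
  obtain ⟨N', hN', hr'⟩ := hr
  obtain ⟨Γ, b, hΓ⟩ := hr' 0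
  rw [pastSeminorm_kernel hN hN']
  exact (hΓ.eq_cylProj hα₀ hα₂ (isAdmissible_rawMeasure hα₀ hX.skewness hX.hasSummableGrowth)
    (hX.charFun_pathLaw hα₀ m h 0)).2.1

/-- A non-symmetric representation is admissible and equals the projection, which forces logarithmic
integrability for its own semi-norm, hence for every past semi-norm. -/
lemma IsStableAggregate.integrable_log (hX : IsStableAggregate μ 1 β p d ε L X)
    (hr : IsPastRepresentableAt μ 1 X m h) {N : Seminorm ℝ (PathSpace m h)}
    (hN : IsPastSeminorm N) {t : ℤ} (hs : ¬ IsSymm (pathLaw μ X m h t)) :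
    Integrable (fun s => Real.log (N s) • s) (rawMeasure m h Finset.univ β p d) := by
  have hadm := isAdmissible_rawMeasure (m := m) (h := h) (S := Finset.univ) (p := p) one_pos
    hX.skewness hX.hasSummableGrowth
  obtain ⟨N', hN', hr'⟩ := hr
  obtain ⟨Γ, b, hΓ⟩ := hr' t
  obtain ⟨h1, h2, h3⟩ := hΓ.eq_cylProj one_pos one_lt_two hadm (hX.charFun_pathLaw one_pos m h t)
  refine integrable_log_of_pastSeminorm hN hN' hadm ?_
  rw [← isAdmissible_cylProj_iff hadm h2, ← h1]
  exact (h3 hs).1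

lemma IsStableAggregate.isPastRepresentableAt (hX : IsStableAggregate μ α β p d ε L X)
    (hα₀ : 0 < α) (hα₂ : α < 2) {N : Seminorm ℝ (PathSpace m h)} (hN : IsPastSeminorm N)
    (hK : rawMeasure m h Finset.univ β p d {x | N x = 0 ∧ x ≠ 0} = 0) (t₀ : ℤ)
    (hcase : α ≠ 1 ∨ IsSymm (pathLaw μ X m h t₀) ∨
      Integrable (fun s => Real.log (N s) • s) (rawMeasure m h Finset.univ β p d)) :
    IsPastRepresentableAt μ α X m h := by
  have hadm := isAdmissible_rawMeasure (m := m) (h := h) (S := Finset.univ) (p := p) hα₀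
    hX.skewness hX.hasSummableGrowth
  refine ⟨N, hN, fun t => ?_⟩
  have hν := hX.charFun_pathLaw hα₀ m h t
  by_cases hs : IsSymm (pathLaw μ X m h t)
  · exact ⟨_, _, isSpectralRep_cylProj_of_symm hα₀ hα₂ hadm hν hK hs⟩
  by_cases hα : α = 1
  · subst hα
    rcases hcase with h1 | h1 | h1
    · exact absurd rfl h1
    · exact absurd (hX.pathLaw_eq one_pos m h t t₀ ▸ h1) hs
    · exact ⟨_, _, isSpectralRep_cylProj_one hadm hν hK hs h1⟩
  · exact ⟨_, _, isSpectralRep_cylProj hα₀ hα hadm hν hK hs⟩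

lemma IsStableAggregate.isPastRepresentableAt_iff (hX : IsStableAggregate μ α β p d ε L X)
    (hα₀ : 0 < α) (hα₂ : α < 2) (hα : α ≠ 1) (hh : 1 ≤ h) :
    IsPastRepresentableAt μ α X m h ↔ (⨆ j, m₀ (d j)) ≤ (m : ℕ∞) := by
  obtain ⟨N, hN⟩ := exists_pastSeminorm m h
  rw [← rawMeasure_kernel_iff_iSup_le (β := β) hX.weight_pos hN hh]
  exact ⟨fun hr => hX.kernel_eq_zero hα₀ hα₂ hr hN,
    fun hK => hX.isPastRepresentableAt hα₀ hα₂ hN hK 0 (Or.inl hα)⟩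

lemma IsStableAggregate.isPastRepresentable_iff (hX : IsStableAggregate μ α β p d ε L X)
    (hα₀ : 0 < α) (hα₂ : α < 2) (hα : α ≠ 1) :
    IsPastRepresentable μ α X ↔ (⨆ j, m₀ (d j)) < ⊤ := by
  constructor
  · rintro ⟨m, h, hh, hr⟩
    exact ((hX.isPastRepresentableAt_iff hα₀ hα₂ hα hh).1 hr).trans_lt (ENat.natCast_lt_top m)
  · intro hlt
    -- The smallest admissible m is the supremum itself, and any h ≥ 1 will do.
    refine ⟨(⨆ j, m₀ (d j)).toNat, 1, le_rfl,
      (hX.isPastRepresentableAt_iff hα₀ hα₂ hα le_rfl).2 ?_⟩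
    rw [ENat.natCast_toNat hlt.ne]

lemma iSup_fin_lt_top_iff {f : Fin J → ℕ∞} : (⨆ j, f j) < ⊤ ↔ ∀ j, f j < ⊤ := by
  constructor
  · exact fun hlt j => (le_iSup f j).trans_lt hlt
  · intro hf
    have hle : (⨆ j, f j) ≤ ((∑ j, (f j).toNat : ℕ) : ℕ∞) := by
      refine iSup_le fun j => ?_
      rw [← ENat.natCast_toNat (hf j).ne]
      exact_mod_cast Finset.single_le_sum (f := fun j => (f j).toNat) (fun _ _ => Nat.zero_le _)
        (Finset.mem_univ j)
    exact hle.trans_lt (ENat.natCast_lt_top _)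

/-- Representability when `α = 1`. -/
lemma IsStableAggregate.isPastRepresentableAt_one_iff (hX : IsStableAggregate μ 1 β p d ε L X)
    (hh : 1 ≤ h) {N : Seminorm ℝ (PathSpace m h)} (hN : IsPastSeminorm N) (t : ℤ) :
    IsPastRepresentableAt μ 1 X m h ↔ (⨆ j, m₀ (d j)) ≤ (m : ℕ∞) ∧
      (IsSymm (pathLaw μ X m h t) ∨
        (¬ IsSymm (pathLaw μ X m h t) ∧ ∀ j, LogSummable N (d j))) := by
  rw [← rawMeasure_kernel_iff_iSup_le (β := β) hX.weight_pos hN hh,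
    logSummable_iff hX.skewness hX.weight_pos hX.hasSummableGrowth]
  constructor
  · intro hr
    have hK := hX.kernel_eq_zero one_pos one_lt_two hr hN
    refine ⟨hK, ?_⟩
    by_cases hs : IsSymm (pathLaw μ X m h t)
    · exact Or.inl hs
    · exact Or.inr ⟨hs, hK, hX.integrable_log hr hN hs⟩
  · rintro ⟨hK, hcase⟩
    refine hX.isPastRepresentableAt one_pos one_lt_two hN hK t (Or.inr ?_)
    exact hcase.imp id fun h1 => h1.2.2

lemma summable_shiftTerm_of_ne_one (hα : α ≠ 1) (N : Seminorm ℝ (PathSpace m h)) (j : Fin J) :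
    Summable (shiftTerm α β p d N j) := by
  have : shiftTerm α β p d N j = fun _ => 0 := by ext1 k; simp [shiftTerm, hα]
  rw [this]
  exact summable_zero

lemma cylinderShift_of_ne_one (hα : α ≠ 1) (N : Seminorm ℝ (PathSpace m h)) :
    cylinderShift α β p d N = 0 := by
  simp [cylinderShift, shiftTerm, hα]

lemma summable_shiftTerm_of_integrable (hβ : ∀ j, β j ∈ Set.Icc (-1 : ℝ) 1)
    {N : Seminorm ℝ (PathSpace m h)}
    (hL : Integrable (fun s => Real.log (N s) • s) (rawMeasure m h Finset.univ β p d))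
    (j : Fin J) : Summable (shiftTerm 1 β p d N j) := by
  have h1 := ((integrable_log_rawMeasure_iff hβ).1 hL j (Finset.mem_univ j)).of_norm
  exact (h1.const_smul (-(2 / Real.pi) * β j)).congr fun k => (shiftTerm_one N j k).symm

end Aggregate

end StableAgg

end

theorem proposition4 {Ω : Type*} [MeasurableSpace Ω] (μ : Measure Ω) [IsProbabilityMeasure μ]
    (J : ℕ) (hJ : 1 ≤ J) (α : ℝ) (hα₀ : 0 < α) (hα₂ : α < 2)
    (β p : Fin J → ℝ) (d : Fin J → ℤ → ℝ) (ε L : Fin J → ℤ → Ω → ℝ) (X : ℤ → Ω → ℝ)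
    (hX : StableAgg.IsStableAggregate μ α β p d ε L X) :
    -- characterisation for `α ≠ 1`
    (α ≠ 1 →
      (StableAgg.IsPastRepresentable μ α X ↔
        ∀ j, StableAgg.IsPastRepresentable μ α (L j)) ∧
      (StableAgg.IsPastRepresentable μ α X ↔ (⨆ j, StableAgg.m₀ (d j)) < ⊤) ∧
      (∀ m h : ℕ, 1 ≤ h →
        (StableAgg.IsPastRepresentableAt μ α X m h ↔
          (⨆ j, StableAgg.m₀ (d j)) < ⊤ ∧ (⨆ j, StableAgg.m₀ (d j)) ≤ (m : ℕ∞)))) ∧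
    -- characterisation for `α = 1`, whatever the time `t` and the semi-norms `N m h`
    (α = 1 →
      ∀ (t : ℤ) (N : ∀ m h : ℕ, Seminorm ℝ (StableAgg.PathSpace m h)),
        (∀ m h, StableAgg.IsPastSeminorm (N m h)) →
        (StableAgg.IsPastRepresentable μ α X ↔
          (⨆ j, StableAgg.m₀ (d j)) < ⊤ ∧
          ∃ m h : ℕ, (⨆ j, StableAgg.m₀ (d j)) ≤ (m : ℕ∞) ∧ 1 ≤ h ∧
            (StableAgg.IsSymm (StableAgg.pathLaw μ X m h t) ∨
              (¬ StableAgg.IsSymm (StableAgg.pathLaw μ X m h t) ∧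
                ∀ j, StableAgg.LogSummable (N m h) (d j)))) ∧
        (∀ m h : ℕ, (⨆ j, StableAgg.m₀ (d j)) ≤ (m : ℕ∞) → 1 ≤ h →
          (StableAgg.IsSymm (StableAgg.pathLaw μ X m h t) ∨
            (¬ StableAgg.IsSymm (StableAgg.pathLaw μ X m h t) ∧
              ∀ j, StableAgg.LogSummable (N m h) (d j))) →
          StableAgg.IsPastRepresentableAt μ α X m h)) ∧
    -- the spectral representation on the cylinder
    (∀ (m h : ℕ) (N : Seminorm ℝ (StableAgg.PathSpace m h)), 1 ≤ h →
      StableAgg.IsPastSeminorm N → StableAgg.IsPastRepresentableAt μ α X m h →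
      ∀ t : ℤ,
        -- the series of the shift vector converges, unless `α = 1` and the path is symmetric
        (¬ (α = 1 ∧ StableAgg.IsSymm (StableAgg.pathLaw μ X m h t)) →
          ∀ j, Summable (StableAgg.shiftTerm α β p d N j)) ∧
        -- where it converges, the formula gives the one and only spectral representation
        ((∀ j, Summable (StableAgg.shiftTerm α β p d N j)) →
          ∀ (Γ : Measure (StableAgg.PathSpace m h)) (b : StableAgg.PathSpace m h),
            StableAgg.IsSpectralRep α N (StableAgg.pathLaw μ X m h t) Γ b ↔
              Γ = StableAgg.cylinderMeasure α β p d N ∧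
              b = StableAgg.cylinderShift α β p d N) ∧
        -- for `α = 1` and a symmetric path, the shift is zero
        (α = 1 → StableAgg.IsSymm (StableAgg.pathLaw μ X m h t) →
          ∀ (Γ : Measure (StableAgg.PathSpace m h)) (b : StableAgg.PathSpace m h),
            StableAgg.IsSpectralRep α N (StableAgg.pathLaw μ X m h t) Γ b ↔
              Γ = StableAgg.cylinderMeasure α β p d N ∧ b = 0)) := by
  have hβ := hX.skewness
  have hd := hX.hasSummableGrowth
  refine ⟨fun hα => ⟨?_, hX.isPastRepresentable_iff hα₀ hα₂ hα, fun m h hh => ?_⟩, ?_, ?_⟩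
  · rw [hX.isPastRepresentable_iff hα₀ hα₂ hα, StableAgg.iSup_fin_lt_top_iff]
    refine forall_congr' fun j => ?_
    rw [(hX.single j).isPastRepresentable_iff hα₀ hα₂ hα, ciSup_const]
  · rw [hX.isPastRepresentableAt_iff hα₀ hα₂ hα hh]
    exact ⟨fun hle => ⟨hle.trans_lt (ENat.natCast_lt_top m), hle⟩, fun hle => hle.2⟩
  · rintro rfl t N hN
    refine ⟨⟨?_, ?_⟩, fun m h hle hh hcase =>
      (hX.isPastRepresentableAt_one_iff hh (hN m h) t).2 ⟨hle, hcase⟩⟩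
    · rintro ⟨m, h, hh, hr⟩
      obtain ⟨hle, hcase⟩ := (hX.isPastRepresentableAt_one_iff hh (hN m h) t).1 hr
      exact ⟨hle.trans_lt (ENat.natCast_lt_top m), m, h, hle, hh, hcase⟩
    · rintro ⟨-, m, h, hle, hh, hcase⟩
      exact ⟨m, h, hh, (hX.isPastRepresentableAt_one_iff hh (hN m h) t).2 ⟨hle, hcase⟩⟩
  · intro m h N _ hN hr t
    have hadm := StableAgg.isAdmissible_rawMeasure (m := m) (h := h) (S := Finset.univ) (p := p)
      hα₀ hβ hd
    have hν := hX.charFun_pathLaw hα₀ m h t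
    have hK := hX.kernel_eq_zero hα₀ hα₂ hr hN
    rw [← StableAgg.cylProj_rawMeasure α hβ hX.weight_pos N]
    refine ⟨fun hns j => ?_, fun hsum Γ b => ?_, fun _ hs Γ b =>
      StableAgg.isSpectralRep_iff_of_symm hα₀ hα₂ hadm hν hK hs Γ b⟩
    · by_cases hα : α = 1
      · subst hα
        exact StableAgg.summable_shiftTerm_of_integrable hβ
          (hX.integrable_log hr hN fun hs => hns ⟨rfl, hs⟩) j
      · exact StableAgg.summable_shiftTerm_of_ne_one hα N j
    · by_cases hα : α = 1
      · subst hα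
        by_cases hs : StableAgg.IsSymm (StableAgg.pathLaw μ X m h t)
        -- The true shift is 0. The formula agrees because it is the shift of the measure restricted
        -- to β_j ≠ 0, whose exponent is also real.
        · obtain ⟨hL, hshift⟩ := StableAgg.cylShift_rawMeasure_filter hβ hsum
          rw [StableAgg.isSpectralRep_iff_of_symm hα₀ hα₂ hadm hν hK hs, ← hshift,
            StableAgg.cylShift_eq_zero (StableAgg.isAdmissible_rawMeasure hα₀ hβ hd)
              (StableAgg.rawMeasure_kernel_subset hK) hL fun u => ?_]
          rw [StableAgg.specExponent_rawMeasure_im_filter hα₀ hβ hd]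
          exact StableAgg.specExponent_im_eq_zero hα₀ hadm hν hs u
        · have hL := hX.integrable_log hr hN hs
          rw [StableAgg.isSpectralRep_iff_of_integrable hadm hν hK hs hL,
            StableAgg.cylShift_rawMeasure hβ hL, StableAgg.cylinderShift]
      · rw [StableAgg.isSpectralRep_iff_of_ne_one hα₀ hα₂ hα hadm hν hK,
          StableAgg.cylinderShift_of_ne_one hα]
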